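/- Let $X=U/\Lambda$ be a complex abelian variety of dimension $n$, $\hat X$ its dual, $\mathcal P$ the Poincaré line bundle on $X\times\hat X$, $V=H^1(X,\mathbb Z)\oplus H^1(\hat X,\mathbb Z)$ with the pairing $((w_1,\theta_1),(w_2,\theta_2))_V=\theta_1(w_2)+\theta_2(w_1)$, where $H^1(\hat X,\mathbb Z)=H^1(X,\mathbb Z)^*$, and $C(V)$ its Clifford algebra, with $v_1v_2+v_2v_1=(v_1,v_2)_V$. Let $S=H^*(X,\mathbb Z)=\wedge^*H^1(X,\mathbb Z)$, $S^+=H^{even}(X,\mathbb Z)$, let $m:C(V)\to \mathrm{End}(S)$ be given by $m_{(w,\theta)}=w\wedge(\bullet)+\theta\rfloor(\bullet)$, and let $\mathrm{Spin}(V)=\{x\in C(V)^{even}: xx^*=1,\ xVx^*\subset V\}$. Let $\tau$ act on $H^i(X)$ by $(-1)^{i(i-1)/2}$ and set $(s,t)_S=\int_X\tau(s)\cup t$. Let $\phi: S_{\mathbb Q}\otimes S_{\mathbb Q}=H^*(X\times X,\mathbb Q)\to H^*(X\times\hat X,\mathbb Q)=\wedge^*V_{\mathbb Q}$ be the map on cohomology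 induced by Orlov's equivalence, i.e. $\phi(y)=\pi_{13,*}\big(\pi_{12}^*\mu^*y\cup\pi_{23}^*((-1)^n\exp(-c_1(\mathcal P)))\big)$, where $\mu(x,y)=(x+y,y)$ and $\pi_{ij}$ are the projections from $X\times X\times\hat X$. Set $\phi'=\phi\circ(id\otimes\tau)$. It is an isomorphism; for $g\in\mathrm{Spin}(V)$ put $\rho'_g=\phi'(m_g\otimes m_g)\phi'^{-1}$. For a field $F$ of characteristic $0$ let $F^k=\oplus_{i\ge k}H^i(X\times\hat X,F)$. For a subgroup $G\subset\mathrm{Spin}(V)$, a nonzero $\rho'(G)$-stable subspace $T\subset H^*(X\times\hat X,F)$ has weight $k$ if for every irreducible subrepresentation $T'\subset T$ the maximal integer $j$ with $T'\subset F^j$ equals $k$. Let $K=\mathbb Q(\sqrt{-d})$, $d\in\mathbb Q_{>0}$, be an imaginary quadratic field, with complex conjugation $\sigma$. An even pure spinor over $K$ is a nonzero $s\in S^+_K$ for which $\{v\in V_K: m_v(s)=0\}$ is a maximal isotropic subspace. Let $P\subset S^+_{\mathbb Q}$ be a $2$-dimensional subspace on which $(\bullet,\bullet)_S$ does not vanish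 identically, contained in $\oplus_pH^{p,p}(X,\mathbb Q)$, with $P_K=\tilde\ell_1\oplus\tilde\ell_2$, where $\tilde\ell_1,\tilde\ell_2\subset S^+_K$ are lines spanned by even pure spinors and $\tilde\ell_2=\sigma(\tilde\ell_1)$. Let $W_i=\{v\in V_K: m_v(\tilde\ell_i)=0\}$, and let $\mathrm{Spin}(V)_P\subset\mathrm{Spin}(V)$ be the subgroup fixing every vector of $P$. Let $HW_P\subset S_{\mathbb Q}\otimes S_{\mathbb Q}$ be the $2$-dimensional rational subspace corresponding to $HW_{P_K}=\tilde\ell_1^{\otimes2}\oplus\tilde\ell_2^{\otimes2}\subset S_K\otimes_K S_K$. (1) $\phi'(HW_P)$ is a $\mathrm{Spin}(V)_P$-subrepresentation of weight $2n$ of $H^*(X\times\hat X,\mathbb Q)$ via $\rho'$ (and likewise $\phi'(HW_{P_K})$ over $K$). The lines $\wedge^{2n}W_1$, $\wedge^{2n}W_2$ are independent, and the projection $\hat{HW}_P$ of $\phi'(HW_P)$ to $H^{2n}(X\times\hat X,\mathbb Q)$ is the $2$-dimensional rational subspace that corresponds to the subspace $\wedge^{2n}W_1\oplus\wedge^{2n}W_2$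 of $H^{2n}(X\times\hat X,K)$, that is, $\hat{HW}_P\otimes_{\mathbb Q} K=\wedge^{2n}W_1\oplus\wedge^{2n}W_2$. (2) Let $\ell_1\wedge\ell_2\subset\wedge^2S^+_K$ and $\ell_1\cdot\ell_2\subset \mathrm{Sym}^2S^+_K$ be the lines spanned by $\lambda_1\otimes\lambda_2\mp\lambda_2\otimes\lambda_1$, $0\ne\lambda_i\in\tilde\ell_i$. As $\mathrm{Spin}(V)_P$-subrepresentations of $H^*(X\times\hat X,K)$ via $\rho'$: if $n$ is even, $\phi'(\ell_1\wedge\ell_2)$ has weight $2$ and $\phi'(\ell_1\cdot\ell_2)$ has weight $0$; if $n$ is odd, $\phi'(\ell_1\cdot\ell_2)$ has weight $2$ and $\phi'(\ell_1\wedge\ell_2)$ has weight $0$. -/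

import Mathlib

open TensorProduct Module CliffordAlgebra

noncomputable section

/-! ### The lattice `V`, the Clifford algebra, the spin group and the spin representation

`R` is a commutative ring and `M` plays the role of `H¹(X, R)`, so that `Module.Dual R M` is
`H¹(X̂, R)` under the natural identification. -/

section Spin

variable (R M : Type*) [CommRing R] [AddCommGroup M] [Module R M]

/-- `V = H¹(X) ⊕ H¹(X̂)`. -/
abbrev VSpace : Type _ := M × Dual R M

/-- The pairing `((w₁, θ₁), (w₂, θ₂))_V = θ₁(w₂) + θ₂(w₁)`. -/
def pairV : LinearMap.BilinForm R (VSpace R M) :=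
  LinearMap.mk₂ R (fun v₁ v₂ => v₁.2 v₂.1 + v₂.2 v₁.1)
    (fun a b c => by simp; abel) (fun r a b => by simp; ring)
    (fun a b c => by simp; abel) (fun r a b => by simp; ring)

/-- The quadratic form `(w, θ) ↦ θ(w)`, that is, half of `(v, v)_V`. -/
def quadV : QuadraticForm R (VSpace R M) :=
  (QuadraticForm.dualProd R M).comp (LinearEquiv.prodComm R M (Dual R M)).toLinearMap

@[simp] lemma quadV_apply (v : VSpace R M) : quadV R M v = v.2 v.1 := rfl

/-- The Clifford algebra `C(V)`, with `v₁ v₂ + v₂ v₁ = (v₁, v₂)_V`. -/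
abbrev CliffV : Type _ := CliffordAlgebra (quadV R M)

/-- `Spin(V) = {x ∈ C(V)^even : x x^* = 1, x V x^* ⊆ V}`. Here `star` is the conjugation
`x ↦ x^*`, the composition of the main anti-automorphism and the main involution. -/
def SpinV : Submonoid (CliffV R M) where
  carrier := {x | x ∈ CliffordAlgebra.even (quadV R M) ∧ x * star x = 1 ∧
    ∀ v, ∃ v', x * ι (quadV R M) v * star x = ι (quadV R M) v'}
  one_mem' := ⟨Subalgebra.one_mem _, by simp, fun v => ⟨v, by simp⟩⟩
  mul_mem' := by
    rintro x y ⟨hx, hx1, hxV⟩ ⟨hy, hy1, hyV⟩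
    refine ⟨Subalgebra.mul_mem _ hx hy, ?_, fun v => ?_⟩
    · rw [star_mul, mul_assoc, ← mul_assoc y, hy1, one_mul, hx1]
    · obtain ⟨v₁, h₁⟩ := hyV v
      obtain ⟨v₂, h₂⟩ := hxV v₁
      refine ⟨v₂, ?_⟩
      rw [← h₂, ← h₁, star_mul]
      simp only [mul_assoc]

/-- Clifford multiplication `m_{(w, θ)} = L_w + D_θ` on `S = ∧^* H¹(X)`. -/
def mVec : VSpace R M →ₗ[R] Module.End R (ExteriorAlgebra R M) :=
  LinearMap.coprod (LinearMap.mul R (ExteriorAlgebra R M) ∘ₗ ExteriorAlgebra.ι R)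
    (contractLeft (Q := (0 : QuadraticForm R M)))

lemma mVec_mul_self (v : VSpace R M) :
    mVec R M v * mVec R M v = algebraMap R (Module.End R (ExteriorAlgebra R M)) (quadV R M v) := by
  obtain ⟨w, θ⟩ := v
  refine LinearMap.ext fun x => ?_
  have h1 : ExteriorAlgebra.ι R w * (ExteriorAlgebra.ι R w * x) = 0 := by
    rw [← mul_assoc, ExteriorAlgebra.ι_sq_zero, zero_mul]
  have h2 := contractLeft_ι_mul (Q := (0 : QuadraticForm R M)) (d := θ) w x
  have h3 := contractLeft_contractLeft (Q := (0 : QuadraticForm R M)) (d := θ) x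
  have h4 : ∀ y, mVec R M (w, θ) y =
      ExteriorAlgebra.ι R w * y + contractLeft (Q := (0 : QuadraticForm R M)) θ y := fun y => rfl
  rw [Module.End.mul_apply, h4, h4, map_add, mul_add, h1, h3, Module.algebraMap_end_apply,
    quadV_apply, zero_add, add_zero]
  exact (congrArg (_ + ·) h2).trans (add_sub_cancel _ _)

/-- The spin representation `m : C(V) → End(S)`. -/
def mCliff : CliffV R M →ₐ[R] Module.End R (ExteriorAlgebra R M) :=
  CliffordAlgebra.lift (quadV R M) ⟨mVec R M, mVec_mul_self R M⟩

/-- The map `V → V ⊗ ℚ`. -/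
def latticeToRat (M : Type*) [AddCommGroup M] : VSpace ℤ M →ₗ[ℤ] VSpace ℚ (ℚ ⊗[ℤ] M) :=
  LinearMap.prodMap (TensorProduct.mk ℤ ℚ M 1) (Module.Dual.baseChange ℚ)

/-- The map `C(V) → C(V_ℚ)`. -/
def cliffToRat (M : Type*) [AddCommGroup M] : CliffV ℤ M →ₐ[ℤ] CliffV ℚ (ℚ ⊗[ℤ] M) :=
  CliffordAlgebra.lift (quadV ℤ M)
    ⟨((ι (quadV ℚ (ℚ ⊗[ℤ] M))).restrictScalars ℤ) ∘ₗ latticeToRat M, fun v => by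
      have h : quadV ℚ (ℚ ⊗[ℤ] M) (latticeToRat M v) = ((quadV ℤ M v : ℤ) : ℚ) := by
        obtain ⟨w, θ⟩ := v
        change Module.Dual.baseChange ℚ θ ((1 : ℚ) ⊗ₜ[ℤ] w) = ((θ w : ℤ) : ℚ)
        simp
      rw [LinearMap.comp_apply, LinearMap.restrictScalars_apply, ι_sq_scalar, h]
      simp⟩

end Spin

/-! ### Extension of scalars from `ℚ` to a field `F` -/

section BaseChange

variable (F : Type*) [Field F] [CharZero F]

/-- The `F`-bilinear extension of a `ℚ`-bilinear map. -/
def bilinExt {A B C : Type*} [AddCommGroup A] [Module ℚ A] [AddCommGroup B] [Module ℚ B]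
    [AddCommGroup C] [Module ℚ C] (f : A →ₗ[ℚ] B →ₗ[ℚ] C) :
    (F ⊗[ℚ] A) →ₗ[F] (F ⊗[ℚ] B) →ₗ[F] (F ⊗[ℚ] C) :=
  (TensorProduct.mk F (F ⊗[ℚ] A) (F ⊗[ℚ] B)).compr₂
    ((TensorProduct.lift f).baseChange F ∘ₗ
      (AlgebraTensorModule.distribBaseChange ℚ F A B).symm.toLinearMap)

/-- `a ↦ 1 ⊗ a` -/
def toExt (A : Type*) [AddCommGroup A] [Module ℚ A] : A →ₗ[ℚ] F ⊗[ℚ] A :=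
  TensorProduct.mk ℚ F A 1

end BaseChange

/-! ### The complex torus `X = U / Λ` and its cohomology

`Λ = H₁(X, ℤ)`, the cohomology ring of a torus is the exterior algebra of its first cohomology,
and pullback by a homomorphism is induced by the pullback on first cohomology. -/

section Torus

variable {U : Type*} [NormedAddCommGroup U] [NormedSpace ℂ U] [FiniteDimensional ℂ U]
  (Λ : Submodule ℤ U)

/-- The complex torus `U / Λ` is an abelian variety: there is a positive definite Hermitian form
on `U` whose imaginary part is integral on `Λ`. -/
def IsPolarizable : Prop :=
  ∃ H : U →ₗ⋆[ℂ] U →ₗ[ℂ] ℂ, (∀ x y, H y x = starRingEnd ℂ (H x y)) ∧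
    (∀ x, x ≠ 0 → 0 < (H x x).re) ∧ ∀ x ∈ Λ, ∀ y ∈ Λ, ∃ k : ℤ, (H x y).im = k

/-- `H¹(X, ℤ)` -/
abbrev H1Z : Type _ := Dual ℤ Λ

/-- `H¹(X, ℚ)` -/
abbrev H1 : Type _ := ℚ ⊗[ℤ] H1Z Λ

/-- `H¹(X̂, ℚ)`, identified with the dual of `H¹(X, ℚ)`. -/
abbrev H1dual : Type _ := Dual ℚ (H1 Λ)

/-- `V_ℚ = H¹(X × X̂, ℚ)` -/
abbrev VQ : Type _ := VSpace ℚ (H1 Λ)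

/-- `S_ℚ = H^*(X, ℚ)` -/
abbrev SQ : Type _ := ExteriorAlgebra ℚ (H1 Λ)

/-- `H^*(X × X̂, ℚ) = ∧^* V_ℚ` -/
abbrev WedgeV : Type _ := ExteriorAlgebra ℚ (VQ Λ)

/-- `S⁺_ℚ = H^{even}(X, ℚ)` -/
def SPlus : Submodule ℚ (SQ Λ) := ⨆ i : ℕ, ⋀[ℚ]^(2 * i) (H1 Λ)

/-- The main anti-automorphism of `S_ℚ`, which acts by `(-1)^{i(i-1)/2}` on `H^i(X, ℚ)`. -/
def tauS : SQ Λ →ₗ[ℚ] SQ Λ := CliffordAlgebra.reverse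

/-! #### Hodge structure -/

/-- The value of a class in `H¹(X, ℂ)` on the elements of `H₁(X, ℤ)`. -/
def evalC : (ℂ ⊗[ℚ] H1 Λ) →ₗ[ℂ] (Λ → ℂ) :=
  LinearMap.pi fun l => Module.Dual.baseChange ℂ (Module.Dual.baseChange ℚ (Dual.eval ℤ Λ l))

/-- `H^{1,0}(X)`: classes that are restrictions to `Λ` of `ℂ`-linear forms on `U`. -/
def H10 : Submodule ℂ (ℂ ⊗[ℚ] H1 Λ) where
  carrier := {x | ∃ f : U →ₗ[ℂ] ℂ, ∀ l : Λ, evalC Λ x l = f l}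
  zero_mem' := ⟨0, by simp⟩
  add_mem' := by
    rintro x y ⟨f, hf⟩ ⟨g, hg⟩
    exact ⟨f + g, fun l => by simp [hf, hg]⟩
  smul_mem' := by
    rintro c x ⟨f, hf⟩
    exact ⟨c • f, fun l => by simp [hf]⟩

/-- `H^{0,1}(X)`: classes that are restrictions to `Λ` of `ℂ`-antilinear forms on `U`. -/
def H01 : Submodule ℂ (ℂ ⊗[ℚ] H1 Λ) where
  carrier := {x | ∃ f : U →ₗ⋆[ℂ] ℂ, ∀ l : Λ, evalC Λ x l = f l}
  zero_mem' := ⟨0, by simp⟩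
  add_mem' := by
    rintro x y ⟨f, hf⟩ ⟨g, hg⟩
    exact ⟨f + g, fun l => by simp [hf, hg]⟩
  smul_mem' := by
    rintro c x ⟨f, hf⟩
    exact ⟨c • f, fun l => by simp [hf]⟩

/-- The inclusion of `H¹(X, ℂ)` in the algebra `H^*(X, ℂ)`. -/
def iotaC : (ℂ ⊗[ℚ] H1 Λ) →ₗ[ℂ] (ℂ ⊗[ℚ] SQ Λ) := (ExteriorAlgebra.ι ℚ).baseChange ℂ

/-- `H^{p,q}(X) = ∧^p H^{1,0}(X) ∧ ∧^q H^{0,1}(X)`, a subspace of `H^*(X, ℂ)`. -/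
def Hpq (p q : ℕ) : Submodule ℂ (ℂ ⊗[ℚ] SQ Λ) :=
  (H10 Λ).map (iotaC Λ) ^ p * (H01 Λ).map (iotaC Λ) ^ q

/-- The Hodge ring `⨁_p H^{p,p}(X, ℚ)`, where `H^{p,p}(X, ℚ)` consists of the rational classes
in `H^{p,p}(X)`. -/
def HodgeRing : Submodule ℚ (SQ Λ) :=
  ⨆ p : ℕ, ((Hpq Λ p p).restrictScalars ℚ).comap (toExt ℂ (SQ Λ))

/-! #### Integration -/

/-- Contraction with the functionals `δ 0`, `δ 1`, … in this order. -/
def contractAll {N : Type*} [AddCommGroup N] [Module ℚ N] {r : ℕ} (δ : Fin r → Dual ℚ N) :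
    ExteriorAlgebra ℚ N →ₗ[ℚ] ExteriorAlgebra ℚ N :=
  (List.ofFn δ).foldl (fun f d => contractLeft (Q := (0 : QuadraticForm ℚ N)) d ∘ₗ f)
    LinearMap.id

variable [DiscreteTopology Λ] [IsZLattice ℝ Λ]

lemma finrank_lattice : finrank ℤ Λ = finrank ℂ U * 2 := by
  rw [ZLattice.rank ℝ Λ, finrank_real_of_complex, mul_comm]

/-- A basis of `Λ = H₁(X, ℤ)`. -/
def latticeBasis : Basis (Fin (finrank ℂ U * 2)) ℤ Λ :=
  Module.finBasisOfFinrankEq ℤ Λ (finrank_lattice Λ)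

/-- The dual basis `e_i` of `H¹(X, ℚ)`. -/
def eBasis : Basis (Fin (finrank ℂ U * 2)) ℚ (H1 Λ) :=
  (latticeBasis Λ).dualBasis.baseChange ℚ

/-- A real basis `u₁, i u₁, u₂, i u₂, …` of `U`, which defines the complex orientation. -/
def complexBasis (U : Type*) [NormedAddCommGroup U] [NormedSpace ℂ U] [FiniteDimensional ℂ U] :
    Basis (Fin (finrank ℂ U * 2)) ℝ U :=
  (Complex.basisOneI.smulTower (Module.finBasis ℂ U)).reindex
    ((Equiv.prodComm _ _).trans finProdFinEquiv)

/-- `1` or `-1`, according to whether the chosen basis of `Λ` is positively oriented or not. -/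
def orientationSign : ℚ :=
  ((SignType.sign ((complexBasis U).det fun i => (latticeBasis Λ i : U)) : ℤ) : ℚ)

/-- Integration `∫_X : H^*(X, ℚ) → ℚ`. -/
def integralX : SQ Λ →ₗ[ℚ] ℚ :=
  orientationSign Λ •
    (ExteriorAlgebra.algebraMapInv.toLinearMap ∘ₗ contractAll fun i => (eBasis Λ).coord i)

/-- The pairing `(s, t)_S = ∫_X τ(s) ∪ t`. -/
def pairS (s t : SQ Λ) : ℚ := integralX Λ (tauS Λ s * t)

/-! #### Orlov's isomorphism -/

/-- `H¹(X × X × X̂, ℚ)` -/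
abbrev H1triple : Type _ := H1 Λ × H1 Λ × H1dual Λ

/-- The pushforward `π_{13,*} : H^*(X × X × X̂, ℚ) → H^*(X × X̂, ℚ)`: integration over the second
factor. -/
def push13 : ExteriorAlgebra ℚ (H1triple Λ) →ₗ[ℚ] WedgeV Λ :=
  orientationSign Λ •
    ((ExteriorAlgebra.map (LinearMap.prodMap LinearMap.id
        (LinearMap.snd ℚ (H1 Λ) (H1dual Λ)))).toLinearMap ∘ₗ
      contractAll fun i =>
        (eBasis Λ).coord i ∘ₗ LinearMap.fst ℚ (H1 Λ) (H1dual Λ) ∘ₗ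
          LinearMap.snd ℚ (H1 Λ) (H1 Λ × H1dual Λ))

/-- `π_{12}^* : H^*(X × X, ℚ) → H^*(X × X × X̂, ℚ)` -/
def pull12 : ExteriorAlgebra ℚ (H1 Λ × H1 Λ) →ₐ[ℚ] ExteriorAlgebra ℚ (H1triple Λ) :=
  ExteriorAlgebra.map
    (LinearMap.prodMap LinearMap.id (LinearMap.inl ℚ (H1 Λ) (H1dual Λ)))

/-- `π_{23}^* : H^*(X × X̂, ℚ) → H^*(X × X × X̂, ℚ)` -/
def pull23 : WedgeV Λ →ₐ[ℚ] ExteriorAlgebra ℚ (H1triple Λ) :=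
  ExteriorAlgebra.map (LinearMap.inr ℚ (H1 Λ) (H1 Λ × H1dual Λ))

/-- The first Chern class `∑ e_i ∧ f_i` of the Poincaré line bundle on `X × X̂`, where `f_i` is
the basis of `H¹(X̂, ℚ)` dual to `e_i`. -/
def c1Poincare : WedgeV Λ :=
  ∑ i, ExteriorAlgebra.ι ℚ (eBasis Λ i, 0) * ExteriorAlgebra.ι ℚ (0, (eBasis Λ).coord i)

/-- The Chern character `(-1)^n exp(-c₁(𝒫))` of `𝒫⁻¹[n]`. -/
def chPoincareInv : WedgeV Λ :=
  (-1) ^ finrank ℂ U * IsNilpotent.exp (-c1Poincare Λ)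

/-- The Künneth isomorphism `s ⊗ t ↦ π₁^* s ∪ π₂^* t` from `S ⊗ S` to `H^*(X × X, ℚ)`. -/
def kunneth : SQ Λ ⊗[ℚ] SQ Λ →ₗ[ℚ] ExteriorAlgebra ℚ (H1 Λ × H1 Λ) :=
  TensorProduct.lift ((LinearMap.mul ℚ _).compl₁₂
    (ExteriorAlgebra.map (LinearMap.inl ℚ (H1 Λ) (H1 Λ))).toLinearMap
    (ExteriorAlgebra.map (LinearMap.inr ℚ (H1 Λ) (H1 Λ))).toLinearMap)

/-- Pullback by `μ : X × X → X × X`, `μ(x, y) = (x + y, y)`. On first cohomology it sends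
`π₁^* a + π₂^* b` to `π₁^* a + π₂^* (a + b)`. -/
def muPull : ExteriorAlgebra ℚ (H1 Λ × H1 Λ) →ₐ[ℚ] ExteriorAlgebra ℚ (H1 Λ × H1 Λ) :=
  ExteriorAlgebra.map ((LinearMap.fst ℚ (H1 Λ) (H1 Λ)).prod
    (LinearMap.fst ℚ (H1 Λ) (H1 Λ) + LinearMap.snd ℚ (H1 Λ) (H1 Λ)))

/-- The action of `id × Ψ_{𝒫⁻¹[n]}` on cohomology,
`y ↦ π_{13,*}(π_{12}^* y ∪ π_{23}^* ch(𝒫⁻¹[n]))`. -/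
def idPsi : ExteriorAlgebra ℚ (H1 Λ × H1 Λ) →ₗ[ℚ] WedgeV Λ :=
  push13 Λ ∘ₗ (LinearMap.mul ℚ _).flip (pull23 Λ (chPoincareInv Λ)) ∘ₗ (pull12 Λ).toLinearMap

/-- The isomorphism `φ : S ⊗ S → ∧^* V` induced by Orlov's equivalence
`Φ = (id × Ψ_{𝒫⁻¹[n]}) ∘ μ^*`. -/
def phi : SQ Λ ⊗[ℚ] SQ Λ →ₗ[ℚ] WedgeV Λ :=
  idPsi Λ ∘ₗ (muPull Λ).toLinearMap ∘ₗ kunneth Λ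

/-- `φ' = φ ∘ (id ⊗ τ)` -/
def phiTau : SQ Λ ⊗[ℚ] SQ Λ →ₗ[ℚ] WedgeV Λ :=
  phi Λ ∘ₗ TensorProduct.map LinearMap.id (tauS Λ)

/-! #### The representation `ρ'` of the integral spin group -/

/-- `Spin(V)` for the lattice `V = H¹(X, ℤ) ⊕ H¹(X̂, ℤ)`. -/
abbrev SpinVZ : Submonoid (CliffV ℤ (H1Z Λ)) := SpinV ℤ (H1Z Λ)

/-- The action `m_g` on `S_ℚ` of an element `g` of the integral Clifford algebra. -/
def mZ (g : CliffV ℤ (H1Z Λ)) : SQ Λ →ₗ[ℚ] SQ Λ := mCliff ℚ (H1 Λ) (cliffToRat (H1Z Λ) g)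

/-- `ρ'_g = φ' (m_g ⊗ m_g) φ'⁻¹` -/
def rhoPrime (g : CliffV ℤ (H1Z Λ)) : WedgeV Λ →ₗ[ℚ] WedgeV Λ :=
  phiTau Λ ∘ₗ TensorProduct.map (mZ Λ g) (mZ Λ g) ∘ₗ (phiTau Λ).leftInverse

/-- `Spin(V)_P`, the elements of `Spin(V)` that fix every vector of `P`. -/
def SpinVP (P : Submodule ℚ (SQ Λ)) : Submonoid (CliffV ℤ (H1Z Λ)) where
  carrier := {g | g ∈ SpinVZ Λ ∧ ∀ p ∈ P, mZ Λ g p = p}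
  one_mem' := ⟨one_mem _, fun p _ => by simp [mZ]⟩
  mul_mem' := by
    rintro g h ⟨hg, hgP⟩ ⟨hh, hhP⟩
    refine ⟨mul_mem hg hh, fun p hp => ?_⟩
    have : mZ Λ (g * h) p = mZ Λ g (mZ Λ h p) := by simp [mZ]
    rw [this, hhP p hp, hgP p hp]

section Coefficients

variable (F : Type*) [Field F] [CharZero F]

/-- `H^*(X × X̂, F)` -/
abbrev WedgeF : Type _ := F ⊗[ℚ] WedgeV Λ

/-- `H^*(X × X, F) = S_F ⊗_F S_F` -/
abbrev SSF : Type _ := F ⊗[ℚ] (SQ Λ ⊗[ℚ] SQ Λ)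

/-- `H^i(X × X̂, F)` -/
def HF (i : ℕ) : Submodule F (WedgeF Λ F) := (⋀[ℚ]^i (VQ Λ)).baseChange F

/-- The decreasing filtration `F^k = ⨁_{i ≥ k} H^i(X × X̂, F)`. -/
def filF (k : ℕ) : Submodule F (WedgeF Λ F) := ⨆ i : ℕ, ⨆ _ : k ≤ i, HF Λ F i

/-- The extension of `φ'` to `F`. -/
def phiF : SSF Λ F →ₗ[F] WedgeF Λ F := (phiTau Λ).baseChange F

/-- `V_F` -/
abbrev VF : Type _ := F ⊗[ℚ] VQ Λ

/-- `S_F = H^*(X, F)` -/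
abbrev SF : Type _ := F ⊗[ℚ] SQ Λ

/-- The pairing on `V_F`. -/
def pairVF : LinearMap.BilinForm F (VF Λ F) :=
  (bilinExt F (pairV ℚ (H1 Λ))).compr₂ (AlgebraTensorModule.rid ℚ F F).toLinearMap

/-- The exterior product `S_F × S_F → S_F ⊗ S_F`. -/
def tmulF : SF Λ F →ₗ[F] SF Λ F →ₗ[F] SSF Λ F := bilinExt F (TensorProduct.mk ℚ (SQ Λ) (SQ Λ))

end Coefficients

/-! #### Weights, pure spinors and rational secants -/

section Field

variable {F : Type*} [Field F] [CharZero F]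

/-- The kernel of `m_s : V_F → S_F`, `v ↦ m_v(s)`, for `s ∈ S_F`. -/
def kerM (s : SF Λ F) : Submodule F (VF Λ F) :=
  LinearMap.ker ((bilinExt F (mVec ℚ (H1 Λ))).flip s)

/-- `T` is a subrepresentation of `H^*(X × X̂, F)` under the action `ρ'` of `G`. -/
def IsSubrep (G : Submonoid (CliffV ℤ (H1Z Λ))) (T : Submodule F (WedgeF Λ F)) : Prop :=
  ∀ g ∈ G, ∀ x ∈ T, (rhoPrime Λ g).baseChange F x ∈ T

/-- `T` is an irreducible subrepresentation of `H^*(X × X̂, F)`. -/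
def IsIrredSubrep (G : Submonoid (CliffV ℤ (H1Z Λ))) (T : Submodule F (WedgeF Λ F)) : Prop :=
  IsSubrep Λ G T ∧ T ≠ ⊥ ∧ ∀ T' ≤ T, IsSubrep Λ G T' → T' = ⊥ ∨ T' = T

/-- `T` is a nonzero subrepresentation of weight `k`: for every irreducible subrepresentation `T'`
of `T`, the maximal integer `j` with `T' ⊆ F^j` is `k`. -/
def HasWeight (G : Submonoid (CliffV ℤ (H1Z Λ))) (T : Submodule F (WedgeF Λ F)) (k : ℕ) : Prop :=
  IsSubrep Λ G T ∧ T ≠ ⊥ ∧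
    ∀ T' ≤ T, IsIrredSubrep Λ G T' → IsGreatest {j : ℕ | T' ≤ filF Λ F j} k

/-- `W ⊆ V_F` is a maximal isotropic subspace. -/
def IsMaxIsotropic (W : Submodule F (VF Λ F)) : Prop :=
  Maximal (fun W' : Submodule F (VF Λ F) => ∀ x ∈ W', ∀ y ∈ W', pairVF Λ F x y = 0) W

/-- `s ∈ S_F` is an even pure spinor. -/
def IsEvenPureSpinor (s : SF Λ F) : Prop :=
  s ∈ (SPlus Λ).baseChange F ∧ s ≠ 0 ∧ IsMaxIsotropic Λ (kerM Λ s)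

/-- The line `l` in `S⁺_F` is spanned by an even pure spinor. -/
def IsPureSpinorLine (l : Submodule F (SF Λ F)) : Prop :=
  ∃ s, IsEvenPureSpinor Λ s ∧ l = Submodule.span F {s}

/-- The isotropic subspace `W ⊆ V_F` of the vectors that annihilate the line `l ⊆ S_F`. -/
def annW (l : Submodule F (SF Λ F)) : Submodule F (VF Λ F) := ⨅ s ∈ l, kerM Λ s

/-- `∧^k W` as a subspace of `H^k(X × X̂, F) = ∧^k V_F`, for `W ⊆ V_F`. -/
def wedgePow (W : Submodule F (VF Λ F)) (k : ℕ) : Submodule F (WedgeF Λ F) :=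
  W.map ((ExteriorAlgebra.ι ℚ).baseChange F) ^ k

/-- `l₁ ⊗ l₂` -/
def tensorLines (l₁ l₂ : Submodule F (SF Λ F)) : Submodule F (SSF Λ F) :=
  Submodule.span F {z | ∃ x ∈ l₁, ∃ y ∈ l₂, z = tmulF Λ F x y}

/-- `l₁ ∧ l₂`, a subspace of `∧² S_F ⊆ S_F ⊗ S_F`. -/
def wedgeLines (l₁ l₂ : Submodule F (SF Λ F)) : Submodule F (SSF Λ F) :=
  Submodule.span F {z | ∃ x ∈ l₁, ∃ y ∈ l₂, z = tmulF Λ F x y - tmulF Λ F y x}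

/-- `l₁ · l₂`, a subspace of `Sym² S_F ⊆ S_F ⊗ S_F`. -/
def symLines (l₁ l₂ : Submodule F (SF Λ F)) : Submodule F (SSF Λ F) :=
  Submodule.span F {z | ∃ x ∈ l₁, ∃ y ∈ l₂, z = tmulF Λ F x y + tmulF Λ F y x}

/-- `HW_{P_F} = l₁^{⊗2} ⊕ l₂^{⊗2}` -/
def HWF (l₁ l₂ : Submodule F (SF Λ F)) : Submodule F (SSF Λ F) :=
  tensorLines Λ l₁ l₁ ⊔ tensorLines Λ l₂ l₂

/-- `HW_P`: the rational subspace of `S_ℚ ⊗ S_ℚ` that consists of the rational vectors of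
`HW_{P_F}`. -/
def HW (l₁ l₂ : Submodule F (SF Λ F)) : Submodule ℚ (SQ Λ ⊗[ℚ] SQ Λ) :=
  ((HWF Λ l₁ l₂).restrictScalars ℚ).comap (toExt F (SQ Λ ⊗[ℚ] SQ Λ))

/-- `hatHW_P`: the projection of `φ'(HW_P)` to `H^{2n}(X × X̂, ℚ)`, `n = dim X`. -/
def HatHW (l₁ l₂ : Submodule F (SF Λ F)) : Submodule ℚ (WedgeV Λ) :=
  ((HW Λ l₁ l₂).map (phiTau Λ)).map
    (GradedAlgebra.proj (fun j : ℕ => ⋀[ℚ]^j (VQ Λ)) (2 * finrank ℂ U))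

/-- The rational plane `P ⊆ S_ℚ` is non-isotropic, is contained in the Hodge ring of `X`, and
`ℙ(P)` is the secant line of the spinor variety through the two points `l₁`, `l₂`, which are
defined over `F` and conjugate under `σ`. -/
structure IsRationalSecant (σ : F ≃ₐ[ℚ] F) (P : Submodule ℚ (SQ Λ))
    (l₁ l₂ : Submodule F (SF Λ F)) : Prop where
  finrank_eq : finrank ℚ P = 2
  nonisotropic : ∃ s ∈ P, ∃ t ∈ P, pairS Λ s t ≠ 0
  hodge : P ≤ HodgeRing Λ
  pure₁ : IsPureSpinorLine Λ l₁
  pure₂ : IsPureSpinorLine Λ l₂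
  conj : ∀ s, s ∈ l₁ ↔ σ.toLinearMap.rTensor (SQ Λ) s ∈ l₂
  span_eq : P.baseChange F = l₁ ⊔ l₂

end Field

end Torus

end

/-! Write `α` for the grading involution `involute`. Under `φ'`, Clifford multiplication on `S ⊗ S`
turns into exterior multiplication and contraction on `∧^* V`. For `v = (w, θ)`, `φ'(m_v a ⊗ b) =
(w, 0) ∧ φ'(a ⊗ b) + (v, •)_V ⌋ φ'(a ⊗ b)` (`orlovMap_mVec_tmul`), `v ∧ φ'(a ⊗ b) = φ'(m_v a ⊗ b) -
φ'(α a ⊗ m_v α b)` (`ι_mul_orlovMap`). Two facts give these formulas: contracting `exp(-c₁(𝒫))`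
amounts to multiplying it by a vector, and the fibre integral of a contraction along the fibre
vanishes. By the second formula the range of `φ'` is stable under multiplication by vectors; it
contains `1`, so `φ'` is onto, and bijective by dimension (`orlovMap_bijective`).

Let `a` be an even pure spinor with annihilator `W`, and put `y = φ'(a ⊗ a)`. For `u ∈ W` the
formulas give `u ∧ y = 0` and `(u, •) ⌋ y = -(fst u) ∧ y`. The last product raises degree, so the
lowest nonzero component of `y` is killed by multiplication and by contraction with `W`. As `W` is
Lagrangian, the number operator in a basis adapted to `W` acts on this component both by its degree
and by `dim W = 2n`. So `y` begins in degree `2n`, with a generator of `∧^{2n} W`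
(`pureSpinor_square`). Different Lagrangians give independent lines (`disjoint_span`).

On even classes the degree `0` part of `φ'(a ⊗ b)` is `(a, b)_S`, which is `(-1)^n`-symmetric. Here
`n > 0`, so by the previous paragraph pure spinors `a`, `b` spanning the two lines are isotropic,
and non-isotropy of `P` forces `(a, b)_S ≠ 0`. Hence `a ⊗ b + (-1)^n b ⊗ a` has a nonzero component
in degree `0`. With the opposite sign, degree `0` cancels, degree `1` vanishes by parity, and
contracting the degree `2` part with `v ∈ W₁` gives a nonzero multiple of `v` (`pureSpinor_mixed`).

The group `Spin(V)_P` fixes `P_K` pointwise, so all the subspaces in question consist of invariants.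
For such a nonzero space, lying in `F^k` and meeting `F^{k+1}` only in `0` gives weight `k`
(`hasWeight_of_invariant`). The rational statements follow by descent from the quadratic field
(`baseChange_comap_toExt`). -/

set_option linter.unusedSectionVars false

noncomputable section

/-! ### Sign rules for contraction, involution and reversal -/

section ExteriorContraction

variable {R M N : Type*} [CommRing R] [AddCommGroup M] [Module R M] [AddCommGroup N] [Module R N]

/-- The sign of moving a vector past `x` is stored in `involute x`, so `x` need not be homogeneous.
All later sign bookkeeping uses this form. -/
lemma ext_ι_mul (w : M) (x : ExteriorAlgebra R M) :
    ExteriorAlgebra.ι R w * x = involute x * ExteriorAlgebra.ι R w := by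
  induction x using CliffordAlgebra.left_induction with
  | algebraMap r => simp [Algebra.commutes]
  | add x y hx hy => rw [mul_add, hx, hy, map_add, add_mul]
  | ι_mul x m hx =>
    have h1 : ExteriorAlgebra.ι R w * ι (0 : QuadraticForm R M) m =
        -(ι (0 : QuadraticForm R M) m * ExteriorAlgebra.ι R w) :=
      eq_neg_of_add_eq_zero_left (ExteriorAlgebra.ι_add_mul_swap w m)
    rw [map_mul, involute_ι, mul_assoc, ← hx]
    exact (mul_assoc _ _ _).symm.trans ((congrArg (· * x) h1).trans (by
      rw [neg_mul, neg_mul, mul_assoc]))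

lemma contractLeft_ι_mul' (d : Dual R M) (w : M) (x : ExteriorAlgebra R M) :
    contractLeft (Q := (0 : QuadraticForm R M)) d (ExteriorAlgebra.ι R w * x) =
      d w • x - ExteriorAlgebra.ι R w * contractLeft (Q := (0 : QuadraticForm R M)) d x :=
  contractLeft_ι_mul (Q := (0 : QuadraticForm R M)) (d := d) w x

/-- Contraction is an odd derivation, so passing `x` costs the involution. -/
lemma contractLeft_mul (d : Dual R M) (x y : ExteriorAlgebra R M) :
    contractLeft (Q := (0 : QuadraticForm R M)) d (x * y) =
      contractLeft (Q := (0 : QuadraticForm R M)) d x * y +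
        involute x * contractLeft (Q := (0 : QuadraticForm R M)) d y := by
  induction x using CliffordAlgebra.left_induction with
  | algebraMap r => 
    rw [contractLeft_algebraMap_mul, contractLeft_algebraMap, zero_mul, zero_add, AlgHom.commutes]
  | add x y hx hy => simp only [add_mul, map_add, hx, hy]; abel
  | ι_mul x m hx =>
    have h1 := contractLeft_ι_mul (Q := (0 : QuadraticForm R M)) (d := d) m (x * y)
    have h2 := contractLeft_ι_mul (Q := (0 : QuadraticForm R M)) (d := d) m x
    rw [mul_assoc, h1, h2, hx, map_mul, involute_ι, sub_mul, smul_mul_assoc, mul_add]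
    noncomm_ring

lemma map_contractLeft (f : M →ₗ[R] N) (d : Dual R N) (x : ExteriorAlgebra R M) :
    contractLeft (Q := (0 : QuadraticForm R N)) d (ExteriorAlgebra.map f x) =
      ExteriorAlgebra.map f (contractLeft (Q := (0 : QuadraticForm R M)) (d ∘ₗ f) x) := by
  induction x using CliffordAlgebra.left_induction with
  | algebraMap r => 
    rw [contractLeft_algebraMap, AlgHom.commutes]
    exact (contractLeft_algebraMap (Q := (0 : QuadraticForm R N)) d r).trans (map_zero _).symm
  | add x y hx hy => simp only [map_add, hx, hy]
  | ι_mul x m hx =>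
    have h0 : ExteriorAlgebra.map f (ι (0 : QuadraticForm R M) m) = ExteriorAlgebra.ι R (f m) :=
      ExteriorAlgebra.map_apply_ι f m
    rw [map_mul, h0, contractLeft_ι_mul', hx, contractLeft_ι_mul, map_sub, map_mul, h0, map_smul]
    rfl

lemma map_involute (f : M →ₗ[R] N) (x : ExteriorAlgebra R M) :
    involute (ExteriorAlgebra.map f x) = ExteriorAlgebra.map f (involute x) := by
  induction x using CliffordAlgebra.left_induction with
  | algebraMap r => 
    have h1 : involute (algebraMap R (ExteriorAlgebra R N) r) = algebraMap _ _ r :=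
      AlgHom.commutes (involute (Q := (0 : QuadraticForm R N))) r
    have h2 : ExteriorAlgebra.map f (algebraMap R (ExteriorAlgebra R M) r) = algebraMap _ _ r :=
      AlgHom.commutes _ r
    have h3 : involute (algebraMap R (ExteriorAlgebra R M) r) = algebraMap _ _ r :=
      AlgHom.commutes (involute (Q := (0 : QuadraticForm R M))) r
    rw [h3, h2, h1]
  | add x y hx hy => simp only [map_add, hx, hy]
  | ι_mul x m hx =>
    have h0 : ExteriorAlgebra.map f (ι (0 : QuadraticForm R M) m) = ι _ (f m) :=
      ExteriorAlgebra.map_apply_ι f m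
    rw [map_mul, map_mul, map_mul, map_mul, hx, h0, involute_ι, involute_ι, map_neg, h0]

lemma contractLeft_involute (d : Dual R M) (x : ExteriorAlgebra R M) :
    contractLeft (Q := (0 : QuadraticForm R M)) d (involute x) =
      -involute (contractLeft (Q := (0 : QuadraticForm R M)) d x) := by
  induction x using CliffordAlgebra.left_induction with
  | algebraMap r => rw [AlgHom.commutes, contractLeft_algebraMap, map_zero, neg_zero]
  | add x y hx hy => simp only [map_add, hx, hy, neg_add]
  | ι_mul x m hx =>
    rw [map_mul, involute_ι, neg_mul, map_neg, contractLeft_ι_mul, hx, contractLeft_ι_mul, map_sub,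
      map_mul, map_smul, involute_ι]
    noncomm_ring

lemma involute_reverse (x : ExteriorAlgebra R M) :
    involute (reverse x) = reverse (involute x) := (reverse_involute _).symm

/-- In degree `k` the reversal signs before and after the contraction differ by `(-1)^(k-1)`, which
is the involution on the contracted class. -/
lemma contractLeft_reverse (d : Dual R M) (x : ExteriorAlgebra R M) :
    contractLeft (Q := (0 : QuadraticForm R M)) d (reverse x) =
      reverse (involute (contractLeft (Q := (0 : QuadraticForm R M)) d x)) := by
  induction x using CliffordAlgebra.left_induction with
  | algebraMap r => rw [reverse.commutes, contractLeft_algebraMap, map_zero, map_zero]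
  | add x y hx hy => simp only [map_add, hx, hy]
  | ι_mul x m hx =>
    rw [reverse.map_mul, reverse_ι, contractLeft_mul, hx, contractLeft_ι, contractLeft_ι_mul,
      map_sub, map_sub, map_mul, reverse.map_mul, involute_ι, map_neg, reverse_ι, map_smul,
      map_smul, involute_reverse, mul_neg, sub_neg_eq_add, add_comm, ← Algebra.commutes,
      ← Algebra.smul_def]

lemma algebraMapInv_ι_mul (w : M) (x : ExteriorAlgebra R M) :
    ExteriorAlgebra.algebraMapInv (ExteriorAlgebra.ι R w * x) = 0 := by
  rw [map_mul]
  simp [ExteriorAlgebra.algebraMapInv]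

lemma algebraMapInv_involute (x : ExteriorAlgebra R M) :
    ExteriorAlgebra.algebraMapInv (involute x) = ExteriorAlgebra.algebraMapInv x := by
  induction x using CliffordAlgebra.left_induction with
  | algebraMap r => rw [AlgHom.commutes]
  | add x y hx hy => simp only [map_add, hx, hy]
  | ι_mul x m hx =>
    rw [map_mul, involute_ι, neg_mul, map_neg, map_mul, map_mul]
    simp [ExteriorAlgebra.algebraMapInv]

lemma algebraMapInv_reverse (x : ExteriorAlgebra R M) :
    ExteriorAlgebra.algebraMapInv (reverse x) = ExteriorAlgebra.algebraMapInv x := by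
  induction x using CliffordAlgebra.left_induction with
  | algebraMap r => rw [reverse.commutes]
  | add x y hx hy => simp only [map_add, hx, hy]
  | ι_mul x m hx =>
    rw [reverse.map_mul, reverse_ι, map_mul, map_mul]
    simp [ExteriorAlgebra.algebraMapInv]

lemma algebraMapInv_map (f : M →ₗ[R] N) (x : ExteriorAlgebra R M) :
    ExteriorAlgebra.algebraMapInv (ExteriorAlgebra.map f x) = ExteriorAlgebra.algebraMapInv x := by
  have : (ExteriorAlgebra.algebraMapInv (R := R) (M := N)).comp (ExteriorAlgebra.map f) =
      ExteriorAlgebra.algebraMapInv := by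
    ext; simp [ExteriorAlgebra.algebraMapInv]
  exact DFunLike.congr_fun this x

end ExteriorContraction

/-! ### Iterated contractions (fibre integrals) -/

section ContractAll

variable {M N : Type*} [AddCommGroup M] [Module ℚ M] [AddCommGroup N] [Module ℚ N]

@[simp] lemma contractAll_zero (δ : Fin 0 → Dual ℚ M) (x : ExteriorAlgebra ℚ M) :
    contractAll δ x = x := by
  simp [contractAll]

lemma contractAll_succ {r : ℕ} (δ : Fin (r + 1) → Dual ℚ M) (x : ExteriorAlgebra ℚ M) :
    contractAll δ x = contractAll (fun i => δ i.succ)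
      (contractLeft (Q := (0 : QuadraticForm ℚ M)) (δ 0) x) := by
  -- The contractions already performed accumulate in `f`; the recursion needs them split off as a
  -- right factor.
  have key : ∀ (l : List (Dual ℚ M)) (f : ExteriorAlgebra ℚ M →ₗ[ℚ] ExteriorAlgebra ℚ M),
      l.foldl (fun f d => contractLeft (Q := (0 : QuadraticForm ℚ M)) d ∘ₗ f) f =
        l.foldl (fun f d => contractLeft (Q := (0 : QuadraticForm ℚ M)) d ∘ₗ f)
          LinearMap.id ∘ₗ f := by
    intro l
    induction l with
    | nil => intro f; simp
    | cons d l ih =>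
      intro f
      rw [List.foldl_cons, ih, List.foldl_cons, ih (_ ∘ₗ LinearMap.id), LinearMap.comp_id,
        LinearMap.comp_assoc]
  unfold contractAll
  rw [List.ofFn_succ, List.foldl_cons, key, LinearMap.comp_id, LinearMap.comp_apply]

lemma contractAll_ι_mul {r : ℕ} (δ : Fin r → Dual ℚ M) (u : M) (hu : ∀ i, δ i u = 0)
    (x : ExteriorAlgebra ℚ M) :
    contractAll δ (ExteriorAlgebra.ι ℚ u * x) =
      (-1 : ℚ) ^ r • (ExteriorAlgebra.ι ℚ u * contractAll δ x) := by
  induction r generalizing x with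
  | zero => simp
  | succ r ih =>
    rw [contractAll_succ, contractLeft_ι_mul', hu, zero_smul, zero_sub, map_neg,
      ih _ (fun i => hu _), contractAll_succ, pow_succ]
    simp

lemma contractAll_contractLeft {r : ℕ} (δ : Fin r → Dual ℚ M) (d : Dual ℚ M)
    (x : ExteriorAlgebra ℚ M) :
    contractAll δ (contractLeft (Q := (0 : QuadraticForm ℚ M)) d x) =
      (-1 : ℚ) ^ r • contractLeft (Q := (0 : QuadraticForm ℚ M)) d (contractAll δ x) := by
  induction r generalizing x with
  | zero => simp
  | succ r ih =>
    rw [contractAll_succ, contractLeft_comm, map_neg, ih, contractAll_succ, pow_succ]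
    simp

/-- Contractions anticommute and have square zero, so a repeated functional gives zero. -/
lemma contractAll_contractLeft_self {r : ℕ} (δ : Fin r → Dual ℚ M) (j : Fin r)
    (x : ExteriorAlgebra ℚ M) :
    contractAll δ (contractLeft (Q := (0 : QuadraticForm ℚ M)) (δ j) x) = 0 := by
  induction r generalizing x with
  | zero => exact j.elim0
  | succ r ih =>
    rw [contractAll_succ]
    refine Fin.cases ?_ (fun i => ?_) j
    · rw [contractLeft_contractLeft, map_zero]
    · rw [contractLeft_comm, map_neg, ih (fun i => δ i.succ), neg_zero]

lemma contractAll_involute {r : ℕ} (δ : Fin r → Dual ℚ M) (x : ExteriorAlgebra ℚ M) :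
    contractAll δ (involute x) = (-1 : ℚ) ^ r • involute (contractAll δ x) := by
  induction r generalizing x with
  | zero => simp
  | succ r ih =>
    rw [contractAll_succ, contractLeft_involute, map_neg, ih, contractAll_succ, pow_succ]
    simp

lemma contractAll_map {r : ℕ} (f : M →ₗ[ℚ] N) (δ : Fin r → Dual ℚ N) (x : ExteriorAlgebra ℚ M) :
    contractAll δ (ExteriorAlgebra.map f x) =
      ExteriorAlgebra.map f (contractAll (fun i => δ i ∘ₗ f) x) := by
  induction r generalizing x with
  | zero => simp
  | succ r ih => rw [contractAll_succ, map_contractLeft, ih, contractAll_succ]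

/-- Each contraction that passes `reverse` leaves an involution, which must cross the `j`
contractions still to come at the cost of `(-1)^j`. The exponents add up to `0 + 1 + … + (r - 1)`.
-/
lemma algebraMapInv_contractAll_reverse {r : ℕ} (δ : Fin r → Dual ℚ M) (x : ExteriorAlgebra ℚ M) :
    ExteriorAlgebra.algebraMapInv (contractAll δ (reverse x)) =
      (-1 : ℚ) ^ (r.choose 2) * ExteriorAlgebra.algebraMapInv (contractAll δ x) := by
  induction r generalizing x with
  | zero => simpa using algebraMapInv_reverse x
  | succ r ih =>
    rw [contractAll_succ, contractLeft_reverse, ih, contractAll_involute, map_smul,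
      algebraMapInv_involute, contractAll_succ, Nat.choose_succ_succ' r 1, Nat.choose_one_right,
      pow_add, smul_eq_mul]
    ring

/-- The witness is the product of all the `e i` in order. The clause on `d` serves the induction,
where `δ 0` has to kill the remaining factors; the last clause makes `c₁(𝒫)` kill the pulled back
witness in `orlovMap_bijective`. -/
lemma exists_contractAll_eq_one {r : ℕ} (δ : Fin r → Dual ℚ M) (e : Fin r → M)
    (h : ∀ i j, δ i (e j) = if i = j then 1 else 0) :
    ∃ x : ExteriorAlgebra ℚ M, contractAll δ x = 1 ∧
      (∀ d : Dual ℚ M, (∀ i, d (e i) = 0) →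
        contractLeft (Q := (0 : QuadraticForm ℚ M)) d x = 0) ∧
      ∀ i, ExteriorAlgebra.ι ℚ (e i) * x = 0 := by
  induction r with
  | zero => exact ⟨1, by simp, fun d _ => contractLeft_one (Q := 0) (d := d), fun i => i.elim0⟩
  | succ r ih =>
    obtain ⟨x, hx, hd, he⟩ := ih (fun i => δ i.succ) (fun i => e i.succ) (fun i j => by simp [h])
    refine ⟨ExteriorAlgebra.ι ℚ (e 0) * x, ?_, fun d hd' => ?_, fun i => ?_⟩
    · rw [contractAll_succ, contractLeft_ι_mul', h, hd _ (fun i => by simp [h, Fin.ext_iff])]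
      simp [hx]
    · rw [contractLeft_ι_mul', hd' 0, hd d (fun i => hd' _)]
      simp
    · refine Fin.cases ?_ (fun j => ?_) i
      · rw [← mul_assoc, ExteriorAlgebra.ι_sq_zero, zero_mul]
      · rw [← mul_assoc, eq_neg_of_add_eq_zero_left (ExteriorAlgebra.ι_add_mul_swap _ _), neg_mul,
          mul_assoc, he, mul_zero, neg_zero]

end ContractAll

/-! ### Contraction of exponentials of two-forms -/

section Exponential

variable {M : Type*} [AddCommGroup M] [Module ℚ M]

/-- As `c` is even and central, the odd derivation obeys the ordinary chain rule on powers of `c`.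
-/
lemma contractLeft_exp (d : Dual ℚ M) (c : ExteriorAlgebra ℚ M) (hc : IsNilpotent c)
    (hα : involute c = c) (hcomm : ∀ z, Commute c z) :
    contractLeft (Q := (0 : QuadraticForm ℚ M)) d (IsNilpotent.exp c) =
      contractLeft (Q := (0 : QuadraticForm ℚ M)) d c * IsNilpotent.exp c := by
  obtain ⟨k, hk⟩ := hc
  have hpow : ∀ j : ℕ, contractLeft (Q := (0 : QuadraticForm ℚ M)) d (c ^ (j + 1)) =
      ((j + 1 : ℕ) : ℚ) • (contractLeft (Q := (0 : QuadraticForm ℚ M)) d c * c ^ j) := by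
    intro j
    induction j with
    | zero => simp
    | succ j ih =>
      rw [pow_succ', contractLeft_mul, hα, ih, mul_smul_comm, ← mul_assoc, (hcomm _).eq, mul_assoc,
        ← pow_succ']
      push_cast
      module
  -- The left exponential is expanded one term further, so that the two sums match once its constant
  -- term is dropped and the index is shifted.
  have hk1 : c ^ (k + 1) = 0 := by rw [pow_succ, hk, zero_mul]
  conv_lhs => rw [IsNilpotent.exp_eq_sum hk1]
  rw [IsNilpotent.exp_eq_sum hk, Finset.sum_range_succ', map_add, map_sum, Finset.mul_sum,
    pow_zero, map_smul, contractLeft_one, smul_zero, add_zero]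
  refine Finset.sum_congr rfl fun j _ => ?_
  rw [map_smul, hpow, smul_smul, mul_smul_comm, Nat.factorial_succ]
  congr 1
  push_cast
  field_simp

end Exponential

section TwoForm

variable {R M ι' : Type*} [CommRing R] [AddCommGroup M] [Module R M] [Fintype ι'] (u v : ι' → M)

/-- The two-form `∑ u_i ∧ v_i`. -/
def twoForm : ExteriorAlgebra R M := ∑ i, ExteriorAlgebra.ι R (u i) * ExteriorAlgebra.ι R (v i)

lemma ι_mul_ι_commute (a b : M) (z : ExteriorAlgebra R M) :
    Commute (ExteriorAlgebra.ι R a * ExteriorAlgebra.ι R b) z := by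
  have h1 := ext_ι_mul b z
  have h2 := ext_ι_mul a (involute z)
  rw [involute_involute] at h2
  rw [commute_iff_eq, mul_assoc, h1, ← mul_assoc, h2, mul_assoc]

lemma twoForm_commute (z : ExteriorAlgebra R M) : Commute (twoForm u v) z :=
  Commute.sum_left _ _ _ fun _ _ => ι_mul_ι_commute _ _ z

lemma involute_twoForm : involute (twoForm u v) = (twoForm u v : ExteriorAlgebra R M) := by
  unfold twoForm
  rw [map_sum]
  refine Finset.sum_congr rfl fun i _ => ?_
  have h : ∀ a : M, involute (ExteriorAlgebra.ι R a) = -ExteriorAlgebra.ι R a :=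
    fun a => involute_ι (Q := (0 : QuadraticForm R M)) a
  rw [map_mul, h, h, neg_mul_neg]

lemma isNilpotent_twoForm : IsNilpotent (twoForm u v : ExteriorAlgebra R M) := by
  refine Commute.isNilpotent_sum (fun i _ => ⟨2, ?_⟩) fun i j _ _ => ι_mul_ι_commute _ _ _
  rw [pow_two, mul_assoc, ← (ι_mul_ι_commute (u i) (v i) (ExteriorAlgebra.ι R (v i))).eq, mul_assoc,
    ExteriorAlgebra.ι_sq_zero, mul_zero, mul_zero]

lemma contractLeft_twoForm (d : Dual R M) :
    contractLeft (Q := (0 : QuadraticForm R M)) d (twoForm u v) =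
      ExteriorAlgebra.ι R (∑ i, (d (u i) • v i - d (v i) • u i)) := by
  unfold twoForm
  rw [map_sum, map_sum]
  refine Finset.sum_congr rfl fun i _ => ?_
  have h : contractLeft (Q := (0 : QuadraticForm R M)) d (ExteriorAlgebra.ι R (v i)) =
    algebraMap _ _ (d (v i)) := contractLeft_ι (Q := (0 : QuadraticForm R M)) d (v i)
  rw [contractLeft_ι_mul', h, map_sub, map_smul, map_smul, ← Algebra.commutes, ← Algebra.smul_def]

end TwoForm

/-! ### Orlov's map in coordinates and the Clifford action -/

section Orlov

variable {M : Type*} [AddCommGroup M] [Module ℚ M]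

variable (M) in
/-- The ring homomorphism induced on cohomology by `(x, y, ξ) ↦ x + y`. -/
def pullSum : ExteriorAlgebra ℚ M →ₐ[ℚ] ExteriorAlgebra ℚ (M × M × Dual ℚ M) :=
  ExteriorAlgebra.map (LinearMap.prod LinearMap.id (LinearMap.inl ℚ M (Dual ℚ M)))

variable (M) in
/-- The ring homomorphism induced on cohomology by `(x, y, ξ) ↦ y`. -/
def pullSnd : ExteriorAlgebra ℚ M →ₐ[ℚ] ExteriorAlgebra ℚ (M × M × Dual ℚ M) :=
  ExteriorAlgebra.map (LinearMap.inr ℚ M (M × Dual ℚ M) ∘ₗ LinearMap.inl ℚ M (Dual ℚ M))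

variable {n : ℕ} (e : Basis (Fin (n * 2)) ℚ M) (s : ℚ)

/-- The pullback of `c₁(𝒫)` to `X × X × X̂`. -/
def c1Triple : ExteriorAlgebra ℚ (M × M × Dual ℚ M) :=
  twoForm (fun i => ((0, e i, 0) : M × M × Dual ℚ M)) (fun i => (0, 0, e.coord i))

/-- The pullback of the kernel of Orlov's equivalence to `X × X × X̂`. -/
def kernelClass : ExteriorAlgebra ℚ (M × M × Dual ℚ M) :=
  (-1 : ℚ) ^ n • IsNilpotent.exp (-c1Triple e)

/-- Integration over the second factor of `X × X × X̂`. -/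
def pushOuter : ExteriorAlgebra ℚ (M × M × Dual ℚ M) →ₗ[ℚ] ExteriorAlgebra ℚ (M × Dual ℚ M) :=
  s • ((ExteriorAlgebra.map (LinearMap.prodMap LinearMap.id
        (LinearMap.snd ℚ M (Dual ℚ M)))).toLinearMap ∘ₗ
      contractAll fun i => e.coord i ∘ₗ LinearMap.fst ℚ M (Dual ℚ M) ∘ₗ
          LinearMap.snd ℚ M (M × Dual ℚ M))

/-- The map `a ⊗ b ↦ π_{13,*}(σ^*(a) ∪ π₂^*(τ b) ∪ (-1)^n exp(-c₁(𝒫)))`, where `σ` is the sum of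
the first two components. -/
def orlovMap : ExteriorAlgebra ℚ M ⊗[ℚ] ExteriorAlgebra ℚ M →ₗ[ℚ]
    ExteriorAlgebra ℚ (M × Dual ℚ M) :=
  TensorProduct.lift (((LinearMap.mul ℚ _).compl₁₂ (pullSum M).toLinearMap
    ((pullSnd M).toLinearMap ∘ₗ reverse)).compr₂
      (pushOuter e s ∘ₗ (LinearMap.mul ℚ _).flip (kernelClass e)))

lemma orlovMap_tmul (a b : ExteriorAlgebra ℚ M) :
    orlovMap e s (a ⊗ₜ b) =
      pushOuter e s (pullSum M a * pullSnd M (reverse b) * kernelClass e) := rfl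

lemma involute_kernelClass : involute (kernelClass e) = kernelClass e := by
  have h2 : IsNilpotent (-c1Triple e) := (isNilpotent_twoForm _ _).neg
  rw [kernelClass, map_smul, IsNilpotent.map_exp h2, map_neg, c1Triple, involute_twoForm]

/-- The mechanism of the Fourier transform: the kernel is the exponential of a two-form, so
contraction acts on it as multiplication by a vector. The next two lemmas read off the two
directions in which this vector can point. -/
lemma contractLeft_kernelClass (d : Dual ℚ (M × M × Dual ℚ M)) :
    contractLeft (Q := (0 : QuadraticForm ℚ (M × M × Dual ℚ M))) d (kernelClass e) =
      ExteriorAlgebra.ι ℚ (∑ i, (d (0, 0, e.coord i) • ((0, e i, 0) : M × M × Dual ℚ M) -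
        d (0, e i, 0) • (0, 0, e.coord i))) * kernelClass e := by
  have h2 : IsNilpotent (-c1Triple e) := (isNilpotent_twoForm _ _).neg
  rw [kernelClass, map_smul, contractLeft_exp d _ h2, map_neg, c1Triple, contractLeft_twoForm,
    ← map_neg, mul_smul_comm, ← Finset.sum_neg_distrib]
  · simp only [neg_sub]
  · rw [map_neg, c1Triple, involute_twoForm]
  · exact fun z => (twoForm_commute _ _ z).neg_left

/-- The functional `(x, y, ξ) ↦ ξ(w)` on `H¹(X × X × X̂)`. -/
def dualFunctional (w : M) : Dual ℚ (M × M × Dual ℚ M) :=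
  Dual.eval ℚ M w ∘ₗ LinearMap.snd ℚ M (Dual ℚ M) ∘ₗ
    LinearMap.snd ℚ M (M × Dual ℚ M)

/-- The functional `(x, y, ξ) ↦ θ(y)` on `H¹(X × X × X̂)`. -/
def sndFunctional (θ : Dual ℚ M) : Dual ℚ (M × M × Dual ℚ M) :=
  θ ∘ₗ LinearMap.fst ℚ M (Dual ℚ M) ∘ₗ LinearMap.snd ℚ M (M × Dual ℚ M)

/-- The functional induced by `d` through `(x, y, ξ) ↦ (x, ξ)`. -/
def outerFunctional (d : Dual ℚ (M × Dual ℚ M)) : Dual ℚ (M × M × Dual ℚ M) :=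
  d ∘ₗ LinearMap.prodMap LinearMap.id (LinearMap.snd ℚ M (Dual ℚ M))

@[simp] lemma dualFunctional_apply (w x y : M) (ξ : Dual ℚ M) :
    dualFunctional w (x, y, ξ) = ξ w := rfl

@[simp] lemma sndFunctional_apply (θ : Dual ℚ M) (x y : M) (ξ : Dual ℚ M) :
    sndFunctional θ (x, y, ξ) = θ y := rfl

@[simp] lemma outerFunctional_apply (d : Dual ℚ (M × Dual ℚ M)) (x y : M) (ξ : Dual ℚ M) :
    outerFunctional d (x, y, ξ) = d (x, ξ) := rfl

lemma contractLeft_dualFunctional_kernelClass (w : M) :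
    contractLeft (Q := (0 : QuadraticForm ℚ (M × M × Dual ℚ M))) (dualFunctional w) (kernelClass e) =
      ExteriorAlgebra.ι ℚ (0, w, 0) * kernelClass e := by
  rw [contractLeft_kernelClass]
  congr 2
  simp only [dualFunctional_apply, LinearMap.zero_apply, zero_smul, sub_zero, Basis.coord_apply]
  conv_rhs => rw [← e.sum_repr w]
  have : ∀ x, ((0, x, 0) : M × M × Dual ℚ M) = (LinearMap.inr ℚ M (M × Dual ℚ M) ∘ₗ
    LinearMap.inl ℚ M (Dual ℚ M)) x := fun x => rfl
  simp only [this, map_sum, map_smul]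

lemma sum_smul_coord (θ : Dual ℚ M) :
    ∑ i, θ (e i) • e.coord i = θ := by
  refine e.ext fun j => ?_
  rw [LinearMap.sum_apply, Finset.sum_eq_single j]
  · simp
  · intro i _ hij; simp [hij]
  · simp

lemma contractLeft_sndFunctional_kernelClass (θ : Dual ℚ M) :
    contractLeft (Q := (0 : QuadraticForm ℚ (M × M × Dual ℚ M))) (sndFunctional θ) (kernelClass e) =
      -(ExteriorAlgebra.ι ℚ (0, 0, θ) * kernelClass e) := by
  rw [contractLeft_kernelClass, ← neg_mul, ← map_neg]
  congr 2
  simp only [sndFunctional_apply, map_zero, zero_smul, zero_sub, Finset.sum_neg_distrib]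
  conv_rhs => rw [← sum_smul_coord e θ]
  have : ∀ x, ((0, 0, x) : M × M × Dual ℚ M) = (LinearMap.inr ℚ M (M × Dual ℚ M) ∘ₗ
    LinearMap.inr ℚ M (Dual ℚ M)) x := fun x => rfl
  simp only [this, map_sum, map_smul]

/-- The functional sees only the first summand of `M × M × Dual ℚ M`, while the kernel is built from
the other two. -/
lemma contractLeft_outerFunctional_kernelClass (θ : Dual ℚ M) :
    contractLeft (Q := (0 : QuadraticForm ℚ (M × M × Dual ℚ M)))
      (outerFunctional (pairV ℚ M (0, θ))) (kernelClass e) = 0 := by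
  rw [contractLeft_kernelClass]
  simp [pairV]

/-! Rules for the pushforward -/

lemma pushOuter_apply (z : ExteriorAlgebra ℚ (M × M × Dual ℚ M)) :
    pushOuter e s z = s • ExteriorAlgebra.map (LinearMap.prodMap LinearMap.id
        (LinearMap.snd ℚ M (Dual ℚ M))) (contractAll (fun i => sndFunctional (e.coord i)) z) := rfl

lemma neg_one_pow_mul_two (n : ℕ) : (-1 : ℚ) ^ (n * 2) = 1 := by
  rw [mul_comm, pow_mul]; norm_num

/-- Projection formula. There is no sign because the fibre has even real dimension `n * 2`. -/
lemma pushOuter_ι_mul (x : M) (ξ : Dual ℚ M) (z : ExteriorAlgebra ℚ (M × M × Dual ℚ M)) :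
    pushOuter e s (ExteriorAlgebra.ι ℚ (x, 0, ξ) * z) = ExteriorAlgebra.ι ℚ (x, ξ) * pushOuter e s z := by
  rw [pushOuter_apply, contractAll_ι_mul _ _ (fun i => by simp), neg_one_pow_mul_two, one_smul,
    map_mul, ExteriorAlgebra.map_apply_ι, pushOuter_apply, mul_smul_comm]
  rfl

lemma pushOuter_contractLeft (d : Dual ℚ (M × Dual ℚ M)) (z : ExteriorAlgebra ℚ (M × M × Dual ℚ M)) :
    pushOuter e s (contractLeft (Q := (0 : QuadraticForm ℚ (M × M × Dual ℚ M)))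
      (outerFunctional d) z) =
      contractLeft (Q := (0 : QuadraticForm ℚ (M × Dual ℚ M))) d (pushOuter e s z) := by
  rw [outerFunctional, pushOuter_apply, contractAll_contractLeft, neg_one_pow_mul_two, one_smul, ← map_contractLeft,
    pushOuter_apply, map_smul]

/-- A class contracted along the fibre has no component of top fibre degree. This vanishing is what
makes integration by parts possible in `ι_dual_mul_orlovMap`. -/
lemma pushOuter_contractLeft_snd (θ : Dual ℚ M) (z : ExteriorAlgebra ℚ (M × M × Dual ℚ M)) :
    pushOuter e s (contractLeft (Q := (0 : QuadraticForm ℚ (M × M × Dual ℚ M))) (sndFunctional θ) z) =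
      0 := by
  have h2 : sndFunctional θ =
      ∑ i, θ (e i) • sndFunctional (e.coord i) := by
    conv_lhs => rw [← sum_smul_coord e θ]
    apply LinearMap.ext
    rintro ⟨x, y, ξ⟩
    simp only [sndFunctional_apply, LinearMap.sum_apply, LinearMap.smul_apply]
  rw [h2, map_sum, LinearMap.sum_apply, map_sum]
  refine Finset.sum_eq_zero fun i _ => ?_
  rw [map_smul, LinearMap.smul_apply, map_smul, pushOuter_apply]
  rw [contractAll_contractLeft_self (fun i => sndFunctional (e.coord i)) i z, map_zero, smul_zero,
    smul_zero]

lemma pushOuter_involute (z : ExteriorAlgebra ℚ (M × M × Dual ℚ M)) :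
    pushOuter e s (involute z) = involute (pushOuter e s z) := by
  rw [pushOuter_apply, contractAll_involute, neg_one_pow_mul_two, one_smul, ← map_involute,
    pushOuter_apply, map_smul]

lemma involute_orlovMap (a b : ExteriorAlgebra ℚ M) :
    involute (orlovMap e s (a ⊗ₜ b)) = orlovMap e s (involute a ⊗ₜ involute b) := by
  have h1 : involute (pullSum M a) = pullSum M (involute a) := map_involute _ _
  have h2 : involute (pullSnd M (reverse b)) = pullSnd M (involute (reverse b)) := map_involute _ _
  rw [orlovMap_tmul, orlovMap_tmul, ← pushOuter_involute, map_mul (involute (Q := (0 : QuadraticForm ℚ (M × M × Dual ℚ M)))),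
    map_mul (involute (Q := (0 : QuadraticForm ℚ (M × M × Dual ℚ M)))), h1, h2, involute_reverse,
    involute_kernelClass]

/-! Contractions of pulled back classes -/

/-- Leibniz rule for the integrand, with `d₁` and `d₂` the restrictions of `d` along the two
pullbacks. Each functional used below makes some of the three terms vanish. -/
lemma contractLeft_product (d : Dual ℚ (M × M × Dual ℚ M)) (d₁ d₂ : Dual ℚ M)
    (h₁ : ∀ x, d (x, x, 0) = d₁ x) (h₂ : ∀ x, d (0, x, 0) = d₂ x) (a b : ExteriorAlgebra ℚ M) :
    contractLeft (Q := (0 : QuadraticForm ℚ (M × M × Dual ℚ M))) d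
      (pullSum M a * pullSnd M b * kernelClass e) =
      pullSum M (contractLeft (Q := (0 : QuadraticForm ℚ M)) d₁ a) * pullSnd M b *
        kernelClass e +
      pullSum M (involute a) * pullSnd M (contractLeft (Q := (0 : QuadraticForm ℚ M)) d₂ b) *
        kernelClass e +
      involute (pullSum M a * pullSnd M b) *
        contractLeft (Q := (0 : QuadraticForm ℚ (M × M × Dual ℚ M))) d (kernelClass e) := by
  have hd₁ : d ∘ₗ LinearMap.prod LinearMap.id (LinearMap.inl ℚ M (Dual ℚ M)) = d₁ :=
    LinearMap.ext h₁
  have hd₂ : d ∘ₗ LinearMap.inr ℚ M (M × Dual ℚ M) ∘ₗ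
      LinearMap.inl ℚ M (Dual ℚ M) = d₂ := LinearMap.ext h₂
  have h1 : contractLeft (Q := (0 : QuadraticForm ℚ (M × M × Dual ℚ M))) d (pullSum M a) =
      pullSum M (contractLeft (Q := (0 : QuadraticForm ℚ M)) d₁ a) := by
    rw [← hd₁]; exact map_contractLeft _ _ _
  have h2 : contractLeft (Q := (0 : QuadraticForm ℚ (M × M × Dual ℚ M))) d (pullSnd M b) =
      pullSnd M (contractLeft (Q := (0 : QuadraticForm ℚ M)) d₂ b) := by
    rw [← hd₂]; exact map_contractLeft _ _ _
  have h3 : involute (pullSum M a) = pullSum M (involute a) := map_involute _ _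
  rw [contractLeft_mul, contractLeft_mul, h1, h2, h3, add_mul]

lemma mVec_apply (w : M) (θ : Dual ℚ M) (a : ExteriorAlgebra ℚ M) :
    mVec ℚ M (w, θ) a = ExteriorAlgebra.ι ℚ w * a +
      contractLeft (Q := (0 : QuadraticForm ℚ M)) θ a := rfl

/-- Insertion of a class from the second factor becomes a contraction. -/
lemma pushOuter_ι_snd_mul (w : M) (a b : ExteriorAlgebra ℚ M) :
    pushOuter e s (ExteriorAlgebra.ι ℚ (0, w, 0) * (pullSum M a * pullSnd M b * kernelClass e)) =
      contractLeft (Q := (0 : QuadraticForm ℚ (M × Dual ℚ M))) (pairV ℚ M (w, 0))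
        (pushOuter e s (pullSum M a * pullSnd M b * kernelClass e)) := by
  have hd : outerFunctional (pairV ℚ M (w, 0)) = dualFunctional w := by
    apply LinearMap.ext; rintro ⟨x, y, ξ⟩
    simp [pairV]
  have h := contractLeft_product e (dualFunctional w) 0 0 (fun x => rfl) (fun x => rfl) a b
  rw [← pushOuter_contractLeft, hd, h, contractLeft_dualFunctional_kernelClass,
    ← mul_assoc (involute _), ← ext_ι_mul, mul_assoc (ExteriorAlgebra.ι ℚ _)]
  simp only [map_zero, LinearMap.zero_apply, zero_mul, mul_zero, zero_add]

lemma orlovMap_contractLeft_tmul (θ : Dual ℚ M) (a b : ExteriorAlgebra ℚ M) :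
    orlovMap e s (contractLeft (Q := (0 : QuadraticForm ℚ M)) θ a ⊗ₜ b) =
      contractLeft (Q := (0 : QuadraticForm ℚ (M × Dual ℚ M))) (pairV ℚ M (0, θ))
        (orlovMap e s (a ⊗ₜ b)) := by
  have h := contractLeft_product e (outerFunctional (pairV ℚ M (0, θ))) θ 0
    (fun x => by simp [pairV]) (fun x => by simp [pairV]) a (reverse b)
  rw [orlovMap_tmul, orlovMap_tmul, ← pushOuter_contractLeft, h,
    contractLeft_outerFunctional_kernelClass]
  simp only [map_zero, LinearMap.zero_apply, zero_mul, mul_zero, add_zero]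

/-- The pullback of `w` under `x + y` is an outer class plus a fibre class. The former leaves the
integral by the projection formula; the latter is converted into a contraction by the kernel. -/
lemma orlovMap_ι_mul_tmul (w : M) (a b : ExteriorAlgebra ℚ M) :
    orlovMap e s ((ExteriorAlgebra.ι ℚ w * a) ⊗ₜ b) =
      ExteriorAlgebra.ι ℚ (w, 0) * orlovMap e s (a ⊗ₜ b) +
      contractLeft (Q := (0 : QuadraticForm ℚ (M × Dual ℚ M))) (pairV ℚ M (w, 0))
        (orlovMap e s (a ⊗ₜ b)) := by
  have h1 : pullSum M (ExteriorAlgebra.ι ℚ w) =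
      ExteriorAlgebra.ι ℚ (w, 0, 0) + ExteriorAlgebra.ι ℚ (0, w, 0) := by
    simp [pullSum, ← map_add]
  rw [orlovMap_tmul, orlovMap_tmul, map_mul (pullSum M), h1, ← pushOuter_ι_snd_mul, ← pushOuter_ι_mul,
    ← map_add (pushOuter e s)]
  simp only [← mul_assoc, ← add_mul]

/-- `m_v ⊗ 1` corresponds to `(w, 0) ∧ • + (v, •)_V ⌋ •`. -/
lemma orlovMap_mVec_tmul (v : M × Dual ℚ M) (a b : ExteriorAlgebra ℚ M) :
    orlovMap e s (mVec ℚ M v a ⊗ₜ b) =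
      ExteriorAlgebra.ι ℚ (v.1, 0) * orlovMap e s (a ⊗ₜ b) +
        contractLeft (Q := (0 : QuadraticForm ℚ (M × Dual ℚ M))) (pairV ℚ M v)
          (orlovMap e s (a ⊗ₜ b)) := by
  obtain ⟨w, θ⟩ := v
  have hv : pairV ℚ M (w, θ) = pairV ℚ M (w, 0) + pairV ℚ M (0, θ) := by
    rw [← map_add]; simp
  rw [mVec_apply, TensorProduct.add_tmul, map_add, orlovMap_contractLeft_tmul, orlovMap_ι_mul_tmul, hv,
    map_add, LinearMap.add_apply, add_assoc]

lemma orlovMap_tmul_ι_mul (w : M) (a b : ExteriorAlgebra ℚ M) :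
    orlovMap e s (involute a ⊗ₜ (ExteriorAlgebra.ι ℚ w * involute b)) =
      contractLeft (Q := (0 : QuadraticForm ℚ (M × Dual ℚ M))) (pairV ℚ M (w, 0))
        (orlovMap e s (a ⊗ₜ b)) := by
  have h1 : pullSnd M (ExteriorAlgebra.ι ℚ w) = ExteriorAlgebra.ι ℚ (0, w, 0) := by
    simp [pullSnd]
  -- Reversal moves `w` to the right of `b`, and the involution supplies the sign needed to bring it
  -- back to the left.
  have h2 : reverse (ExteriorAlgebra.ι ℚ w * involute b) =
      ExteriorAlgebra.ι ℚ w * reverse b := by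
    rw [ext_ι_mul w (reverse b), reverse.map_mul, ← involute_reverse]
    exact congrArg _ (reverse_ι (Q := (0 : QuadraticForm ℚ M)) w)
  have h3 : involute (pullSum M a) = pullSum M (involute a) := map_involute _ _
  rw [orlovMap_tmul, orlovMap_tmul, ← pushOuter_ι_snd_mul, h2, map_mul (pullSnd M), h1, ← h3,
    ← mul_assoc, ← ext_ι_mul]
  simp only [mul_assoc]

lemma ι_dual_mul_orlovMap (θ : Dual ℚ M) (a b : ExteriorAlgebra ℚ M) :
    ExteriorAlgebra.ι ℚ ((0, θ) : M × Dual ℚ M) * orlovMap e s (a ⊗ₜ b) =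
      orlovMap e s (contractLeft (Q := (0 : QuadraticForm ℚ M)) θ a ⊗ₜ b) -
      orlovMap e s (involute a ⊗ₜ contractLeft (Q := (0 : QuadraticForm ℚ M)) θ (involute b)) := by
  have h3 : reverse (contractLeft (Q := (0 : QuadraticForm ℚ M)) θ (involute b)) =
      -contractLeft (Q := (0 : QuadraticForm ℚ M)) θ (reverse b) := by
    rw [contractLeft_reverse, contractLeft_involute, map_neg]
  -- Integration by parts: the fibre contraction by `θ` of the whole integrand has integral zero,
  -- and its term on the kernel is exterior multiplication by `(0, θ)`.
  have key := pushOuter_contractLeft_snd e s θ (pullSum M a * pullSnd M (reverse b) * kernelClass e)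
  rw [contractLeft_product e (sndFunctional θ) θ θ (fun x => rfl) (fun x => rfl),
    contractLeft_sndFunctional_kernelClass, mul_neg, ← mul_assoc, ← ext_ι_mul, map_add, map_add,
    map_neg, mul_assoc (ExteriorAlgebra.ι ℚ _), pushOuter_ι_mul, ← orlovMap_tmul, ← orlovMap_tmul] at key
  rw [orlovMap_tmul e s (involute a), h3, map_neg, mul_neg, neg_mul, map_neg, sub_neg_eq_add]
  exact (eq_of_sub_eq_zero ((sub_eq_add_neg _ _).trans key)).symm

/-- Exterior multiplication by `v` corresponds to `m_v ⊗ 1 - α ⊗ m_v α`. -/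
lemma ι_mul_orlovMap (v : M × Dual ℚ M) (a b : ExteriorAlgebra ℚ M) :
    ExteriorAlgebra.ι ℚ v * orlovMap e s (a ⊗ₜ b) =
      orlovMap e s (mVec ℚ M v a ⊗ₜ b) -
        orlovMap e s (involute a ⊗ₜ mVec ℚ M v (involute b)) := by
  obtain ⟨w, θ⟩ := v
  have h0 : ExteriorAlgebra.ι ℚ ((w, θ) : M × Dual ℚ M) = ExteriorAlgebra.ι ℚ (w, 0) +
      ExteriorAlgebra.ι ℚ (0, θ) := by rw [← map_add]; simp
  rw [h0, add_mul, ι_dual_mul_orlovMap, mVec_apply, mVec_apply, add_tmul, tmul_add, map_add, map_add,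
    orlovMap_tmul_ι_mul, orlovMap_ι_mul_tmul]
  abel

/-! The component of degree `0` -/

/-- Integration over the first factor. -/
def integralBasis : ExteriorAlgebra ℚ M →ₗ[ℚ] ℚ :=
  s • (ExteriorAlgebra.algebraMapInv.toLinearMap ∘ₗ contractAll fun i => e.coord i)

/-- Degree `0` is computed by restriction to `0 × X × 0`. There both pullbacks become the identity,
`c₁(𝒫)` vanishes, and only `(-1)^n` remains of the kernel. -/
lemma algebraMapInv_orlovMap (a b : ExteriorAlgebra ℚ M) :
    ExteriorAlgebra.algebraMapInv (orlovMap e s (a ⊗ₜ b)) =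
      (-1) ^ n * integralBasis e s (a * reverse b) := by
  set q : M × M × Dual ℚ M →ₗ[ℚ] M := LinearMap.fst ℚ M (Dual ℚ M) ∘ₗ
          LinearMap.snd ℚ M (M × Dual ℚ M) with hq
  have h1 : ∀ a, ExteriorAlgebra.map q (pullSum M a) = a := by
    intro a
    have : (ExteriorAlgebra.map q).comp (pullSum M) = AlgHom.id ℚ _ := by
      ext x; simp [pullSum, q]
    exact DFunLike.congr_fun this a
  have h2 : ∀ a, ExteriorAlgebra.map q (pullSnd M a) = a := by
    intro a
    have : (ExteriorAlgebra.map q).comp (pullSnd M) = AlgHom.id ℚ _ := by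
      ext x; simp [pullSnd, q]
    exact DFunLike.congr_fun this a
  have h3 : ExteriorAlgebra.map q (kernelClass e) = algebraMap ℚ _ ((-1) ^ n) := by
    have h2 : IsNilpotent (-c1Triple e) := (isNilpotent_twoForm _ _).neg
    have h4 : ExteriorAlgebra.map q (c1Triple e) = 0 := by
      simp [c1Triple, twoForm, q]
    rw [kernelClass, map_smul, IsNilpotent.map_exp h2, map_neg, h4, neg_zero,
      IsNilpotent.exp_zero, Algebra.algebraMap_eq_smul_one]
  have h5 : ∀ z : ExteriorAlgebra ℚ M, integralBasis e s z = s • ExteriorAlgebra.algebraMapInv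
    (contractAll (fun i => e.coord i) z) := fun z => rfl
  have h6 : contractAll (fun i => e.coord i) (ExteriorAlgebra.map q
      (pullSum M a * pullSnd M (reverse b) * kernelClass e)) = ExteriorAlgebra.map q
      (contractAll (fun i => sndFunctional (e.coord i))
        (pullSum M a * pullSnd M (reverse b) * kernelClass e)) := contractAll_map q _ _
  rw [orlovMap_tmul, pushOuter_apply, map_smul, algebraMapInv_map, h5]
  rw [map_mul (ExteriorAlgebra.map q), map_mul (ExteriorAlgebra.map q), h1, h2, h3,
    ← Algebra.commutes, ← Algebra.smul_def, map_smul] at h6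
  rw [← algebraMapInv_map q, ← h6, map_smul]
  simp only [smul_eq_mul]
  ring

end Orlov

/-! ### Dimension, parity and bijectivity of Orlov's map -/

section FiniteDimension

variable (F M : Type*) [Field F] [AddCommGroup M] [Module F M] [FiniteDimensional F M]

instance finiteDimensional_exteriorAlgebra : FiniteDimensional F (ExteriorAlgebra F M) :=
  Module.Finite.of_basis (Module.finBasis F M).ExteriorAlgebra

lemma finrank_exteriorAlgebra : finrank F (ExteriorAlgebra F M) = 2 ^ finrank F M := by
  rw [Module.finrank_eq_card_basis (Module.finBasis F M).ExteriorAlgebra]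
  simp

end FiniteDimension

lemma commute_of_involute_eq {R M : Type*} [CommRing R] [AddCommGroup M] [Module R M]
    {x : ExteriorAlgebra R M} (hx : involute x = x) (y : ExteriorAlgebra R M) : x * y = y * x := by
  induction y using CliffordAlgebra.left_induction with
  | algebraMap r => exact (Algebra.commutes r x).symm
  | add y z hy hz => rw [mul_add, add_mul, hy, hz]
  | ι_mul y m hy =>
    have h : ExteriorAlgebra.ι R m * x = x * ExteriorAlgebra.ι R m := by rw [ext_ι_mul, hx]
    calc x * (ι _ m * y) = x * ExteriorAlgebra.ι R m * y := (mul_assoc _ _ _).symm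
      _ = ExteriorAlgebra.ι R m * (x * y) := by rw [← h, mul_assoc]
      _ = ExteriorAlgebra.ι R m * y * x := by rw [hy, mul_assoc]

lemma involute_eq_self_of_mem {R M : Type*} [CommRing R] [AddCommGroup M] [Module R M]
    {x : ExteriorAlgebra R M} (hx : x ∈ ⨆ i : ℕ, ⋀[R]^(2 * i) M) : involute x = x := by
  have : (⨆ i : ℕ, ⋀[R]^(2 * i) M) ≤ LinearMap.eqLocus
      (involute (Q := (0 : QuadraticForm R M))).toLinearMap LinearMap.id := by
    refine iSup_le fun i y hy => ?_
    change involute y = y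
    have h1 : ∀ j, ∀ y ∈ ⋀[R]^j M, involute y = (-1 : R) ^ j • y := by
      intro j y hy
      induction hy using Submodule.pow_induction_on_left' with
      | algebraMap r => simp
      | add x y i hx hy h1 h2 => rw [map_add, h1, h2, smul_add]
      | mem_mul m hm i x hx h =>
        obtain ⟨v, rfl⟩ := hm
        have h2 : involute (ExteriorAlgebra.ι R v) = -ExteriorAlgebra.ι R v :=
          involute_ι (Q := (0 : QuadraticForm R M)) v
        rw [map_mul, h, h2, pow_succ, neg_mul, mul_smul_comm, mul_neg_one, neg_smul]
    rw [h1 _ y hy, pow_mul]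
    simp
  exact this hx

section Orlov

variable {M : Type*} [AddCommGroup M] [Module ℚ M] {n : ℕ} (e : Basis (Fin (n * 2)) ℚ M) (s : ℚ)

lemma neg_one_pow_choose_two (n : ℕ) : (-1 : ℚ) ^ ((n * 2).choose 2) = (-1) ^ n := by
  have h : (n * 2).choose 2 = n * (n * 2 - 1) := by
    rw [Nat.choose_two_right, mul_right_comm, Nat.mul_div_cancel _ two_pos]
  rcases Nat.eq_zero_or_pos n with rfl | hn
  · simp
  · have h2 : Odd (n * 2 - 1) := ⟨n - 1, by omega⟩
    rw [h, mul_comm, pow_mul, h2.neg_one_pow]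

lemma integralBasis_reverse (x : ExteriorAlgebra ℚ M) :
    integralBasis e s (reverse x) = (-1) ^ n * integralBasis e s x := by
  have h : ∀ x, integralBasis e s x = s * ExteriorAlgebra.algebraMapInv
    (contractAll (fun i => e.coord i) x) := fun x => rfl
  rw [h, h, algebraMapInv_contractAll_reverse, neg_one_pow_choose_two]
  ring

/-- The products `a * reverse b` and `b * reverse a` are reverses of each other, and reversal in
degree `2n` is multiplication by `(-1)^n`. -/
lemma algebraMapInv_orlovMap_swap (a b : ExteriorAlgebra ℚ M) :
    ExteriorAlgebra.algebraMapInv (orlovMap e s (a ⊗ₜ b)) =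
      (-1) ^ n * ExteriorAlgebra.algebraMapInv (orlovMap e s (b ⊗ₜ a)) := by
  rw [algebraMapInv_orlovMap, algebraMapInv_orlovMap, ← reverse_reverse a, ← reverse.map_mul,
    integralBasis_reverse, reverse_reverse]

/-- The sign of the swap cancels the sign of the kernel, so the pairing `(a, b)_S` appears without a
factor. -/
lemma algebraMapInv_orlovMap_of_even {a b : ExteriorAlgebra ℚ M} (hb : involute b = b) :
    ExteriorAlgebra.algebraMapInv (orlovMap e s (a ⊗ₜ b)) = integralBasis e s (reverse a * b) := by
  rw [algebraMapInv_orlovMap_swap, algebraMapInv_orlovMap, commute_of_involute_eq hb]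
  rcases neg_one_pow_eq_or ℚ n with h | h <;> rw [h] <;> ring

lemma orlovMap_bijective (hs : s ≠ 0) : Function.Bijective (orlovMap e s) := by
  have hfin : FiniteDimensional ℚ M := Module.Finite.of_basis e
  have hdim : finrank ℚ (ExteriorAlgebra ℚ M ⊗[ℚ] ExteriorAlgebra ℚ M) =
      finrank ℚ (ExteriorAlgebra ℚ (M × Dual ℚ M)) := by
    rw [finrank_tensorProduct, finrank_exteriorAlgebra, finrank_exteriorAlgebra, finrank_prod,
      Subspace.dual_finrank_eq, pow_add]
  have hsurj : Function.Surjective (orlovMap e s) := by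
    rw [← LinearMap.range_eq_top, eq_top_iff]
    obtain ⟨x, hx, -, he⟩ := exists_contractAll_eq_one (fun i => e.coord i) e (fun i j => by
      simp [Finsupp.single_apply, eq_comm])
    -- The class `x` is of top degree on the fibre, so `c₁(𝒫)` kills it and the exponential acts on
    -- it as `1`.
    have h1 : orlovMap e s (1 ⊗ₜ reverse x) = ((-1) ^ n * s) • 1 := by
      have hc : c1Triple e * pullSnd M x = 0 := by
        unfold c1Triple twoForm
        rw [Finset.sum_mul]
        refine Finset.sum_eq_zero fun i _ => ?_
        have h2 : ExteriorAlgebra.ι ℚ ((0, e i, 0) : M × M × Dual ℚ M) =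
          pullSnd M (ExteriorAlgebra.ι ℚ (e i)) := by simp [pullSnd]
        rw [eq_neg_of_add_eq_zero_left (ExteriorAlgebra.ι_add_mul_swap _ _), h2, neg_mul, mul_assoc,
          ← map_mul, he, map_zero, mul_zero, neg_zero]
      have h2 : IsNilpotent (-c1Triple e) := (isNilpotent_twoForm _ _).neg
      have h3 : pullSnd M x * kernelClass e = (-1 : ℚ) ^ n • pullSnd M x := by
        have h4 := IsNilpotent.exp_smul_eq_sum (a := -c1Triple e) (m := pullSnd M x) (k := 1)
          (by rw [pow_one, smul_eq_mul, neg_mul, hc, neg_zero]) h2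
        have h5 : involute (IsNilpotent.exp (-c1Triple e)) = IsNilpotent.exp (-c1Triple e) := by
          rw [IsNilpotent.map_exp h2, map_neg, c1Triple, involute_twoForm]
        rw [kernelClass, mul_smul_comm, ← commute_of_involute_eq h5, ← smul_eq_mul (a := IsNilpotent.exp _), h4]
        simp
      have h6 : contractAll (fun i => sndFunctional (e.coord i)) (pullSnd M x) = 1 := by
        have h7 : contractAll (fun i => sndFunctional (e.coord i)) (pullSnd M x) = pullSnd M
          (contractAll (fun i => e.coord i) x) := contractAll_map _ _ _
        rw [h7, hx, map_one]
      rw [orlovMap_tmul, map_one, one_mul, reverse_reverse, h3, map_smul, pushOuter_apply, h6,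
        map_one, smul_smul]
    have h1' : (1 : ExteriorAlgebra ℚ (M × Dual ℚ M)) ∈ LinearMap.range (orlovMap e s) := by
      refine ⟨((-1) ^ n * s)⁻¹ • (1 ⊗ₜ reverse x), ?_⟩
      rw [map_smul, h1, smul_smul, inv_mul_cancel₀ (mul_ne_zero (by simp) hs), one_smul]
    -- Vectors generate the exterior algebra, so this stability together with `1` in the range gives
    -- surjectivity.
    have hι : ∀ v, ∀ z ∈ LinearMap.range (orlovMap e s),
        ExteriorAlgebra.ι ℚ v * z ∈ LinearMap.range (orlovMap e s) := by
      rintro v _ ⟨t, rfl⟩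
      induction t with
      | zero => simp
      | add x y hx hy => rw [map_add, mul_add]; exact Submodule.add_mem _ hx hy
      | tmul a b =>
        rw [ι_mul_orlovMap]
        exact Submodule.sub_mem _ ⟨_, rfl⟩ ⟨_, rfl⟩
    intro z _
    induction z using CliffordAlgebra.left_induction with
    | algebraMap r =>
      rw [Algebra.algebraMap_eq_smul_one]
      exact Submodule.smul_mem _ _ h1'
    | add x y hx hy => exact Submodule.add_mem _ (hx trivial) (hy trivial)
    | ι_mul x m hx => exact hι m x (hx trivial)
  exact ⟨(LinearMap.injective_iff_surjective_of_finrank_eq_finrank hdim).2 hsurj, hsurj⟩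

end Orlov

/-! ### Identification of `φ'` with the coordinate model -/

section Torus

variable {U : Type*} [NormedAddCommGroup U] [NormedSpace ℂ U] [FiniteDimensional ℂ U]
  (Λ : Submodule ℤ U) [DiscreteTopology Λ] [IsZLattice ℝ Λ]

/-- A `ℤ`-basis of a full lattice is an `ℝ`-basis of `U`, so the determinant does not vanish. -/
lemma orientationSign_ne_zero : orientationSign Λ ≠ 0 := by
  have h : (complexBasis U).det (fun i => (latticeBasis Λ i : U)) ≠ 0 := by
    have h1 : (fun i => (latticeBasis Λ i : U)) = (latticeBasis Λ).ofZLatticeBasis ℝ Λ :=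
      funext fun i => (Basis.ofZLatticeBasis_apply ℝ Λ _ i).symm
    rw [h1]
    exact (Basis.isUnit_det (complexBasis U) ((latticeBasis Λ).ofZLatticeBasis ℝ Λ)).ne_zero
  unfold orientationSign
  rcases lt_or_gt_of_ne h with h | h
  · simp [sign_neg h]
  · simp [sign_pos h]

lemma kernelClass_eBasis : kernelClass (eBasis Λ) = pull23 Λ (chPoincareInv Λ) := by
  have h0 : c1Poincare Λ = twoForm (fun i => ((eBasis Λ i, 0) : VQ Λ))
    (fun i => (0, (eBasis Λ).coord i)) := rfl
  have h1 : pull23 Λ (c1Poincare Λ) = c1Triple (eBasis Λ) := by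
    simp [c1Poincare, c1Triple, twoForm, pull23]
  have h2 : IsNilpotent (-c1Poincare Λ) := by
    rw [h0]; exact (isNilpotent_twoForm _ _).neg
  rw [kernelClass, chPoincareInv, map_mul, IsNilpotent.map_exp h2, map_neg, h1, map_pow, map_neg,
    map_one, Algebra.smul_def, map_pow, map_neg, map_one]

/-- Composing `μ` with `π₁₂` gives `(x, y, ξ) ↦ (x + y, y)`, whose components induce the two
pullbacks of the model. -/
lemma phiTau_eq : phiTau Λ = orlovMap (eBasis Λ) (orientationSign Λ) := by
  have hA : ∀ a, pull12 Λ (muPull Λ (ExteriorAlgebra.map (LinearMap.inl ℚ (H1 Λ) (H1 Λ)) a)) =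
      pullSum (H1 Λ) a := by
    intro a
    have : ((pull12 Λ).comp (muPull Λ)).comp
        (ExteriorAlgebra.map (LinearMap.inl ℚ (H1 Λ) (H1 Λ))) = pullSum (H1 Λ) := by
      ext x; simp [pull12, muPull, pullSum]
    exact DFunLike.congr_fun this a
  have hB : ∀ a, pull12 Λ (muPull Λ (ExteriorAlgebra.map (LinearMap.inr ℚ (H1 Λ) (H1 Λ)) a)) =
      pullSnd (H1 Λ) a := by
    intro a
    have : ((pull12 Λ).comp (muPull Λ)).comp
        (ExteriorAlgebra.map (LinearMap.inr ℚ (H1 Λ) (H1 Λ))) = pullSnd (H1 Λ) := by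
      ext x; simp [pull12, muPull, pullSnd]
    exact DFunLike.congr_fun this a
  refine TensorProduct.ext' fun a b => ?_
  rw [orlovMap_tmul, kernelClass_eBasis]
  simp only [phiTau, phi, idPsi, kunneth, LinearMap.comp_apply, TensorProduct.map_tmul,
    TensorProduct.lift.tmul, LinearMap.compl₁₂_apply, LinearMap.mul_apply', LinearMap.id_apply,
    AlgHom.toLinearMap_apply, LinearMap.flip_apply, map_mul, hA, hB, tauS]
  rfl

lemma pairS_eq (s t : SQ Λ) :
    pairS Λ s t = integralBasis (eBasis Λ) (orientationSign Λ) (reverse s * t) := rfl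

end Torus

/-! ### Induction on extended scalars -/

section BaseChange

variable {F : Type*} [Field F] [CharZero F]

@[simp] lemma bilinExt_tmul {A B C : Type*} [AddCommGroup A] [Module ℚ A] [AddCommGroup B]
    [Module ℚ B] [AddCommGroup C] [Module ℚ C] (f : A →ₗ[ℚ] B →ₗ[ℚ] C) (p q : F) (a : A) (b : B) :
    bilinExt F f (p ⊗ₜ a) (q ⊗ₜ b) = (p * q) ⊗ₜ f a b := by
  simp [bilinExt]

lemma baseChange_induction {A : Type*} [AddCommGroup A] [Module ℚ A] {N : Submodule ℚ A}
    {p : F ⊗[ℚ] A → Prop} (hmem : ∀ a ∈ N, p (1 ⊗ₜ a)) (hzero : p 0)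
    (hadd : ∀ x y, p x → p y → p (x + y)) (hsmul : ∀ (c : F) x, p x → p (c • x))
    {x : F ⊗[ℚ] A} (hx : x ∈ N.baseChange F) : p x := by
  rw [Submodule.baseChange_eq_span] at hx
  induction hx using Submodule.span_induction with
  | mem x h => obtain ⟨a, ha, rfl⟩ := h; exact hmem a ha
  | zero => exact hzero
  | add x y _ _ h1 h2 => exact hadd x y h1 h2
  | smul c x _ h => exact hsmul c x h

lemma ext_induction {A : Type*} [AddCommGroup A] [Module ℚ A]
    {p : F ⊗[ℚ] A → Prop} (hmem : ∀ a, p (1 ⊗ₜ a)) (hzero : p 0)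
    (hadd : ∀ x y, p x → p y → p (x + y)) (hsmul : ∀ (c : F) x, p x → p (c • x))
    (x : F ⊗[ℚ] A) : p x :=
  baseChange_induction (N := ⊤) (fun a _ => hmem a) hzero hadd hsmul
    (by rw [Submodule.baseChange_top]; trivial)

end BaseChange

/-! ### Graded components of the exterior algebra -/

section Grading

variable {V : Type*} [AddCommGroup V] [Module ℚ V]

/-- The projection of `∧^* V` to `∧^k V`. -/
abbrev extProj (V : Type*) [AddCommGroup V] [Module ℚ V] (k : ℕ) :
    ExteriorAlgebra ℚ V →ₗ[ℚ] ExteriorAlgebra ℚ V :=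
  GradedAlgebra.proj (fun j : ℕ => ⋀[ℚ]^j V) k

lemma extProj_mem (k : ℕ) (x : ExteriorAlgebra ℚ V) : extProj V k x ∈ ⋀[ℚ]^k V := by
  rw [GradedAlgebra.proj_apply]; exact SetLike.coe_mem _

lemma extProj_of_mem {k : ℕ} {x : ExteriorAlgebra ℚ V} (hx : x ∈ ⋀[ℚ]^k V) : extProj V k x = x := by
  rw [GradedAlgebra.proj_apply]
  exact DirectSum.decompose_of_mem_same (fun j : ℕ => ⋀[ℚ]^j V) hx

lemma extProj_of_mem_ne {k j : ℕ} {x : ExteriorAlgebra ℚ V} (hx : x ∈ ⋀[ℚ]^k V) (h : k ≠ j) :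
    extProj V j x = 0 := by
  rw [GradedAlgebra.proj_apply]
  exact DirectSum.decompose_of_mem_ne (fun j : ℕ => ⋀[ℚ]^j V) hx h

lemma sum_extProj (x : ExteriorAlgebra ℚ V) :
    ∃ m : ℕ, ∑ i ∈ Finset.range m, extProj V i x = x ∧ ∀ i, m ≤ i → extProj V i x = 0 := by
  classical
  set s := (DirectSum.decompose (fun j : ℕ => ⋀[ℚ]^j V) x).support with hs
  obtain ⟨m, hm⟩ := s.exists_nat_subset_range
  have h0 : ∀ i, i ∉ s → extProj V i x = 0 := by
    intro i hi
    rw [GradedAlgebra.proj_apply]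
    simpa [hs] using hi
  refine ⟨m, ?_, fun i hi => h0 i fun h => ?_⟩
  · rw [← Finset.sum_subset hm fun i _ hi => h0 i hi]
    exact DirectSum.sum_support_decompose (fun j : ℕ => ⋀[ℚ]^j V) x
  · exact absurd (Finset.mem_range.1 (hm h)) (by omega)

lemma ι_mem_exteriorPower (v : V) : ExteriorAlgebra.ι ℚ v ∈ ⋀[ℚ]^1 V := by
  rw [ExteriorAlgebra.exteriorPower, pow_one]; exact ⟨v, rfl⟩

lemma extProj_ι_mul (v : V) (k : ℕ) (x : ExteriorAlgebra ℚ V) :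
    extProj V (k + 1) (ExteriorAlgebra.ι ℚ v * x) = ExteriorAlgebra.ι ℚ v * extProj V k x := by
  rw [GradedAlgebra.proj_apply, GradedAlgebra.proj_apply, add_comm]
  exact DirectSum.coe_decompose_mul_add_of_left_mem (fun j : ℕ => ⋀[ℚ]^j V) (ι_mem_exteriorPower v)

lemma extProj_zero_apply (x : ExteriorAlgebra ℚ V) :
    extProj V 0 x = algebraMap ℚ _ (ExteriorAlgebra.algebraMapInv x) := by
  induction x using CliffordAlgebra.left_induction with
  | algebraMap r =>
    have h1 : ExteriorAlgebra.algebraMapInv (algebraMap ℚ (ExteriorAlgebra ℚ V) r) = r :=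
      ExteriorAlgebra.algebraMap_leftInverse V r
    have h2 : algebraMap ℚ (ExteriorAlgebra ℚ V) r ∈ ⋀[ℚ]^0 V := by
      rw [ExteriorAlgebra.exteriorPower, pow_zero]; exact Submodule.algebraMap_mem r
    rw [extProj_of_mem h2, h1]
  | add x y hx hy => rw [map_add, map_add, map_add, hx, hy]
  | ι_mul x m hx =>
    obtain ⟨j, hj, -⟩ := sum_extProj x
    have h1 : ExteriorAlgebra.algebraMapInv (ExteriorAlgebra.ι ℚ m * x) = 0 :=
      algebraMapInv_ι_mul m x
    have h2 : ExteriorAlgebra.ι ℚ m * x =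
        ∑ i ∈ Finset.range j, extProj V (i + 1) (ExteriorAlgebra.ι ℚ m * x) := by
      simp only [extProj_ι_mul]
      rw [← Finset.mul_sum, hj]
    change extProj V 0 (ExteriorAlgebra.ι ℚ m * x) =
      algebraMap ℚ _ (ExteriorAlgebra.algebraMapInv (ExteriorAlgebra.ι ℚ m * x))
    rw [h1, map_zero, h2, map_sum]
    exact Finset.sum_eq_zero fun i _ => extProj_of_mem_ne (extProj_mem _ _) (by omega)

lemma extProj_zero_ι_mul (v : V) (x : ExteriorAlgebra ℚ V) :
    extProj V 0 (ExteriorAlgebra.ι ℚ v * x) = 0 := by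
  rw [extProj_zero_apply, algebraMapInv_ι_mul, map_zero]

lemma contractLeft_mem_exteriorPower (d : Dual ℚ V) {k : ℕ} {x : ExteriorAlgebra ℚ V}
    (hx : x ∈ ⋀[ℚ]^(k + 1) V) :
    contractLeft (Q := (0 : QuadraticForm ℚ V)) d x ∈ ⋀[ℚ]^k V := by
  have : ∀ j, ∀ x ∈ ⋀[ℚ]^j V, (j = 0 → contractLeft (Q := (0 : QuadraticForm ℚ V)) d x = 0) ∧
      ∀ i, j = i + 1 → contractLeft (Q := (0 : QuadraticForm ℚ V)) d x ∈ ⋀[ℚ]^i V := by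
    intro j x hx
    induction hx using Submodule.pow_induction_on_left' with
    | algebraMap r =>
      refine ⟨fun _ => contractLeft_algebraMap (Q := (0 : QuadraticForm ℚ V)) d r, ?_⟩
      intro i hi; omega
    | add x y i hx hy h1 h2 =>
      refine ⟨fun h => by rw [map_add, h1.1 h, h2.1 h, add_zero], fun j hj => ?_⟩
      rw [map_add]
      exact Submodule.add_mem _ (h1.2 j hj) (h2.2 j hj)
    | mem_mul m hm i x hx h =>
      obtain ⟨v, rfl⟩ := hm
      refine ⟨fun h => by omega, fun j hj => ?_⟩
      obtain rfl : i = j := by omega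
      rw [contractLeft_ι_mul']
      refine Submodule.sub_mem _ (Submodule.smul_mem _ _ hx) ?_
      rcases i with _ | i
      · rw [h.1 rfl, mul_zero]; exact zero_mem _
      · rw [ExteriorAlgebra.exteriorPower, pow_succ']
        exact Submodule.mul_mem_mul ⟨v, rfl⟩ (h.2 i rfl)
  exact (this _ x hx).2 k rfl

lemma extProj_contractLeft (d : Dual ℚ V) (k : ℕ) (x : ExteriorAlgebra ℚ V) :
    extProj V k (contractLeft (Q := (0 : QuadraticForm ℚ V)) d x) =
      contractLeft (Q := (0 : QuadraticForm ℚ V)) d (extProj V (k + 1) x) := by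
  obtain ⟨m, hm, hm'⟩ := sum_extProj x
  have h0 : contractLeft (Q := (0 : QuadraticForm ℚ V)) d (extProj V 0 x) = 0 := by
    rw [extProj_zero_apply]; exact contractLeft_algebraMap (Q := (0 : QuadraticForm ℚ V)) d _
  conv_lhs => rw [← hm]
  rw [map_sum, map_sum]
  rw [Finset.sum_eq_single (k + 1)]
  · exact extProj_of_mem (contractLeft_mem_exteriorPower d (extProj_mem _ _))
  · intro i _ hi
    rcases i with _ | i
    · rw [h0, map_zero]
    · exact extProj_of_mem_ne (contractLeft_mem_exteriorPower d (extProj_mem _ _)) (by omega)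
  · intro h
    rw [hm' _ (by simpa using h), map_zero, map_zero]

/-- Parity is needed only in degree `1`, to exclude a linear term in `φ'` of even classes. -/
lemma involute_extProj_one (x : ExteriorAlgebra ℚ V) :
    extProj V 1 (involute x) = -extProj V 1 x := by
  induction x using CliffordAlgebra.left_induction with
  | algebraMap r =>
    have h2 : algebraMap ℚ (ExteriorAlgebra ℚ V) r ∈ ⋀[ℚ]^0 V := by
      rw [ExteriorAlgebra.exteriorPower, pow_zero]; exact Submodule.algebraMap_mem r
    rw [AlgHom.commutes]
    change extProj V 1 (algebraMap ℚ (ExteriorAlgebra ℚ V) r) =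
      -extProj V 1 (algebraMap ℚ (ExteriorAlgebra ℚ V) r)
    rw [extProj_of_mem_ne h2 zero_ne_one, neg_zero]
  | add x y hx hy => rw [map_add, map_add, map_add, hx, hy, neg_add]
  | ι_mul x m hx =>
    rw [map_mul, involute_ι, neg_mul, map_neg]
    have := extProj_ι_mul m 0 x
    have h' := extProj_ι_mul m 0 (involute x)
    refine congrArg _ (h'.trans (Eq.trans ?_ this.symm))
    rw [extProj_zero_apply, extProj_zero_apply, algebraMapInv_involute]

end Grading

/-! ### Multiplication, contraction and projection over `F` -/

section Operators

variable (F M : Type*) [Field F] [CharZero F] [AddCommGroup M] [Module ℚ M]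

/-- The inclusion of `V_F` in the algebra `(∧^* V)_F`. -/
def iotaExt : F ⊗[ℚ] (M × Dual ℚ M) →ₗ[F] F ⊗[ℚ] ExteriorAlgebra ℚ (M × Dual ℚ M) :=
  (ExteriorAlgebra.ι ℚ).baseChange F

/-- Contraction with the functional `(v, •)_V` on `(∧^* V)_F`, for `v ∈ V_F`. -/
def ctrExt : F ⊗[ℚ] (M × Dual ℚ M) →ₗ[F] F ⊗[ℚ] ExteriorAlgebra ℚ (M × Dual ℚ M) →ₗ[F]
    F ⊗[ℚ] ExteriorAlgebra ℚ (M × Dual ℚ M) :=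
  bilinExt F (contractLeft (Q := (0 : QuadraticForm ℚ (M × Dual ℚ M))) ∘ₗ pairV ℚ M)

/-- The pairing on `V_F`. -/
def pairExt : LinearMap.BilinForm F (F ⊗[ℚ] (M × Dual ℚ M)) :=
  (bilinExt F (pairV ℚ M)).compr₂ (AlgebraTensorModule.rid ℚ F F).toLinearMap

/-- The projection of `V_F` to `H¹(X, F)`. -/
def fstExt : F ⊗[ℚ] (M × Dual ℚ M) →ₗ[F] F ⊗[ℚ] (M × Dual ℚ M) :=
  (LinearMap.inl ℚ M (Dual ℚ M) ∘ₗ LinearMap.fst ℚ M (Dual ℚ M)).baseChange F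

/-- The projection of `(∧^* V)_F` to its component of degree `k`. -/
def projExt (k : ℕ) : F ⊗[ℚ] ExteriorAlgebra ℚ (M × Dual ℚ M) →ₗ[F]
    F ⊗[ℚ] ExteriorAlgebra ℚ (M × Dual ℚ M) :=
  (extProj (M × Dual ℚ M) k).baseChange F

/-- The component of degree `0` as a scalar. -/
def augExt : F ⊗[ℚ] ExteriorAlgebra ℚ (M × Dual ℚ M) →ₗ[F] F :=
  (AlgebraTensorModule.rid ℚ F F).toLinearMap ∘ₗ
    (ExteriorAlgebra.algebraMapInv.toLinearMap).baseChange F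

variable {F M}

@[simp] lemma iotaExt_tmul (c : F) (v : M × Dual ℚ M) :
    iotaExt F M (c ⊗ₜ v) = c ⊗ₜ ExteriorAlgebra.ι ℚ v := rfl

@[simp] lemma ctrExt_tmul (c c' : F) (v : M × Dual ℚ M) (x : ExteriorAlgebra ℚ (M × Dual ℚ M)) :
    ctrExt F M (c ⊗ₜ v) (c' ⊗ₜ x) =
      (c * c') ⊗ₜ contractLeft (Q := (0 : QuadraticForm ℚ (M × Dual ℚ M))) (pairV ℚ M v) x := by
  simp [ctrExt]

@[simp] lemma pairExt_tmul (c c' : F) (v v' : M × Dual ℚ M) :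
    pairExt F M (c ⊗ₜ v) (c' ⊗ₜ v') = pairV ℚ M v v' • (c * c') := by
  simp [pairExt]

@[simp] lemma fstExt_tmul (c : F) (v : M × Dual ℚ M) : fstExt F M (c ⊗ₜ v) = c ⊗ₜ (v.1, 0) := rfl

@[simp] lemma projExt_tmul (k : ℕ) (c : F) (x : ExteriorAlgebra ℚ (M × Dual ℚ M)) :
    projExt F M k (c ⊗ₜ x) = c ⊗ₜ extProj (M × Dual ℚ M) k x := rfl

@[simp] lemma augExt_tmul (c : F) (x : ExteriorAlgebra ℚ (M × Dual ℚ M)) :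
    augExt F M (c ⊗ₜ x) = ExteriorAlgebra.algebraMapInv x • c := by
  simp [augExt]

lemma pairExt_comm (v v' : F ⊗[ℚ] (M × Dual ℚ M)) : pairExt F M v v' = pairExt F M v' v := by
  induction v using ext_induction with
  | hzero => simp
  | hadd x y hx hy => simp [hx, hy]
  | hsmul c x h => simp [h]
  | hmem a =>
    induction v' using ext_induction with
    | hzero => simp
    | hadd x y hx hy => simp [hx, hy]
    | hsmul c x h => simp [h]
    | hmem b => rw [pairExt_tmul, pairExt_tmul]; simp [pairV, add_comm]

lemma ctrExt_iotaExt_mul (u v : F ⊗[ℚ] (M × Dual ℚ M))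
    (x : F ⊗[ℚ] ExteriorAlgebra ℚ (M × Dual ℚ M)) :
    ctrExt F M u (iotaExt F M v * x) = pairExt F M u v • x - iotaExt F M v * ctrExt F M u x := by
  induction u using ext_induction with
  | hzero => simp
  | hadd a b ha hb => simp only [map_add, LinearMap.add_apply, ha, hb, add_smul, mul_add]; abel
  | hsmul c a h =>
    simp only [map_smul, LinearMap.smul_apply, h, smul_sub, mul_smul_comm, smul_smul, smul_eq_mul]
  | hmem a =>
    induction v using ext_induction with
    | hzero => simp
    | hadd c d hc hd => simp only [map_add, add_mul, hc, hd, add_smul]; abel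
    | hsmul c b h =>
      simp only [map_smul, smul_mul_assoc, h, smul_sub, smul_smul, smul_eq_mul]
    | hmem b =>
      induction x using ext_induction with
      | hzero => simp
      | hadd c d hc hd => simp only [map_add, mul_add, hc, hd, smul_add]; abel
      | hsmul c y h => rw [mul_smul_comm, map_smul, h, map_smul, smul_sub, mul_smul_comm,
          smul_comm]
      | hmem y =>
        rw [iotaExt_tmul, Algebra.TensorProduct.tmul_mul_tmul, ctrExt_tmul, contractLeft_ι_mul',
          pairExt_tmul, ctrExt_tmul, Algebra.TensorProduct.tmul_mul_tmul, tmul_sub, tmul_smul,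
          smul_assoc]
        simp [smul_tmul']

lemma iotaExt_mul_comm (u v : F ⊗[ℚ] (M × Dual ℚ M)) :
    iotaExt F M u * iotaExt F M v = -(iotaExt F M v * iotaExt F M u) := by
  induction u using ext_induction with
  | hzero => simp
  | hadd c d hc hd => rw [map_add, add_mul, hc, hd, mul_add, neg_add]
  | hsmul c b h => rw [map_smul, smul_mul_assoc, h, mul_smul_comm, smul_neg]
  | hmem a =>
    induction v using ext_induction with
    | hzero => simp
    | hadd c d hc hd => rw [map_add, mul_add, hc, hd, add_mul, neg_add]
    | hsmul c b h => rw [map_smul, mul_smul_comm, h, smul_mul_assoc, smul_neg]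
    | hmem b =>
      rw [iotaExt_tmul, iotaExt_tmul, Algebra.TensorProduct.tmul_mul_tmul,
        Algebra.TensorProduct.tmul_mul_tmul,
        eq_neg_of_add_eq_zero_left (ExteriorAlgebra.ι_add_mul_swap _ _), tmul_neg]

lemma ctrExt_comm (u v : F ⊗[ℚ] (M × Dual ℚ M))
    (x : F ⊗[ℚ] ExteriorAlgebra ℚ (M × Dual ℚ M)) :
    ctrExt F M u (ctrExt F M v x) = -ctrExt F M v (ctrExt F M u x) := by
  induction u using ext_induction with
  | hzero => simp
  | hadd a b ha hb => simp only [map_add, LinearMap.add_apply, ha, hb, neg_add]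
  | hsmul c a h => simp only [map_smul, LinearMap.smul_apply, h, smul_neg]
  | hmem a =>
    induction v using ext_induction with
    | hzero => simp
    | hadd c d hc hd => simp only [map_add, LinearMap.add_apply, hc, hd, neg_add]
    | hsmul c b h => simp only [map_smul, LinearMap.smul_apply, h, smul_neg]
    | hmem b =>
      induction x using ext_induction with
      | hzero => simp
      | hadd c d hc hd => simp only [map_add, hc, hd, neg_add]
      | hsmul c y h => simp only [map_smul, h, smul_neg]
      | hmem y =>
        rw [ctrExt_tmul, ctrExt_tmul, ctrExt_tmul, ctrExt_tmul, contractLeft_comm, tmul_neg]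

lemma projExt_iotaExt_mul (v : F ⊗[ℚ] (M × Dual ℚ M)) (k : ℕ)
    (x : F ⊗[ℚ] ExteriorAlgebra ℚ (M × Dual ℚ M)) :
    projExt F M (k + 1) (iotaExt F M v * x) = iotaExt F M v * projExt F M k x := by
  induction v using ext_induction with
  | hzero => simp
  | hadd c d hc hd => simp only [map_add, add_mul, hc, hd]
  | hsmul c b h => simp only [map_smul, smul_mul_assoc, h]
  | hmem b =>
    induction x using ext_induction with
    | hzero => simp
    | hadd c d hc hd => simp only [map_add, mul_add, hc, hd]
    | hsmul c y h => simp only [map_smul, mul_smul_comm, h]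
    | hmem y =>
      rw [iotaExt_tmul, Algebra.TensorProduct.tmul_mul_tmul, projExt_tmul, projExt_tmul,
        extProj_ι_mul, Algebra.TensorProduct.tmul_mul_tmul]

lemma projExt_zero_iotaExt_mul (v : F ⊗[ℚ] (M × Dual ℚ M))
    (x : F ⊗[ℚ] ExteriorAlgebra ℚ (M × Dual ℚ M)) :
    projExt F M 0 (iotaExt F M v * x) = 0 := by
  induction v using ext_induction with
  | hzero => simp
  | hadd c d hc hd => simp only [map_add, add_mul, hc, hd, add_zero]
  | hsmul c b h => simp only [map_smul, smul_mul_assoc, h, smul_zero]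
  | hmem b =>
    induction x using ext_induction with
    | hzero => simp
    | hadd c d hc hd => simp only [map_add, mul_add, hc, hd, add_zero]
    | hsmul c y h => simp only [map_smul, mul_smul_comm, h, smul_zero]
    | hmem y =>
      rw [iotaExt_tmul, Algebra.TensorProduct.tmul_mul_tmul, projExt_tmul, extProj_zero_ι_mul,
        tmul_zero]

lemma projExt_ctrExt (v : F ⊗[ℚ] (M × Dual ℚ M)) (k : ℕ)
    (x : F ⊗[ℚ] ExteriorAlgebra ℚ (M × Dual ℚ M)) :
    projExt F M k (ctrExt F M v x) = ctrExt F M v (projExt F M (k + 1) x) := by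
  induction v using ext_induction with
  | hzero => simp
  | hadd c d hc hd => simp only [map_add, LinearMap.add_apply, hc, hd]
  | hsmul c b h => simp only [map_smul, LinearMap.smul_apply, h]
  | hmem b =>
    induction x using ext_induction with
    | hzero => simp
    | hadd c d hc hd => simp only [map_add, hc, hd]
    | hsmul c y h => simp only [map_smul, h]
    | hmem y => rw [ctrExt_tmul, projExt_tmul, projExt_tmul, ctrExt_tmul, extProj_contractLeft]

lemma projExt_zero_eq (x : F ⊗[ℚ] ExteriorAlgebra ℚ (M × Dual ℚ M)) :
    projExt F M 0 x = augExt F M x • 1 := by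
  induction x using ext_induction with
  | hzero => simp
  | hadd c d hc hd => simp only [map_add, hc, hd, add_smul]
  | hsmul c y h => simp only [map_smul, h, smul_assoc]
  | hmem y =>
    rw [projExt_tmul, extProj_zero_apply, augExt_tmul, Algebra.algebraMap_eq_smul_one,
      Algebra.TensorProduct.one_def, smul_tmul', tmul_smul]
    simp [smul_tmul']

/-- All bounds `j ≥ m` are allowed, so that the bounds of two summands can be merged. -/
lemma exists_sum_projExt (x : F ⊗[ℚ] ExteriorAlgebra ℚ (M × Dual ℚ M)) :
    ∃ m : ℕ, ∀ j, m ≤ j → ∑ i ∈ Finset.range j, projExt F M i x = x := by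
  induction x using ext_induction with
  | hzero => exact ⟨0, fun j _ => by simp⟩
  | hadd c d hc hd =>
    obtain ⟨m₁, h₁⟩ := hc
    obtain ⟨m₂, h₂⟩ := hd
    refine ⟨max m₁ m₂, fun j hj => ?_⟩
    simp only [map_add, Finset.sum_add_distrib]
    rw [h₁ j (le_of_max_le_left hj), h₂ j (le_of_max_le_right hj)]
  | hsmul c y h =>
    obtain ⟨m, hm⟩ := h
    refine ⟨m, fun j hj => ?_⟩
    simp only [map_smul, ← Finset.smul_sum]
    rw [hm j hj]
  | hmem y =>
    obtain ⟨m, hm, h0⟩ := sum_extProj y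
    refine ⟨m, fun j hj => ?_⟩
    conv_rhs => rw [← hm]
    rw [tmul_sum]
    refine (Finset.sum_subset (Finset.range_mono hj) fun i _ hi => ?_).symm
    rw [projExt_tmul, h0 i (by simpa using hi), tmul_zero]

lemma exists_projExt_ne_zero {x : F ⊗[ℚ] ExteriorAlgebra ℚ (M × Dual ℚ M)} (hx : x ≠ 0) :
    ∃ k, projExt F M k x ≠ 0 := by
  obtain ⟨m, hm⟩ := exists_sum_projExt x
  by_contra! h
  exact hx ((hm m le_rfl).symm.trans (Finset.sum_eq_zero fun i _ => h i))

lemma projExt_mem (k : ℕ) (x : F ⊗[ℚ] ExteriorAlgebra ℚ (M × Dual ℚ M)) :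
    projExt F M k x ∈ (⋀[ℚ]^k (M × Dual ℚ M)).baseChange F := by
  induction x using ext_induction with
  | hzero => rw [map_zero]; exact zero_mem _
  | hadd c d hc hd => rw [map_add]; exact add_mem hc hd
  | hsmul c y h => rw [map_smul]; exact Submodule.smul_mem _ _ h
  | hmem y => exact Submodule.tmul_mem_baseChange_of_mem _ (extProj_mem _ _)

lemma projExt_of_mem_ne {j k : ℕ} (hjk : k ≠ j) {x : F ⊗[ℚ] ExteriorAlgebra ℚ (M × Dual ℚ M)}
    (hx : x ∈ (⋀[ℚ]^k (M × Dual ℚ M)).baseChange F) : projExt F M j x = 0 := by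
  refine baseChange_induction (p := fun x => projExt F M j x = 0) (fun y hy => ?_) (map_zero _)
    (fun c d hc hd => by rw [map_add, hc, hd, add_zero])
    (fun c y h => by rw [map_smul, h, smul_zero]) hx
  rw [projExt_tmul, extProj_of_mem_ne hy hjk, tmul_zero]

lemma mem_iSup_baseChange_iff (k : ℕ) (x : F ⊗[ℚ] ExteriorAlgebra ℚ (M × Dual ℚ M)) :
    x ∈ ⨆ i : ℕ, ⨆ _ : k ≤ i, (⋀[ℚ]^i (M × Dual ℚ M)).baseChange F ↔
      ∀ i < k, projExt F M i x = 0 := by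
  constructor
  · intro hx i hi
    have : ⨆ i : ℕ, ⨆ _ : k ≤ i, (⋀[ℚ]^i (M × Dual ℚ M)).baseChange F ≤
        LinearMap.ker (projExt F M i) := by
      refine iSup₂_le fun j hj y hy => ?_
      exact projExt_of_mem_ne (by omega) hy
    exact this hx
  · intro h
    obtain ⟨m, hm⟩ := exists_sum_projExt x
    rw [← hm m le_rfl]
    refine Submodule.sum_mem _ fun i _ => ?_
    by_cases hi : k ≤ i
    · exact Submodule.mem_iSup_of_mem i (Submodule.mem_iSup_of_mem hi (projExt_mem i x))
    · rw [h i (by omega)]; exact zero_mem _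

/-- The number operator in a pair of dual bases of `V_F`. -/
lemma sum_iotaExt_mul_ctrExt {ι' : Type*} [Fintype ι'] {b c : ι' → F ⊗[ℚ] (M × Dual ℚ M)}
    (h : ∀ v, ∑ j, pairExt F M (c j) v • b j = v) (k : ℕ)
    (x : F ⊗[ℚ] ExteriorAlgebra ℚ (M × Dual ℚ M)) :
    ∑ j, iotaExt F M (b j) * ctrExt F M (c j) (projExt F M k x) = (k : F) • projExt F M k x := by
  have key : ∀ k : ℕ, ∀ y ∈ ⋀[ℚ]^k (M × Dual ℚ M),
      ∑ j, iotaExt F M (b j) * ctrExt F M (c j) (1 ⊗ₜ y) = (k : F) • (1 : F) ⊗ₜ[ℚ] y := by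
    intro k y hy
    induction hy using Submodule.pow_induction_on_left' with
    | algebraMap r =>
      have : ∀ v : F ⊗[ℚ] (M × Dual ℚ M),
          ctrExt F M v (1 ⊗ₜ algebraMap ℚ (ExteriorAlgebra ℚ (M × Dual ℚ M)) r) = 0 := by
        intro v
        induction v using ext_induction with
        | hzero => simp
        | hadd c d hc hd => simp only [map_add, LinearMap.add_apply, hc, hd, add_zero]
        | hsmul c b h => simp only [map_smul, LinearMap.smul_apply, h, smul_zero]
        | hmem b =>
          have h2 := contractLeft_algebraMap (Q := (0 : QuadraticForm ℚ (M × Dual ℚ M)))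
            (pairV ℚ M b) r
          rw [ctrExt_tmul]
          exact (congrArg _ h2).trans (tmul_zero _ _)
      simp [this]
    | add x y i hx hy h1 h2 =>
      rw [tmul_add, smul_add, ← h1, ← h2, ← Finset.sum_add_distrib]
      simp only [map_add, mul_add]
    | mem_mul m hm i x hx h1 =>
      obtain ⟨v, rfl⟩ := hm
      have h2 : (1 : F) ⊗ₜ[ℚ] (ExteriorAlgebra.ι ℚ v * x) = iotaExt F M (1 ⊗ₜ v) * (1 ⊗ₜ x) := by
        simp
      -- Summed over `j`, the first term reproduces `v ∧ x` and raises the eigenvalue by one; the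
      -- second is the inductive case multiplied by `v`.
      have h3 : ∀ j, iotaExt F M (b j) * ctrExt F M (c j) (iotaExt F M (1 ⊗ₜ v) * (1 ⊗ₜ x)) =
          iotaExt F M (pairExt F M (c j) (1 ⊗ₜ v) • b j) * (1 ⊗ₜ x) +
          iotaExt F M (1 ⊗ₜ v) * (iotaExt F M (b j) * ctrExt F M (c j) (1 ⊗ₜ x)) := by
        intro j
        rw [ctrExt_iotaExt_mul, mul_sub, mul_smul_comm, map_smul, smul_mul_assoc, ← mul_assoc,
          iotaExt_mul_comm, neg_mul, sub_neg_eq_add, mul_assoc]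
      rw [h2, Finset.sum_congr rfl fun j _ => h3 j, Finset.sum_add_distrib, ← Finset.sum_mul,
        ← map_sum, h, ← Finset.mul_sum, h1, mul_smul_comm]
      push_cast
      module
  induction x using ext_induction with
  | hzero => simp
  | hadd c d hc hd =>
    rw [map_add, smul_add, ← hc, ← hd, ← Finset.sum_add_distrib]
    simp only [map_add, mul_add]
  | hsmul c y h =>
    rw [map_smul, smul_comm, ← h, Finset.smul_sum]
    simp only [map_smul, mul_smul_comm]
  | hmem y => exact key k _ (extProj_mem _ _)

end Operators

/-! ### Lagrangian subspaces -/

section Isotropic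

variable {F M : Type*} [Field F] [CharZero F] [AddCommGroup M] [Module ℚ M] {r : ℕ}

/-- Every functional on `V_F` is represented by the pairing. -/
lemma exists_pairExt_eq (e : Basis (Fin r) ℚ M) (f : Dual F (F ⊗[ℚ] (M × Dual ℚ M))) :
    ∃ v, pairExt F M v = f := by
  have hfin : FiniteDimensional ℚ M := Module.Finite.of_basis e
  refine ⟨∑ i, f (1 ⊗ₜ (0, e.coord i)) • (1 ⊗ₜ (e i, 0)) +
    ∑ i, f (1 ⊗ₜ (e i, 0)) • (1 ⊗ₜ (0, e.coord i)), ?_⟩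
  refine ((e.prod e.dualBasis).baseChange F).ext fun j => ?_
  rw [map_add, LinearMap.add_apply, map_sum, map_sum, LinearMap.sum_apply, LinearMap.sum_apply]
  simp only [map_smul, LinearMap.smul_apply, Basis.baseChange_apply]
  rcases j with j | j
  · rw [Finset.sum_eq_zero, Finset.sum_eq_single j, zero_add]
    · simp [pairV]
    · intro i _ hi; simp [pairV, hi.symm]
    · simp
    · intro i _; simp [pairV]
  · rw [Finset.sum_eq_single j, Finset.sum_eq_zero, add_zero]
    · simp [pairV]
    · intro i _; simp [pairV]
    · intro i _ hi; simp [pairV, hi.symm]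
    · simp

lemma pairExt_nondegenerate (e : Basis (Fin r) ℚ M) : (pairExt F M).Nondegenerate := by
  have hrefl : (pairExt F M).IsRefl := fun x y h => by rwa [pairExt_comm]
  refine (LinearMap.IsRefl.nondegenerate_iff_separatingLeft hrefl).2 fun v hv => ?_
  refine (forall_dual_apply_eq_zero_iff F v).1 fun f => ?_
  obtain ⟨u, rfl⟩ := exists_pairExt_eq e f
  rw [pairExt_comm, hv]

lemma finrank_VExt (e : Basis (Fin r) ℚ M) : finrank F (F ⊗[ℚ] (M × Dual ℚ M)) = r + r := by
  have hfin : FiniteDimensional ℚ M := Module.Finite.of_basis e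
  rw [finrank_baseChange, finrank_prod, Subspace.dual_finrank_eq, finrank_eq_card_basis e,
    Fintype.card_fin]

/-- A maximal isotropic subspace of `V_F` is its own orthogonal complement. -/
lemma orthogonal_eq_of_maximal (e : Basis (Fin r) ℚ M) {W : Submodule F (F ⊗[ℚ] (M × Dual ℚ M))}
    (hW : Maximal (fun W' : Submodule F (F ⊗[ℚ] (M × Dual ℚ M)) =>
      ∀ x ∈ W', ∀ y ∈ W', pairExt F M x y = 0) W) :
    (pairExt F M).orthogonal W = W ∧ finrank F W = r := by
  have hfin : FiniteDimensional ℚ M := Module.Finite.of_basis e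
  have hsymm : ∀ x y, pairExt F M x y = 0 → pairExt F M y x = 0 := fun x y h => by
    rwa [pairExt_comm]
  have hnd := pairExt_nondegenerate (F := F) e
  have hV := finrank_VExt (F := F) e
  set B := pairExt F M with hB
  -- `L = H¹(X, F)` is one known Lagrangian; comparing `W` with it settles the dimension over any
  -- `F`.
  set L : Submodule F (F ⊗[ℚ] (M × Dual ℚ M)) :=
    LinearMap.range ((LinearMap.inl ℚ M (Dual ℚ M)).baseChange F) with hL
  have hLfin : finrank F L = r := by
    rw [hL, LinearMap.finrank_range_of_inj, finrank_baseChange, finrank_eq_card_basis e,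
      Fintype.card_fin]
    exact Module.Flat.lTensor_preserves_injective_linearMap _ LinearMap.inl_injective
  have hLiso : ∀ x ∈ L, ∀ y ∈ L, B x y = 0 := by
    rintro _ ⟨x, rfl⟩ _ ⟨y, rfl⟩
    induction x using ext_induction with
    | hzero => simp
    | hadd c d hc hd => simp only [map_add, LinearMap.add_apply, hc, hd, add_zero]
    | hsmul c b h => simp only [map_smul, LinearMap.smul_apply, h, smul_zero]
    | hmem x =>
      induction y using ext_induction with
      | hzero => simp
      | hadd c d hc hd => simp only [map_add, hc, hd, add_zero]
      | hsmul c b h => simp only [map_smul, h, smul_zero]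
      | hmem y => simp [hB, pairV]
  have hWle : W ≤ B.orthogonal W := fun x hx y hy => hW.1 y hy x hx
  have hLle : L ≤ B.orthogonal L := fun x hx y hy => hLiso y hy x hx
  have hLeq : L = B.orthogonal L := by
    refine Submodule.eq_of_le_of_finrank_eq hLle ?_
    rw [LinearMap.BilinForm.finrank_orthogonal hnd, hV, hLfin]; omega
  have hinf : B.orthogonal W ⊓ L = B.orthogonal (W ⊔ L) := by
    apply le_antisymm
    · rintro x ⟨hx, hxL⟩ y hy
      obtain ⟨a, ha, b, hb, rfl⟩ := Submodule.mem_sup.1 hy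
      have h1 : B a x = 0 := hx a ha
      have h2 : B b x = 0 := hLiso b hb x hxL
      change B (a + b) x = 0
      rw [map_add, LinearMap.add_apply, h1, h2, add_zero]
    · refine le_inf (LinearMap.BilinForm.orthogonal_le le_sup_left) ?_
      conv_rhs => rw [hLeq]
      exact LinearMap.BilinForm.orthogonal_le le_sup_right
  -- Enlarging `W` by `W^⊥ ∩ L` keeps it isotropic, so maximality absorbs the enlargement.
  have hsub : B.orthogonal W ⊓ L ≤ W := by
    have h1 : W ⊔ (B.orthogonal W ⊓ L) ≤ W := by
      refine hW.2 ?_ le_sup_left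
      intro x hx y hy
      obtain ⟨a, ha, b, ⟨hb, hbL⟩, rfl⟩ := Submodule.mem_sup.1 hx
      obtain ⟨c, hc, d, ⟨hd, hdL⟩, rfl⟩ := Submodule.mem_sup.1 hy
      have e1 : B a c = 0 := hW.1 a ha c hc
      have e2 : B a d = 0 := hd a ha
      have e3 : B b c = 0 := hsymm _ _ (hb c hc)
      have e4 : B b d = 0 := hLiso b hbL d hdL
      simp [e1, e2, e3, e4]
    exact le_sup_right.trans h1
  have hinf2 : B.orthogonal W ⊓ L = W ⊓ L :=
    le_antisymm (le_inf hsub inf_le_right) (inf_le_inf_right _ hWle)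
  have hdim := Submodule.finrank_sup_add_finrank_inf_eq W L
  have hle : finrank F (W ⊔ L : Submodule F _) ≤ r + r := hV ▸ Submodule.finrank_le _
  have hdim2 : finrank F (W ⊓ L : Submodule F _) = r + r - finrank F (W ⊔ L : Submodule F _) := by
    rw [← hinf2, hinf, LinearMap.BilinForm.finrank_orthogonal hnd, hV]
  -- `dim (W ∩ L) = 2r - dim (W + L)`, while the formula for sums gives `dim W + r = dim (W + L) +
  -- dim (W ∩ L)`.
  have hWr : finrank F W = r := by omega
  refine ⟨(Submodule.eq_of_le_of_finrank_eq hWle ?_).symm, hWr⟩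
  rw [LinearMap.BilinForm.finrank_orthogonal hnd, hV, hWr]; omega

/-- Bases adapted to a Lagrangian subspace: the number operator on the classes that are killed by
the contractions with `W`. -/
lemma exists_number_operator (e : Basis (Fin r) ℚ M) {W : Submodule F (F ⊗[ℚ] (M × Dual ℚ M))}
    (hW : (pairExt F M).orthogonal W = W) (hWr : finrank F W = r) :
    ∃ w c : Fin r → F ⊗[ℚ] (M × Dual ℚ M), (∀ i, w i ∈ W) ∧ (∀ i, pairExt F M (c i) (w i) = 1) ∧
      ∀ (k : ℕ) (x : F ⊗[ℚ] ExteriorAlgebra ℚ (M × Dual ℚ M)),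
        (∀ u ∈ W, ctrExt F M u (projExt F M k x) = 0) →
        ∑ i, iotaExt F M (w i) * ctrExt F M (c i) (projExt F M k x) = (k : F) • projExt F M k x := by
  have hfin : FiniteDimensional ℚ M := Module.Finite.of_basis e
  obtain ⟨W', hW'⟩ := Submodule.exists_isCompl W
  have hfree : Module.Free F W := Module.Free.of_divisionRing F W
  have hfree' : Module.Free F W' := Module.Free.of_divisionRing F W'
  set bW := Module.finBasisOfFinrankEq F W hWr
  set b := (bW.prod (Module.finBasis F W')).map (Submodule.prodEquivOfIsCompl W W' hW') with hb
  choose c hc using fun j => exists_pairExt_eq e (b.coord j)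
  have hbl : ∀ i, b (Sum.inl i) = bW i := by intro i; simp [hb]
  have hsum : ∀ v, ∑ j, pairExt F M (c j) v • b j = v := by
    intro v; simp only [hc]; exact b.sum_repr v
  -- Coordinates along the complement vanish on `W`, so the vectors representing them lie in `W^⊥ =
  -- W`. Their terms in the number operator therefore drop out on classes killed by contraction with
  -- `W`.
  have hcW : ∀ j, c (Sum.inr j) ∈ W := by
    intro j
    rw [← hW]
    intro x hx
    change pairExt F M x _ = 0
    rw [pairExt_comm, hc]
    have h1 : x = ∑ i, bW.repr ⟨x, hx⟩ i • b (Sum.inl i) := by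
      have := congrArg Subtype.val (bW.sum_repr ⟨x, hx⟩)
      simp only [hbl]
      exact this.symm.trans (map_sum W.subtype _ _)
    rw [h1, map_sum]
    refine Finset.sum_eq_zero fun i _ => ?_
    simp
  refine ⟨fun i => b (Sum.inl i), fun i => c (Sum.inl i), fun i => ?_, fun i => ?_, ?_⟩
  · change b (Sum.inl i) ∈ W
    rw [hbl]; exact (bW i).2
  · rw [hc]; simp
  · intro k x hx
    rw [← sum_iotaExt_mul_ctrExt hsum k x, Fintype.sum_sum_type]
    refine (add_eq_left.2 (Finset.sum_eq_zero fun j _ => ?_)).symm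
    rw [hx _ (hcW j), mul_zero]

/-- A homogeneous class that is killed by the contractions with a Lagrangian subspace `W` lies in
`∧^k W`. -/
lemma projExt_mem_pow (e : Basis (Fin r) ℚ M) {W : Submodule F (F ⊗[ℚ] (M × Dual ℚ M))}
    (hW : (pairExt F M).orthogonal W = W) (hWr : finrank F W = r) (k : ℕ)
    (x : F ⊗[ℚ] ExteriorAlgebra ℚ (M × Dual ℚ M))
    (hx : ∀ u ∈ W, ctrExt F M u (projExt F M k x) = 0) :
    projExt F M k x ∈ (W.map (iotaExt F M)) ^ k := by
  obtain ⟨w, c, hw, -, hN⟩ := exists_number_operator e hW hWr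
  induction k generalizing x with
  | zero =>
    rw [projExt_zero_eq, pow_zero]
    exact Submodule.smul_mem _ _ (Submodule.one_le.1 le_rfl)
  | succ k ih =>
    have h1 := hN (k + 1) x hx
    have hk : ((k + 1 : ℕ) : F) ≠ 0 := Nat.cast_ne_zero.2 (Nat.succ_ne_zero k)
    -- The number operator recovers the class, up to the factor `k + 1`, as a sum of `w i ∧ (c i ⌋
    -- •)`. Contractions anticommute, so each `c i ⌋ •` satisfies the hypothesis in degree `k`.
    rw [← inv_smul_smul₀ hk (projExt F M (k + 1) x), ← h1]
    refine Submodule.smul_mem _ _ (Submodule.sum_mem _ fun i _ => ?_)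
    rw [pow_succ', ← projExt_ctrExt]
    refine Submodule.mul_mem_mul ⟨w i, hw i, rfl⟩ (ih _ fun u hu => ?_)
    rw [projExt_ctrExt, ctrExt_comm, hx u hu, map_zero, neg_zero]

/-- A homogeneous class killed by the contractions with `W` and by the exterior multiplications with
`W` is zero or of degree `r`. -/
lemma eq_of_projExt_ne_zero (e : Basis (Fin r) ℚ M) {W : Submodule F (F ⊗[ℚ] (M × Dual ℚ M))}
    (hW : (pairExt F M).orthogonal W = W) (hWr : finrank F W = r) (k : ℕ)
    (x : F ⊗[ℚ] ExteriorAlgebra ℚ (M × Dual ℚ M)) (h0 : projExt F M k x ≠ 0)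
    (hx : ∀ u ∈ W, ctrExt F M u (projExt F M k x) = 0)
    (hx' : ∀ u ∈ W, iotaExt F M u * projExt F M k x = 0) : k = r := by
  obtain ⟨w, c, hw, hcw, hN⟩ := exists_number_operator e hW hWr
  have h1 := hN k x hx
  -- As `w i ∧ •` kills the class, the anticommutation relation makes each summand of the number
  -- operator the identity; its eigenvalue is then both `k` and `r`.
  have h2 : ∀ i, iotaExt F M (w i) * ctrExt F M (c i) (projExt F M k x) = projExt F M k x := by
    intro i
    have h3 := ctrExt_iotaExt_mul (c i) (w i) (projExt F M k x)
    rw [hx' _ (hw i), map_zero, hcw, one_smul] at h3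
    exact (sub_eq_zero.1 h3.symm).symm
  rw [Finset.sum_congr rfl fun i _ => h2 i, Finset.sum_const, Finset.card_univ, Fintype.card_fin,
    ← Nat.cast_smul_eq_nsmul F] at h1
  exact (Nat.cast_injective (smul_left_injective F h0 h1)).symm

/-- The power is an image of `∧^r` of an `r`-dimensional space. An upper bound suffices, since a
nonzero element comes from the pure spinor. -/
lemma finrank_pow_le_one (W : Submodule F (F ⊗[ℚ] (M × Dual ℚ M))) [FiniteDimensional F W]
    (hWr : finrank F W = r) :
    FiniteDimensional F ((W.map (iotaExt F M)) ^ r : Submodule F _) ∧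
    finrank F ((W.map (iotaExt F M)) ^ r : Submodule F _) ≤ 1 := by
  have hsq : ∀ v, iotaExt F M v * iotaExt F M v = 0 := by
    intro v
    have h := eq_neg_iff_add_eq_zero.1 (iotaExt_mul_comm v v)
    rw [← two_smul F] at h
    exact (smul_eq_zero.1 h).resolve_left two_ne_zero
  set g : ExteriorAlgebra F W →ₐ[F] F ⊗[ℚ] ExteriorAlgebra ℚ (M × Dual ℚ M) :=
    ExteriorAlgebra.lift F ⟨iotaExt F M ∘ₗ W.subtype, fun v => hsq v⟩ with hg
  have h1 : W.map (iotaExt F M) = (LinearMap.range (ExteriorAlgebra.ι F)).map g.toLinearMap := by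
    rw [← LinearMap.range_comp]
    have h3 : g.toLinearMap ∘ₗ ExteriorAlgebra.ι F = iotaExt F M ∘ₗ W.subtype := by
      exact LinearMap.ext fun x => ExteriorAlgebra.lift_ι_apply F _ _ x
    rw [h3, LinearMap.range_comp, Submodule.range_subtype]
  have h2 : (W.map (iotaExt F M)) ^ r = (⋀[F]^r W).map g.toLinearMap := by
    rw [h1, Submodule.map_pow]
  rw [h2]
  refine ⟨inferInstance, (Submodule.finrank_map_le _ _).trans ?_⟩
  have hfree : Module.Free F W := Module.Free.of_divisionRing F W
  rw [exteriorPower.finrank_eq, hWr, Nat.choose_self]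

/-- The lines `∧^r W₁` and `∧^r W₂` of two different Lagrangian subspaces are independent. -/
lemma disjoint_span {W₁ W₂ : Submodule F (F ⊗[ℚ] (M × Dual ℚ M))}
    (hW₁ : (pairExt F M).orthogonal W₁ = W₁) (hne : ¬ W₂ ≤ W₁)
    {x₁ x₂ : F ⊗[ℚ] ExteriorAlgebra ℚ (M × Dual ℚ M)}
    (hx₁ : ∀ u ∈ W₁, ctrExt F M u x₁ = 0) (hx₂ : ∀ u ∈ W₂, iotaExt F M u * x₂ = 0) :
    Disjoint (Submodule.span F {x₁}) (Submodule.span F {x₂}) := by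
  rw [Submodule.disjoint_def]
  intro x h1 h2
  obtain ⟨a, rfl⟩ := Submodule.mem_span_singleton.1 h1
  obtain ⟨b, hb⟩ := Submodule.mem_span_singleton.1 h2
  -- A vector `u ∈ W₂` outside `W₁ = W₁^⊥` pairs nontrivially with some `w ∈ W₁`. On a common
  -- element of the lines, the anticommutator of `w ⌋ •` and `u ∧ •` is both `0` and the scalar `(w,
  -- u)`.
  obtain ⟨u, hu, hu'⟩ := SetLike.not_le_iff_exists.1 hne
  rw [← hW₁, LinearMap.BilinForm.mem_orthogonal_iff] at hu'
  push Not at hu'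
  obtain ⟨w, hw, hwu⟩ := hu'
  have h3 := ctrExt_iotaExt_mul w u (a • x₁)
  rw [map_smul, hx₁ w hw, smul_zero, mul_zero, sub_zero, ← hb, mul_smul_comm, hx₂ u hu, smul_zero,
    map_zero, hb] at h3
  exact (smul_eq_zero.1 h3.symm).resolve_left hwu

end Isotropic

/-! ### Images of pure spinors under `φ'` -/

section OrlovExtension

variable (F : Type*) [Field F] [CharZero F] {M : Type*} [AddCommGroup M] [Module ℚ M]

/-- Clifford multiplication `V_F × S_F → S_F`. -/
abbrev mExt (M : Type*) [AddCommGroup M] [Module ℚ M] :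
    F ⊗[ℚ] (M × Dual ℚ M) →ₗ[F] F ⊗[ℚ] ExteriorAlgebra ℚ M →ₗ[F] F ⊗[ℚ] ExteriorAlgebra ℚ M :=
  bilinExt F (mVec ℚ M)

/-- The exterior product `S_F × S_F → (S ⊗ S)_F`. -/
abbrev tExt (S : Type*) [AddCommGroup S] [Module ℚ S] :
    F ⊗[ℚ] S →ₗ[F] F ⊗[ℚ] S →ₗ[F] F ⊗[ℚ] (S ⊗[ℚ] S) :=
  bilinExt F (TensorProduct.mk ℚ S S)

/-- The even part of `S_F`. -/
abbrev evenExt (M : Type*) [AddCommGroup M] [Module ℚ M] :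
    Submodule F (F ⊗[ℚ] ExteriorAlgebra ℚ M) :=
  (⨆ i : ℕ, ⋀[ℚ]^(2 * i) M : Submodule ℚ (ExteriorAlgebra ℚ M)).baseChange F

lemma tExt_ne_zero {S : Type*} [AddCommGroup S] [Module ℚ S] {a b : F ⊗[ℚ] S} (ha : a ≠ 0)
    (hb : b ≠ 0) : tExt F S a b ≠ 0 := by
  have h1 : tExt F S a b = (AlgebraTensorModule.distribBaseChange ℚ F S S).symm (a ⊗ₜ b) := by
    have h2 : TensorProduct.lift (TensorProduct.mk ℚ S S) = LinearMap.id := TensorProduct.lift_mk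
    simp [bilinExt, h2, LinearMap.baseChange_id]
  rw [h1, Ne, LinearEquiv.map_eq_zero_iff]
  intro h
  have hf : ∃ f : Dual F (F ⊗[ℚ] S), f a ≠ 0 := by
    by_contra! h; exact ha ((forall_dual_apply_eq_zero_iff F a).1 h)
  have hg : ∃ f : Dual F (F ⊗[ℚ] S), f b ≠ 0 := by
    by_contra! h; exact hb ((forall_dual_apply_eq_zero_iff F b).1 h)
  obtain ⟨f, hf⟩ := hf
  obtain ⟨g, hg⟩ := hg
  have h3 := congrArg (fun t => TensorProduct.lid F F (TensorProduct.map f g t)) h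
  simp [hf, hg] at h3

variable {F} {n : ℕ} (e : Basis (Fin (n * 2)) ℚ M) (s : ℚ)

variable (F) in
/-- The extension of the Orlov map to `F`. -/
abbrev phiExt : F ⊗[ℚ] (ExteriorAlgebra ℚ M ⊗[ℚ] ExteriorAlgebra ℚ M) →ₗ[F]
    F ⊗[ℚ] ExteriorAlgebra ℚ (M × Dual ℚ M) :=
  (orlovMap e s).baseChange F

lemma phiExt_injective (hs : s ≠ 0) : Function.Injective (phiExt F e s) :=
  Module.Flat.lTensor_preserves_injective_linearMap _ (orlovMap_bijective e s hs).1

lemma phiExt_tExt_tmul (c c' : F) (a b : ExteriorAlgebra ℚ M) :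
    phiExt F e s (tExt F _ (c ⊗ₜ a) (c' ⊗ₜ b)) = (c * c') ⊗ₜ orlovMap e s (a ⊗ₜ b) := by
  rw [bilinExt_tmul, LinearMap.baseChange_tmul, TensorProduct.mk_apply]

lemma ctrExt_one (u : F ⊗[ℚ] (M × Dual ℚ M)) : ctrExt F M u 1 = 0 := by
  induction u using ext_induction with
  | hzero => simp only [map_zero, LinearMap.zero_apply]
  | hadd c d hc hd => simp only [map_add, LinearMap.add_apply, hc, hd, add_zero]
  | hsmul c b h => simp only [map_smul, LinearMap.smul_apply, h, smul_zero]
  | hmem b =>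
    have h := contractLeft_one (Q := (0 : QuadraticForm ℚ (M × Dual ℚ M))) (d := pairV ℚ M b)
    rw [Algebra.TensorProduct.one_def, ctrExt_tmul]
    exact (congrArg _ h).trans (tmul_zero _ _)

lemma phiExt_mExt (v : F ⊗[ℚ] (M × Dual ℚ M)) (a b : F ⊗[ℚ] ExteriorAlgebra ℚ M) :
    phiExt F e s (tExt F _ (mExt F M v a) b) =
      iotaExt F M (fstExt F M v) * phiExt F e s (tExt F _ a b) +
        ctrExt F M v (phiExt F e s (tExt F _ a b)) := by
  induction v using ext_induction with
  | hzero => simp only [map_zero, LinearMap.zero_apply, zero_mul, add_zero]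
  | hadd c d hc hd =>
    simp only [map_add, LinearMap.add_apply, hc, hd, add_mul]
    abel
  | hsmul c v h => simp only [map_smul, LinearMap.smul_apply, h, smul_mul_assoc, smul_add]
  | hmem v =>
    induction a using ext_induction with
    | hzero => simp only [map_zero, LinearMap.zero_apply, mul_zero, add_zero]
    | hadd c d hc hd =>
      simp only [map_add, LinearMap.add_apply, hc, hd, mul_add]
      abel
    | hsmul c a h => simp only [map_smul, LinearMap.smul_apply, h, mul_smul_comm, smul_add]
    | hmem a =>
      induction b using ext_induction with
      | hzero => simp only [map_zero, mul_zero, add_zero]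
      | hadd c d hc hd =>
        simp only [map_add, hc, hd, mul_add]
        abel
      | hsmul c a h => simp only [map_smul, h, mul_smul_comm, smul_add]
      | hmem b =>
        rw [bilinExt_tmul (mVec ℚ M), phiExt_tExt_tmul, phiExt_tExt_tmul, orlovMap_mVec_tmul,
          fstExt_tmul, iotaExt_tmul, ctrExt_tmul, Algebra.TensorProduct.tmul_mul_tmul, tmul_add]
        simp only [mul_one]

/-- On even classes the involutions in `ι_mul_orlovMap` disappear. -/
lemma iotaExt_mul_phiExt (v : F ⊗[ℚ] (M × Dual ℚ M)) {a b : F ⊗[ℚ] ExteriorAlgebra ℚ M}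
    (ha : a ∈ evenExt F M) (hb : b ∈ evenExt F M) :
    iotaExt F M v * phiExt F e s (tExt F _ a b) =
      phiExt F e s (tExt F _ (mExt F M v a) b) - phiExt F e s (tExt F _ a (mExt F M v b)) := by
  induction v using ext_induction with
  | hzero => simp only [map_zero, LinearMap.zero_apply, zero_mul, sub_zero]
  | hadd c d hc hd =>
    simp only [map_add, LinearMap.add_apply, hc, hd, add_mul]
    abel
  | hsmul c v h => simp only [map_smul, LinearMap.smul_apply, h, smul_mul_assoc, smul_sub]
  | hmem v =>
    refine baseChange_induction (p := fun a => iotaExt F M (1 ⊗ₜ v) * phiExt F e s (tExt F _ a b) =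
      phiExt F e s (tExt F _ (mExt F M (1 ⊗ₜ v) a) b) -
        phiExt F e s (tExt F _ a (mExt F M (1 ⊗ₜ v) b))) (fun a ha => ?_)
      (by simp only [map_zero, LinearMap.zero_apply, mul_zero, sub_zero])
      (fun c d hc hd => by
        simp only [map_add, LinearMap.add_apply, hc, hd, mul_add]
        abel)
      (fun c a h => by simp only [map_smul, LinearMap.smul_apply, h, mul_smul_comm, smul_sub]) ha
    refine baseChange_induction (p := fun b =>
      iotaExt F M (1 ⊗ₜ v) * phiExt F e s (tExt F _ (1 ⊗ₜ a) b) =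
      phiExt F e s (tExt F _ (mExt F M (1 ⊗ₜ v) (1 ⊗ₜ a)) b) -
        phiExt F e s (tExt F _ (1 ⊗ₜ a) (mExt F M (1 ⊗ₜ v) b))) (fun b hb => ?_)
      (by simp only [map_zero, mul_zero, sub_zero])
      (fun c d hc hd => by
        simp only [map_add, hc, hd, mul_add]
        abel)
      (fun c a h => by simp only [map_smul, h, mul_smul_comm, smul_sub]) hb
    have h := ι_mul_orlovMap e s v a b
    rw [involute_eq_self_of_mem ha, involute_eq_self_of_mem hb] at h
    rw [bilinExt_tmul (mVec ℚ M), bilinExt_tmul (mVec ℚ M), phiExt_tExt_tmul, phiExt_tExt_tmul,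
      phiExt_tExt_tmul, iotaExt_tmul, Algebra.TensorProduct.tmul_mul_tmul, h, tmul_sub]
    simp only [mul_one]

lemma projExt_one_phiExt {a b : F ⊗[ℚ] ExteriorAlgebra ℚ M} (ha : a ∈ evenExt F M)
    (hb : b ∈ evenExt F M) : projExt F M 1 (phiExt F e s (tExt F _ a b)) = 0 := by
  refine baseChange_induction (p := fun a => projExt F M 1 (phiExt F e s (tExt F _ a b)) = 0)
    (fun a ha => ?_) (by simp only [map_zero, LinearMap.zero_apply])
    (fun c d hc hd => by simp only [map_add, LinearMap.add_apply, hc, hd, add_zero])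
    (fun c a h => by simp only [map_smul, LinearMap.smul_apply, h, smul_zero]) ha
  refine baseChange_induction (p := fun b => projExt F M 1 (phiExt F e s (tExt F _ (1 ⊗ₜ a) b)) = 0)
    (fun b hb => ?_) (by simp only [map_zero])
    (fun c d hc hd => by simp only [map_add, hc, hd, add_zero])
    (fun c a h => by simp only [map_smul, h, smul_zero]) hb
  have h := involute_orlovMap e s a b
  rw [involute_eq_self_of_mem ha, involute_eq_self_of_mem hb] at h
  have h1 := involute_extProj_one (orlovMap e s (a ⊗ₜ b))
  rw [h, eq_neg_iff_add_eq_zero, ← two_smul ℚ] at h1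
  rw [phiExt_tExt_tmul, projExt_tmul, (smul_eq_zero.1 h1).resolve_left two_ne_zero, tmul_zero]

lemma augExt_phiExt_swap (a b : F ⊗[ℚ] ExteriorAlgebra ℚ M) :
    augExt F M (phiExt F e s (tExt F _ a b)) =
      (-1) ^ n * augExt F M (phiExt F e s (tExt F _ b a)) := by
  induction a using ext_induction with
  | hzero => simp only [map_zero, LinearMap.zero_apply, mul_zero]
  | hadd c d hc hd => simp only [map_add, LinearMap.add_apply, hc, hd, mul_add]
  | hsmul c v h =>
    simp only [map_smul, LinearMap.smul_apply, h, smul_eq_mul]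
    ring
  | hmem a =>
    induction b using ext_induction with
    | hzero => simp only [map_zero, LinearMap.zero_apply, mul_zero]
    | hadd c d hc hd => simp only [map_add, LinearMap.add_apply, hc, hd, mul_add]
    | hsmul c v h =>
      simp only [map_smul, LinearMap.smul_apply, h, smul_eq_mul]
      ring
    | hmem b =>
      rw [phiExt_tExt_tmul, phiExt_tExt_tmul, augExt_tmul, augExt_tmul,
        algebraMapInv_orlovMap_swap, Rat.smul_def, Rat.smul_def]
      push_cast
      ring

/-- The class `φ'(s ⊗ s)` of a pure spinor `s`. -/
lemma pureSpinor_square (hs : s ≠ 0) {W : Submodule F (F ⊗[ℚ] (M × Dual ℚ M))}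
    (hW : (pairExt F M).orthogonal W = W) (hWr : finrank F W = n * 2)
    {a : F ⊗[ℚ] ExteriorAlgebra ℚ M} (ha : a ∈ evenExt F M) (ha0 : a ≠ 0)
    (haW : ∀ v ∈ W, mExt F M v a = 0) :
    (∀ k < n * 2, projExt F M k (phiExt F e s (tExt F _ a a)) = 0) ∧
    projExt F M (n * 2) (phiExt F e s (tExt F _ a a)) ≠ 0 ∧
    (∀ u ∈ W, ctrExt F M u (projExt F M (n * 2) (phiExt F e s (tExt F _ a a))) = 0) ∧
    (∀ u ∈ W, iotaExt F M u * projExt F M (n * 2) (phiExt F e s (tExt F _ a a)) = 0) ∧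
    (W.map (iotaExt F M)) ^ (n * 2) =
      Submodule.span F {projExt F M (n * 2) (phiExt F e s (tExt F _ a a))} := by
  classical
  have hfin : FiniteDimensional ℚ M := Module.Finite.of_basis e
  set y := phiExt F e s (tExt F _ a a) with hy
  have hy0 : y ≠ 0 := by
    rw [hy, Ne, map_eq_zero_iff _ (phiExt_injective e s hs)]
    exact tExt_ne_zero F ha0 ha0
  have hL : ∀ u ∈ W, iotaExt F M u * y = 0 := by
    intro u hu
    rw [hy, iotaExt_mul_phiExt e s u ha ha, haW u hu]
    simp only [map_zero, LinearMap.zero_apply, sub_zero]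
  -- On `y`, contraction by `u` lowers degree yet equals an operator that raises it; this is what
  -- isolates the lowest component.
  have hD : ∀ u ∈ W, ctrExt F M u y = -(iotaExt F M (fstExt F M u) * y) := by
    intro u hu
    have h := phiExt_mExt e s u a a
    rw [haW u hu, map_zero, LinearMap.zero_apply, map_zero, ← hy] at h
    exact eq_neg_of_add_eq_zero_right h.symm
  have hex := exists_projExt_ne_zero hy0
  set k := Nat.find hex with hk
  have hk0 : projExt F M k y ≠ 0 := Nat.find_spec hex
  have hlt : ∀ j < k, projExt F M j y = 0 := fun j hj => not_not.1 (Nat.find_min hex hj)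
  have hLk : ∀ u ∈ W, iotaExt F M u * projExt F M k y = 0 := by
    intro u hu
    rw [← projExt_iotaExt_mul, hL u hu, map_zero]
  -- The contraction lives in degree `k - 1`, where `hD` expresses it through the component of `y`
  -- of degree `k - 2`, which is zero.
  have hDk : ∀ u ∈ W, ctrExt F M u (projExt F M k y) = 0 := by
    intro u hu
    rcases hk' : k with _ | j
    · rw [projExt_zero_eq, map_smul, ctrExt_one, smul_zero]
    · rw [← projExt_ctrExt, hD u hu, map_neg]
      rcases j with _ | j
      · rw [projExt_zero_iotaExt_mul, neg_zero]
      · rw [projExt_iotaExt_mul, hlt j (by omega), mul_zero, neg_zero]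
  have hkr : k = n * 2 := eq_of_projExt_ne_zero e hW hWr k y hk0 hDk hLk
  rw [hkr] at hk0 hlt hLk hDk
  refine ⟨hlt, hk0, hDk, hLk, ?_⟩
  have hmem := projExt_mem_pow e hW hWr (n * 2) y hDk
  obtain ⟨h1, h2⟩ := finrank_pow_le_one W hWr
  refine (Submodule.eq_of_le_of_finrank_le ?_ ?_).symm
  · rwa [Submodule.span_singleton_le_iff_mem]
  · rwa [finrank_span_singleton hk0]

lemma iotaExt_injective : Function.Injective (iotaExt F M) :=
  Module.Flat.lTensor_preserves_injective_linearMap _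
    (ExteriorAlgebra.ι_leftInverse (R := ℚ)).injective

/-- The classes `φ'(s₁ ⊗ s₂ ± s₂ ⊗ s₁)` of two non-orthogonal pure spinors. -/
lemma pureSpinor_mixed {W₁ W₂ : Submodule F (F ⊗[ℚ] (M × Dual ℚ M))}
    {a b : F ⊗[ℚ] ExteriorAlgebra ℚ M} (ha : a ∈ evenExt F M) (hb : b ∈ evenExt F M)
    (haW : ∀ v ∈ W₁, mExt F M v a = 0) (hbW : ∀ v ∈ W₂, mExt F M v b = 0)
    (hab : augExt F M (phiExt F e s (tExt F _ a b)) ≠ 0)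
    {c : F} (hc : c = (-1) ^ n) :
    Disjoint W₁ W₂ ∧
    (W₁ ≠ ⊥ → projExt F M 2 (phiExt F e s (tExt F _ a b + -c • tExt F _ b a)) ≠ 0) ∧
    projExt F M 0 (phiExt F e s (tExt F _ a b + -c • tExt F _ b a)) = 0 ∧
    projExt F M 1 (phiExt F e s (tExt F _ a b + -c • tExt F _ b a)) = 0 ∧
    projExt F M 0 (phiExt F e s (tExt F _ a b + c • tExt F _ b a)) ≠ 0 := by
  have hswap := augExt_phiExt_swap e s a b
  rw [← hc] at hswap
  set y := phiExt F e s (tExt F _ a b) with hy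
  set z := phiExt F e s (tExt F _ b a) with hz
  have hone : ∀ c : F, c ≠ 0 → c • (1 : F ⊗[ℚ] ExteriorAlgebra ℚ (M × Dual ℚ M)) ≠ 0 :=
    fun c hc => smul_ne_zero hc one_ne_zero
  have hp1 : ∀ (v : F ⊗[ℚ] (M × Dual ℚ M)) x,
      projExt F M 1 (iotaExt F M v * x) = augExt F M x • iotaExt F M v := by
    intro v x
    rw [projExt_iotaExt_mul, projExt_zero_eq, mul_smul_comm, mul_one]
  refine ⟨?_, ?_, ?_, ?_, ?_⟩
  -- For `v` in both subspaces `v ∧ y = 0`, and the degree `1` part of `v ∧ y` is the nonzero scalar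
  -- part of `y` times `v`.
  · rw [Submodule.disjoint_def]
    intro v h1 h2
    have h := iotaExt_mul_phiExt e s v ha hb
    rw [haW v h1, hbW v h2] at h
    simp only [map_zero, LinearMap.zero_apply, sub_zero] at h
    have h3 := congrArg (projExt F M 1) h
    rw [hp1, map_zero] at h3
    exact iotaExt_injective (((smul_eq_zero.1 h3).resolve_left hab).trans (map_zero _).symm)
  -- If the degree `2` part vanished, so would its contraction with `v ∈ W₁`, which `e1` and `e2`
  -- compute.
  · intro hne h0
    obtain ⟨v, hv, hv0⟩ := Submodule.exists_mem_ne_zero_of_ne_bot hne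
    have h1 := phiExt_mExt e s v a b
    rw [haW v hv, map_zero, LinearMap.zero_apply, map_zero, ← hy] at h1
    have h2 := phiExt_mExt e s v b a
    have h3 := iotaExt_mul_phiExt e s v hb ha
    rw [haW v hv, map_zero, map_zero, sub_zero, h2, ← hz] at h3
    have e1 : ctrExt F M v y = -(iotaExt F M (fstExt F M v) * y) :=
      eq_neg_of_add_eq_zero_right h1.symm
    have e2 : ctrExt F M v z = iotaExt F M v * z - iotaExt F M (fstExt F M v) * z := by
      rw [h3]; abel
    rw [map_add, map_smul, ← hy, ← hz] at h0
    have h4 := congrArg (ctrExt F M v) h0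
    rw [← projExt_ctrExt, map_add, map_smul, e1, e2, map_zero, map_add, map_neg, map_smul, map_sub,
      hp1, hp1, hp1, hswap] at h4
    -- The terms in `fstExt F M v` cancel because the scalar parts satisfy `aug y = c * aug z`.
    have h5 : -(augExt F M y) • iotaExt F M v = 0 := by
      rw [hswap, ← h4]; module
    exact hv0 (iotaExt_injective
      (((smul_eq_zero.1 h5).resolve_left (neg_ne_zero.2 hab)).trans (map_zero _).symm))
  · rw [map_add, map_smul, ← hy, ← hz, projExt_zero_eq, map_add, map_smul, hswap, smul_eq_mul,
      neg_mul, add_neg_cancel, zero_smul]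
  · rw [map_add, map_smul, map_add, map_smul, projExt_one_phiExt e s ha hb,
      projExt_one_phiExt e s hb ha, smul_zero, add_zero]
  · rw [map_add, map_smul, ← hy, ← hz, projExt_zero_eq, map_add, map_smul, smul_eq_mul, ← hswap,
      ← two_mul]
    exact hone _ (mul_ne_zero two_ne_zero hab)

end OrlovExtension

/-! ### Descent from a quadratic field -/

section Descent

variable {K : Type*} [Field K] [CharZero K]

lemma toExt_injective (A : Type*) [AddCommGroup A] [Module ℚ A] :
    Function.Injective (toExt K A) :=
  FaithfullyFlat.tensorProduct_mk_injective A

lemma finrank_submodule_baseChange {A : Type*} [AddCommGroup A] [Module ℚ A]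
    (N : Submodule ℚ A) : finrank K (N.baseChange K) = finrank ℚ N := by
  unfold Submodule.baseChange
  rw [LinearMap.finrank_range_of_inj, finrank_baseChange]
  exact Module.Flat.lTensor_preserves_injective_linearMap _ N.injective_subtype

lemma map_baseChange_eq {A B : Type*} [AddCommGroup A] [Module ℚ A] [AddCommGroup B] [Module ℚ B]
    (f : A →ₗ[ℚ] B) (N : Submodule ℚ A) :
    (N.map f).baseChange K = (N.baseChange K).map (f.baseChange K) := by
  rw [Submodule.baseChange_eq_span, Submodule.baseChange_eq_span, Submodule.map_span]
  congr 1
  ext x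
  simp

lemma exists_of_mem_baseChange_rat {A : Type*} [AddCommGroup A] [Module ℚ A] {N : Submodule ℚ A}
    {x : ℚ ⊗[ℚ] A} (hx : x ∈ N.baseChange ℚ) : ∃ a ∈ N, x = 1 ⊗ₜ a := by
  refine baseChange_induction (p := fun x => ∃ a ∈ N, x = 1 ⊗ₜ a) (fun a ha => ⟨a, ha, rfl⟩)
    ⟨0, zero_mem _, (tmul_zero _ _).symm⟩ ?_ ?_ hx
  · rintro _ _ ⟨a, ha, rfl⟩ ⟨b, hb, rfl⟩
    exact ⟨a + b, add_mem ha hb, (tmul_add _ _ _).symm⟩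
  · rintro c _ ⟨a, ha, rfl⟩
    exact ⟨c • a, N.smul_mem c ha, (tmul_smul _ _ _).symm⟩

lemma finrank_sup_span_singleton {V : Type*} [AddCommGroup V] [Module K V] {x y : V} (hx : x ≠ 0)
    (hy : y ≠ 0) (h : Disjoint (Submodule.span K {x}) (Submodule.span K {y})) :
    finrank K (Submodule.span K {x} ⊔ Submodule.span K {y} : Submodule K V) = 2 := by
  have h1 := Submodule.finrank_sup_add_finrank_inf_eq (Submodule.span K {x}) (Submodule.span K {y})
  rwa [h.eq_bot, finrank_bot, finrank_span_singleton hx, finrank_span_singleton hy] at h1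

/-- Descent of the plane spanned by two conjugate vectors from a quadratic field to `ℚ`. -/
lemma baseChange_comap_toExt (hK : finrank ℚ K = 2)
    (hKim : ∃ d : ℚ, 0 < d ∧ ∃ δ : K, δ ^ 2 = -(d : K)) (σ : K ≃ₐ[ℚ] K) (hσ : σ ≠ AlgEquiv.refl)
    {A : Type*} [AddCommGroup A] [Module ℚ A] (y : K ⊗[ℚ] A) (N : Submodule K (K ⊗[ℚ] A))
    (hN : N = Submodule.span K {y} ⊔ Submodule.span K {σ.toLinearMap.rTensor A y}) :
    (((N.restrictScalars ℚ).comap (toExt K A)).baseChange K) = N := by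
  obtain ⟨d, hd, δ, hδ⟩ := hKim
  have hδ0 : δ ≠ 0 := by
    rintro rfl
    rw [zero_pow two_ne_zero, eq_comm, neg_eq_zero, Rat.cast_eq_zero] at hδ
    exact hd.ne' hδ
  -- A rational `δ` would have a nonnegative square.
  have hli : LinearIndependent ℚ ![(1 : K), δ] := by
    rw [LinearIndependent.pair_iff]
    intro p q h
    have hq : q = 0 := by
      by_contra hq
      have h1 : δ = ((-p / q : ℚ) : K) := by
        have hq' : (q : K) ≠ 0 := Rat.cast_ne_zero.2 hq
        rw [Rat.smul_def, Rat.smul_def] at h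
        push_cast
        field_simp
        linear_combination h
      rw [h1, ← Rat.cast_pow, ← Rat.cast_neg, Rat.cast_inj] at hδ
      nlinarith [sq_nonneg (-p / q)]
    subst hq
    simpa using h
  have hspan : ∀ k : K, ∃ p q : ℚ, k = p • 1 + q • δ := by
    intro k
    have hfin : FiniteDimensional ℚ K := Module.finite_of_finrank_pos (by omega)
    have h := hli.span_eq_top_of_card_eq_finrank' (by simp [hK])
    have hk : k ∈ Submodule.span ℚ (Set.range ![(1 : K), δ]) := h ▸ Submodule.mem_top
    rw [Matrix.range_cons, Matrix.range_cons, Matrix.range_empty, Set.union_empty,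
      Set.singleton_union, Submodule.mem_span_pair] at hk
    obtain ⟨p, q, h⟩ := hk
    exact ⟨p, q, h.symm⟩
  -- `σ δ = ±δ`, and the plus sign would make `σ` trivial on `K = ℚ(δ)`.
  have hσδ : σ δ = -δ := by
    have h1 : (σ δ - δ) * (σ δ + δ) = 0 := by
      have h2 : σ δ ^ 2 = δ ^ 2 := by rw [← map_pow, hδ]; simp
      linear_combination h2
    rcases mul_eq_zero.1 h1 with h2 | h2
    · refine absurd (AlgEquiv.ext fun k => ?_) hσ
      obtain ⟨p, q, rfl⟩ := hspan k
      simp only [Rat.smul_def, map_add, map_mul, map_one, map_ratCast, sub_eq_zero.1 h2]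
      rfl
    · exact eq_neg_of_add_eq_zero_left h2
  -- The rational vectors `a` and `b` are the real and imaginary parts of `y`. They are combinations
  -- of `y` and its conjugate, and conversely span both.
  obtain ⟨a, b, hy⟩ : ∃ a b : A, y = 1 ⊗ₜ a + δ ⊗ₜ b := by
    clear hN
    induction y with
    | zero => exact ⟨0, 0, by simp⟩
    | add x y hx hy =>
      obtain ⟨a, b, rfl⟩ := hx
      obtain ⟨a', b', rfl⟩ := hy
      exact ⟨a + a', b + b', by simp only [tmul_add]; abel⟩
    | tmul k a =>
      obtain ⟨p, q, rfl⟩ := hspan k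
      exact ⟨p • a, q • a, by rw [add_tmul, smul_tmul, smul_tmul]⟩
  have hσy : σ.toLinearMap.rTensor A y = 1 ⊗ₜ a - δ ⊗ₜ b := by
    rw [hy, map_add, LinearMap.rTensor_tmul, LinearMap.rTensor_tmul]
    simp [hσδ, neg_tmul, sub_eq_add_neg]
  have hyN : y ∈ N := hN ▸ Submodule.mem_sup_left (Submodule.mem_span_singleton_self y)
  have hyN' : σ.toLinearMap.rTensor A y ∈ N :=
    hN ▸ Submodule.mem_sup_right (Submodule.mem_span_singleton_self _)
  have haN : (1 : K) ⊗ₜ[ℚ] a ∈ N := by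
    have h : (1 : K) ⊗ₜ[ℚ] a = (2 : K)⁻¹ • (y + σ.toLinearMap.rTensor A y) := by
      rw [hσy, hy, eq_inv_smul_iff₀ two_ne_zero, two_smul]; abel
    rw [h]
    exact N.smul_mem _ (add_mem hyN hyN')
  have hbN : (1 : K) ⊗ₜ[ℚ] b ∈ N := by
    have h : (1 : K) ⊗ₜ[ℚ] b = (2 * δ)⁻¹ • (y - σ.toLinearMap.rTensor A y) := by
      rw [hσy, hy, eq_inv_smul_iff₀ (mul_ne_zero two_ne_zero hδ0), mul_smul, two_smul,
        smul_tmul', smul_eq_mul, mul_one]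
      abel
    rw [h]
    exact N.smul_mem _ (sub_mem hyN hyN')
  apply le_antisymm
  · rw [Submodule.baseChange_eq_span, Submodule.span_le]
    rintro _ ⟨x, hx, rfl⟩
    exact hx
  · set N' := ((N.restrictScalars ℚ).comap (toExt K A)).baseChange K
    have ha' : (1 : K) ⊗ₜ[ℚ] a ∈ N' := Submodule.tmul_mem_baseChange_of_mem _ haN
    have hb' : δ ⊗ₜ[ℚ] b ∈ N' := Submodule.tmul_mem_baseChange_of_mem _ hbN
    rw [hN, hσy, hy]
    refine sup_le ?_ ?_
    · rw [Submodule.span_singleton_le_iff_mem]; exact add_mem ha' hb'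
    · rw [Submodule.span_singleton_le_iff_mem]; exact sub_mem ha' hb'

end Descent

/-! ### Lines in `S ⊗ S` and the weight criterion -/

section Torus

variable {U : Type*} [NormedAddCommGroup U] [NormedSpace ℂ U] [FiniteDimensional ℂ U]
  (Λ : Submodule ℤ U)

section Lines

variable {F : Type*} [Field F] [CharZero F]

lemma baseChange_map_tExt {S : Type*} [AddCommGroup S] [Module ℚ S] (f : S →ₗ[ℚ] S)
    (x y : F ⊗[ℚ] S) :
    (TensorProduct.map f f).baseChange F (tExt F S x y) =
      tExt F S (f.baseChange F x) (f.baseChange F y) := by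
  induction x using ext_induction with
  | hzero => simp only [map_zero, LinearMap.zero_apply]
  | hadd c d hc hd => simp only [map_add, LinearMap.add_apply, hc, hd]
  | hsmul c v h => simp only [map_smul, LinearMap.smul_apply, h]
  | hmem a =>
    induction y using ext_induction with
    | hzero => simp only [map_zero]
    | hadd c d hc hd => simp only [map_add, hc, hd]
    | hsmul c v h => simp only [map_smul, h]
    | hmem b => simp only [bilinExt_tmul, LinearMap.baseChange_tmul, mk_apply, map_tmul]

lemma rTensor_tExt {S : Type*} [AddCommGroup S] [Module ℚ S] (σ : F ≃ₐ[ℚ] F) (x y : F ⊗[ℚ] S) :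
    σ.toLinearMap.rTensor (S ⊗[ℚ] S) (tExt F S x y) =
      tExt F S (σ.toLinearMap.rTensor S x) (σ.toLinearMap.rTensor S y) := by
  induction x using TensorProduct.induction_on with
  | zero => simp only [map_zero, LinearMap.zero_apply]
  | add c d hc hd => simp only [map_add, LinearMap.add_apply, hc, hd]
  | tmul p a =>
    induction y using TensorProduct.induction_on with
    | zero => simp only [map_zero]
    | add c d hc hd => simp only [map_add, hc, hd]
    | tmul q b =>
      simp only [bilinExt_tmul, LinearMap.rTensor_tmul, AlgEquiv.toLinearMap_apply, map_mul]

lemma span_bilinear_eq {S T : Type*} [AddCommGroup S] [Module F S] [AddCommGroup T] [Module F T]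
    (f : S →ₗ[F] S →ₗ[F] T) (a b : S) :
    Submodule.span F {z | ∃ x ∈ Submodule.span F {a}, ∃ y ∈ Submodule.span F {b}, z = f x y} =
      Submodule.span F {f a b} := by
  apply le_antisymm
  · rw [Submodule.span_le]
    rintro _ ⟨x, hx, y, hy, rfl⟩
    obtain ⟨p, rfl⟩ := Submodule.mem_span_singleton.1 hx
    obtain ⟨q, rfl⟩ := Submodule.mem_span_singleton.1 hy
    rw [map_smul, map_smul, LinearMap.smul_apply]
    exact Submodule.smul_mem _ _ (Submodule.smul_mem _ _ (Submodule.mem_span_singleton_self _))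
  · rw [Submodule.span_singleton_le_iff_mem]
    exact Submodule.subset_span ⟨a, Submodule.mem_span_singleton_self _, b,
      Submodule.mem_span_singleton_self _, rfl⟩

lemma span_bilinear_sub_eq {S T : Type*} [AddCommGroup S] [Module F S] [AddCommGroup T]
    [Module F T] (f : S →ₗ[F] S →ₗ[F] T) (a b : S) :
    Submodule.span F {z | ∃ x ∈ Submodule.span F {a}, ∃ y ∈ Submodule.span F {b},
      z = f x y - f y x} = Submodule.span F {f a b + (-1 : F) • f b a} := by
  rw [neg_one_smul, ← sub_eq_add_neg]
  exact span_bilinear_eq (f - f.flip) a b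

lemma span_bilinear_add_eq {S T : Type*} [AddCommGroup S] [Module F S] [AddCommGroup T]
    [Module F T] (f : S →ₗ[F] S →ₗ[F] T) (a b : S) :
    Submodule.span F {z | ∃ x ∈ Submodule.span F {a}, ∃ y ∈ Submodule.span F {b},
      z = f x y + f y x} = Submodule.span F {f a b + (1 : F) • f b a} := by
  rw [one_smul]
  exact span_bilinear_eq (f + f.flip) a b

lemma tensorLines_span (a b : SF Λ F) :
    tensorLines Λ (Submodule.span F {a}) (Submodule.span F {b}) =
      Submodule.span F {tmulF Λ F a b} :=
  span_bilinear_eq _ a b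

lemma wedgeLines_span (a b : SF Λ F) :
    wedgeLines Λ (Submodule.span F {a}) (Submodule.span F {b}) =
      Submodule.span F {tmulF Λ F a b + (-1 : F) • tmulF Λ F b a} :=
  span_bilinear_sub_eq _ a b

lemma symLines_span (a b : SF Λ F) :
    symLines Λ (Submodule.span F {a}) (Submodule.span F {b}) =
      Submodule.span F {tmulF Λ F a b + (1 : F) • tmulF Λ F b a} :=
  span_bilinear_add_eq _ a b

lemma annW_span (a : SF Λ F) : annW Λ (Submodule.span F {a}) = kerM Λ a := by
  apply le_antisymm
  · exact iInf₂_le a (Submodule.mem_span_singleton_self a)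
  · refine le_iInf₂ fun x hx => ?_
    obtain ⟨p, rfl⟩ := Submodule.mem_span_singleton.1 hx
    intro v hv
    have hv' : (bilinExt F (mVec ℚ (H1 Λ))).flip a v = 0 := hv
    change (bilinExt F (mVec ℚ (H1 Λ))).flip (p • a) v = 0
    rw [map_smul, LinearMap.smul_apply, hv', smul_zero]

lemma filF_iff (k : ℕ) (x : WedgeF Λ F) :
    x ∈ filF Λ F k ↔ ∀ i < k, projExt F (H1 Λ) i x = 0 :=
  mem_iSup_baseChange_iff k x

variable [DiscreteTopology Λ] [IsZLattice ℝ Λ]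

lemma phiTau_bijective : Function.Bijective (phiTau Λ) := by
  rw [phiTau_eq]; exact orlovMap_bijective _ _ (orientationSign_ne_zero Λ)

/-- Injectivity of `φ'` ensures that `leftInverse` in `rhoPrime` is a genuine left inverse rather
than a default value. -/
lemma rhoPrime_phiF (g : CliffV ℤ (H1Z Λ)) (z : SSF Λ F) :
    (rhoPrime Λ g).baseChange F (phiF Λ F z) =
      phiF Λ F ((TensorProduct.map (mZ Λ g) (mZ Λ g)).baseChange F z) := by
  have h : rhoPrime Λ g ∘ₗ phiTau Λ = phiTau Λ ∘ₗ TensorProduct.map (mZ Λ g) (mZ Λ g) := by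
    apply LinearMap.ext
    intro z
    simp only [rhoPrime, LinearMap.comp_apply]
    rw [LinearMap.leftInverse_apply_of_inj (LinearMap.ker_eq_bot.2 (phiTau_bijective Λ).1)]
  have h2 := congrArg (fun f => f.baseChange F z) h
  simp only [LinearMap.baseChange_comp, LinearMap.comp_apply] at h2
  exact h2

/-- A space of invariants in `F^k` that meets `F^{k+1}` trivially has weight `k`. -/
lemma hasWeight_of_invariant {G : Submonoid (CliffV ℤ (H1Z Λ))} {T : Submodule F (SSF Λ F)} {k : ℕ}
    (hfix : ∀ g ∈ G, ∀ x ∈ T, (TensorProduct.map (mZ Λ g) (mZ Λ g)).baseChange F x = x)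
    (hne : T.map (phiF Λ F) ≠ ⊥) (hk : ∀ x ∈ T, phiF Λ F x ∈ filF Λ F k)
    (hk' : ∀ x ∈ T, phiF Λ F x ∈ filF Λ F (k + 1) → phiF Λ F x = 0) :
    HasWeight Λ G (T.map (phiF Λ F)) k := by
  refine ⟨?_, hne, fun T' hT' hirr => ⟨?_, fun j hj => ?_⟩⟩
  · rintro g hg _ ⟨x, hx, rfl⟩
    rw [rhoPrime_phiF, hfix g hg x hx]
    exact ⟨x, hx, rfl⟩
  · intro y hy
    obtain ⟨x, hx, rfl⟩ := hT' hy
    exact hk x hx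
  · by_contra hlt
    obtain ⟨y, hy, hy0⟩ := Submodule.exists_mem_ne_zero_of_ne_bot hirr.2.1
    obtain ⟨x, hx, rfl⟩ := hT' hy
    refine hy0 (hk' x hx ?_)
    have h1 := hj hy
    rw [filF_iff] at h1 ⊢
    exact fun i hi => h1 i (by omega)

lemma hasWeight_span {G : Submonoid (CliffV ℤ (H1Z Λ))} {z : SSF Λ F} {k : ℕ}
    (hfix : ∀ g ∈ G, (TensorProduct.map (mZ Λ g) (mZ Λ g)).baseChange F z = z)
    (hk : ∀ i < k, projExt F (H1 Λ) i (phiF Λ F z) = 0)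
    (hk' : projExt F (H1 Λ) k (phiF Λ F z) ≠ 0) :
    HasWeight Λ G ((Submodule.span F {z}).map (phiF Λ F)) k := by
  apply hasWeight_of_invariant
  · intro g hg x hx
    obtain ⟨c, rfl⟩ := Submodule.mem_span_singleton.1 hx
    rw [map_smul, hfix g hg]
  · rw [Submodule.map_span, Set.image_singleton, Ne, Submodule.span_singleton_eq_bot]
    intro h
    exact hk' (by rw [h, map_zero])
  · intro x hx
    obtain ⟨c, rfl⟩ := Submodule.mem_span_singleton.1 hx
    rw [map_smul]
    exact Submodule.smul_mem _ _ ((filF_iff Λ k _).2 hk)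
  · intro x hx h
    obtain ⟨c, rfl⟩ := Submodule.mem_span_singleton.1 hx
    have h1 := (filF_iff Λ (k + 1) _).1 h k (by omega)
    rw [map_smul, map_smul] at h1
    rw [map_smul, (smul_eq_zero.1 h1).resolve_right hk', zero_smul]

end Lines

end Torus

/-! ### Planes and independent images -/

section LinearAlgebra

variable {F S T : Type*} [Field F] [AddCommGroup S] [Module F S] [AddCommGroup T] [Module F T]

/-- With `f` the degree `2n` part of `φ'`, this shows that `φ'(HW)` meets `F^{2n+1}` only in zero.
-/
lemma eq_zero_of_map_eq_zero_of_mem_span_sup (f : S →ₗ[F] T) {x y z : S} (hx : f x ≠ 0)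
    (hy : f y ≠ 0) (h : Disjoint (Submodule.span F {f x}) (Submodule.span F {f y}))
    (hz : z ∈ Submodule.span F {x} ⊔ Submodule.span F {y}) (hz0 : f z = 0) : z = 0 := by
  rw [← Submodule.span_union, Set.singleton_union, Submodule.mem_span_pair] at hz
  obtain ⟨p, q, rfl⟩ := hz
  rw [map_add, map_smul, map_smul] at hz0
  have h2 := Submodule.disjoint_def.1 h _
    (Submodule.smul_mem _ p (Submodule.mem_span_singleton_self _))
    (by
      rw [eq_neg_of_add_eq_zero_left hz0]
      exact neg_mem (Submodule.smul_mem _ q (Submodule.mem_span_singleton_self _)))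
  have hp : p = 0 := (smul_eq_zero.1 h2).resolve_right hx
  rw [hp, zero_smul, zero_add] at hz0
  rw [hp, (smul_eq_zero.1 hz0).resolve_right hy, zero_smul, zero_smul, add_zero]

lemma disjoint_span_of_map (f : S →ₗ[F] T) {x y : S} (hx : f x ≠ 0)
    (h : Disjoint (Submodule.span F {f x}) (Submodule.span F {f y})) :
    Disjoint (Submodule.span F {x}) (Submodule.span F {y}) := by
  rw [Submodule.disjoint_def]
  intro z hz hz'
  obtain ⟨p, rfl⟩ := Submodule.mem_span_singleton.1 hz
  obtain ⟨q, hq⟩ := Submodule.mem_span_singleton.1 hz'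
  have h1 : q • f y = p • f x := by rw [← map_smul, ← map_smul, hq]
  have h2 := Submodule.disjoint_def.1 h _
    (Submodule.smul_mem _ p (Submodule.mem_span_singleton_self _))
    (h1 ▸ Submodule.smul_mem _ q (Submodule.mem_span_singleton_self _))
  rw [(smul_eq_zero.1 h2).resolve_right hx, zero_smul]

lemma map_map_span_sup {T' : Type*} [AddCommGroup T'] [Module F T'] (f : S →ₗ[F] T)
    (g : T →ₗ[F] T') (x y : S) :
    ((Submodule.span F {x} ⊔ Submodule.span F {y}).map f).map g =
      Submodule.span F {g (f x)} ⊔ Submodule.span F {g (f y)} := by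
  simp only [Submodule.map_sup, Submodule.map_span, Set.image_singleton]

end LinearAlgebra

/-! ### Pairs of pure spinors spanning a non-isotropic plane -/

section Nonorthogonal

variable {F : Type*} [Field F] [CharZero F] {M : Type*} [AddCommGroup M] [Module ℚ M]

lemma involute_eq_self_of_toExt_mem {t : ExteriorAlgebra ℚ M} (ht : toExt F _ t ∈ evenExt F M) :
    involute t = t := by
  apply toExt_injective (K := F)
  have h : ∀ x ∈ evenExt F M, (involute (Q := (0 : QuadraticForm ℚ M))).toLinearMap.baseChange F x
      = x := by
    intro x hx
    refine baseChange_induction (p := fun x =>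
      (involute (Q := (0 : QuadraticForm ℚ M))).toLinearMap.baseChange F x = x) (fun a ha => ?_)
      (map_zero _) (fun c d hc hd => by rw [map_add, hc, hd])
      (fun c a h => by rw [map_smul, h]) hx
    rw [LinearMap.baseChange_tmul]
    exact congrArg _ (involute_eq_self_of_mem ha)
  exact h _ ht

/-- Two isotropic lines that span a non-isotropic plane are not orthogonal. -/
lemma augExt_phiExt_ne_zero {n : ℕ} (e : Basis (Fin (n * 2)) ℚ M) (s : ℚ)
    {P : Submodule ℚ (ExteriorAlgebra ℚ M)}
    (hP : ∃ x ∈ P, ∃ y ∈ P, integralBasis e s (reverse x * y) ≠ 0)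
    {a b : F ⊗[ℚ] ExteriorAlgebra ℚ M}
    (hPab : P.baseChange F = Submodule.span F {a} ⊔ Submodule.span F {b})
    (ha : a ∈ evenExt F M) (hb : b ∈ evenExt F M)
    (haa : augExt F M (phiExt F e s (tExt F _ a a)) = 0)
    (hbb : augExt F M (phiExt F e s (tExt F _ b b)) = 0) :
    augExt F M (phiExt F e s (tExt F _ a b)) ≠ 0 := by
  intro hab
  have hba : augExt F M (phiExt F e s (tExt F _ b a)) = 0 := by
    rw [augExt_phiExt_swap, hab, mul_zero]
  have hmem : ∀ x ∈ P, ∃ p q : F, toExt F _ x = p • a + q • b := by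
    intro x hx
    have h : toExt F _ x ∈ P.baseChange F := Submodule.tmul_mem_baseChange_of_mem _ hx
    rw [hPab, ← Submodule.span_union, Set.singleton_union, Submodule.mem_span_pair] at h
    obtain ⟨p, q, h⟩ := h
    exact ⟨p, q, h.symm⟩
  obtain ⟨x, hx, y, hy, hxy⟩ := hP
  obtain ⟨p, q, hpq⟩ := hmem x hx
  obtain ⟨p', q', hpq'⟩ := hmem y hy
  have hyb : involute y = y := by
    apply involute_eq_self_of_toExt_mem (F := F)
    rw [hpq']
    exact add_mem (Submodule.smul_mem _ _ ha) (Submodule.smul_mem _ _ hb)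
  -- All four pairings among `a` and `b` would vanish, and with them the pairing on `P`.
  have h0 : augExt F M (phiExt F e s (tExt F _ (toExt F _ x) (toExt F _ y))) = 0 := by
    rw [hpq, hpq']
    simp only [map_add, map_smul, LinearMap.add_apply, LinearMap.smul_apply, haa, hab, hba, hbb,
      smul_zero, add_zero]
  rw [show toExt F _ x = 1 ⊗ₜ x from rfl, show toExt F _ y = 1 ⊗ₜ y from rfl,
    phiExt_tExt_tmul, augExt_tmul, algebraMapInv_orlovMap_of_even e s hyb] at h0
  exact (smul_eq_zero.1 h0).elim hxy (by simp)

/-- The classes attached to two pure spinors that span a rational non-isotropic plane. -/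
lemma pureSpinor_pair {n : ℕ} (e : Basis (Fin (n * 2)) ℚ M) {s : ℚ} (hs : s ≠ 0)
    {P : Submodule ℚ (ExteriorAlgebra ℚ M)} (hP2 : finrank ℚ P = 2)
    (hP : ∃ x ∈ P, ∃ y ∈ P, integralBasis e s (reverse x * y) ≠ 0)
    {a b : F ⊗[ℚ] ExteriorAlgebra ℚ M}
    (hPab : P.baseChange F = Submodule.span F {a} ⊔ Submodule.span F {b})
    {W₁ W₂ : Submodule F (F ⊗[ℚ] (M × Dual ℚ M))}
    (ha : a ∈ evenExt F M) (ha0 : a ≠ 0) (haW : ∀ v ∈ W₁, mExt F M v a = 0)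
    (hW₁ : (pairExt F M).orthogonal W₁ = W₁) (hr₁ : finrank F W₁ = n * 2)
    (hb : b ∈ evenExt F M) (hb0 : b ≠ 0) (hbW : ∀ v ∈ W₂, mExt F M v b = 0)
    (hW₂ : (pairExt F M).orthogonal W₂ = W₂) (hr₂ : finrank F W₂ = n * 2)
    {r : ℕ} (hr : r = 2 * n) {c : F} (hc : c = (-1) ^ n) :
    ((∀ k < r, projExt F M k (phiExt F e s (tExt F _ a a)) = 0) ∧
      projExt F M r (phiExt F e s (tExt F _ a a)) ≠ 0 ∧
      (W₁.map (iotaExt F M)) ^ r =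
        Submodule.span F {projExt F M r (phiExt F e s (tExt F _ a a))}) ∧
    ((∀ k < r, projExt F M k (phiExt F e s (tExt F _ b b)) = 0) ∧
      projExt F M r (phiExt F e s (tExt F _ b b)) ≠ 0 ∧
      (W₂.map (iotaExt F M)) ^ r =
        Submodule.span F {projExt F M r (phiExt F e s (tExt F _ b b))}) ∧
    Disjoint (Submodule.span F {projExt F M r (phiExt F e s (tExt F _ a a))})
      (Submodule.span F {projExt F M r (phiExt F e s (tExt F _ b b))}) ∧
    (∀ k < 2, projExt F M k (phiExt F e s (tExt F _ a b + -c • tExt F _ b a)) = 0) ∧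
    projExt F M 2 (phiExt F e s (tExt F _ a b + -c • tExt F _ b a)) ≠ 0 ∧
    projExt F M 0 (phiExt F e s (tExt F _ a b + c • tExt F _ b a)) ≠ 0 := by
  replace hr : r = n * 2 := by rw [hr, mul_comm]
  obtain ⟨hya, hya0, hyaD, -, hyaS⟩ := pureSpinor_square e s hs hW₁ hr₁ ha ha0 haW
  obtain ⟨hyb, hyb0, -, hybL, hybS⟩ := pureSpinor_square e s hs hW₂ hr₂ hb hb0 hbW
  have hfinM : FiniteDimensional ℚ M := Module.Finite.of_basis e
  -- For `n = 0` the exterior algebra is one-dimensional and has no room for the plane `P`.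
  have hpos : 0 < n * 2 := by
    by_contra h
    have h2 := Submodule.finrank_le P
    rw [hP2, finrank_exteriorAlgebra, finrank_eq_card_basis e, Fintype.card_fin,
      Nat.eq_zero_of_not_pos h] at h2
    omega
  have haug : ∀ x, projExt F M 0 x = 0 → augExt F M x = 0 := by
    intro x hx
    rw [projExt_zero_eq] at hx
    exact (smul_eq_zero.1 hx).resolve_right one_ne_zero
  -- The squares begin in the positive degree `2n`, so `a` and `b` are isotropic for the pairing.
  have hab := augExt_phiExt_ne_zero e s hP hPab ha hb (haug _ (hya 0 hpos)) (haug _ (hyb 0 hpos))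
  obtain ⟨hdisj, hmix2, hmix0, hmix1, hmix⟩ := pureSpinor_mixed e s ha hb haW hbW hab hc
  have hbot : ∀ W : Submodule F (F ⊗[ℚ] (M × Dual ℚ M)), finrank F W = n * 2 → W ≠ ⊥ := by
    rintro W hW rfl
    rw [finrank_bot] at hW
    omega
  have hdisjS := disjoint_span hW₁ (fun h => hbot _ hr₂ (hdisj.eq_bot_of_ge h)) hyaD hybL
  rw [← hr] at hya hya0 hyaS hyb hyb0 hybS hdisjS
  refine ⟨⟨hya, hya0, hyaS⟩, ⟨hyb, hyb0, hybS⟩, hdisjS, fun i hi => ?_, hmix2 (hbot _ hr₁), hmix⟩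
  interval_cases i
  · exact hmix0
  · exact hmix1

end Nonorthogonal

/-! ### Invariance under `Spin(V)_P` and rational structures -/

section Torus

variable {U : Type*} [NormedAddCommGroup U] [NormedSpace ℂ U] [FiniteDimensional ℂ U]
  (Λ : Submodule ℤ U)

section

variable {F : Type*} [Field F] [CharZero F]

lemma baseChange_mZ_eq {P : Submodule ℚ (SQ Λ)} {g : CliffV ℤ (H1Z Λ)} (hg : g ∈ SpinVP Λ P)
    {x : SF Λ F} (hx : x ∈ P.baseChange F) : (mZ Λ g).baseChange F x = x := by
  refine baseChange_induction (p := fun x => (mZ Λ g).baseChange F x = x) (fun a ha => ?_)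
    (map_zero _) (fun c d hc hd => by rw [map_add, hc, hd])
    (fun c a h => by rw [map_smul, h]) hx
  rw [LinearMap.baseChange_tmul, hg.2 a ha]

lemma baseChange_map_mZ_tmulF {P : Submodule ℚ (SQ Λ)} {g : CliffV ℤ (H1Z Λ)}
    (hg : g ∈ SpinVP Λ P) {x y : SF Λ F} (hx : x ∈ P.baseChange F) (hy : y ∈ P.baseChange F) :
    (TensorProduct.map (mZ Λ g) (mZ Λ g)).baseChange F (tmulF Λ F x y) = tmulF Λ F x y := by
  refine (baseChange_map_tExt (mZ Λ g) x y).trans ?_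
  rw [baseChange_mZ_eq Λ hg hx, baseChange_mZ_eq Λ hg hy]
  rfl

lemma baseChange_HW (hK : finrank ℚ F = 2) (hKim : ∃ d : ℚ, 0 < d ∧ ∃ δ : F, δ ^ 2 = -(d : F))
    (σ : F ≃ₐ[ℚ] F) (hσ : σ ≠ AlgEquiv.refl) {a b : SF Λ F} {l₁ l₂ : Submodule F (SF Λ F)}
    (ha0 : a ≠ 0) (hl₁ : l₁ = Submodule.span F {a}) (hl₂ : l₂ = Submodule.span F {b})
    (hconj : ∀ s, s ∈ l₁ ↔ σ.toLinearMap.rTensor (SQ Λ) s ∈ l₂) :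
    (HW Λ l₁ l₂).baseChange F = HWF Λ l₁ l₂ := by
  -- The conjugate of `a` may differ from `b` by a scalar; only the lines they span matter.
  have hσa : Submodule.span F {σ.toLinearMap.rTensor (SQ Λ) a} = l₂ := by
    have h1 : σ.toLinearMap.rTensor (SQ Λ) a ∈ l₂ :=
      (hconj a).1 (hl₁ ▸ Submodule.mem_span_singleton_self a)
    rw [hl₂] at h1 ⊢
    obtain ⟨c, hc⟩ := Submodule.mem_span_singleton.1 h1
    have hc0 : c ≠ 0 := by
      rintro rfl
      rw [zero_smul] at hc
      have hinj : Function.Injective (σ.toLinearMap.rTensor (SQ Λ)) :=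
        Module.Flat.rTensor_preserves_injective_linearMap _ σ.injective
      exact ha0 (hinj (hc.symm.trans (map_zero _).symm))
    rw [← hc]
    exact Submodule.span_singleton_smul_eq (IsUnit.mk0 c hc0) b
  refine baseChange_comap_toExt hK hKim σ hσ (tmulF Λ F a a) _ ?_
  have h1 : σ.toLinearMap.rTensor (SQ Λ ⊗[ℚ] SQ Λ) (tmulF Λ F a a) =
      tmulF Λ F (σ.toLinearMap.rTensor (SQ Λ) a) (σ.toLinearMap.rTensor (SQ Λ) a) :=
    rTensor_tExt σ a a
  rw [h1, HWF, ← hσa, hl₁, tensorLines_span, tensorLines_span]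

variable [DiscreteTopology Λ] [IsZLattice ℝ Λ]

lemma phiF_eq : phiF Λ F = phiExt F (eBasis Λ) (orientationSign Λ) := by
  unfold phiF; rw [phiTau_eq]

lemma exists_pureSpinor_of_isPureSpinorLine {l : Submodule F (SF Λ F)}
    (hl : IsPureSpinorLine Λ l) :
    ∃ a : SF Λ F, l = Submodule.span F {a} ∧ a ∈ evenExt F (H1 Λ) ∧ a ≠ 0 ∧
      (∀ v ∈ annW Λ l, mExt F (H1 Λ) v a = 0) ∧
      (pairExt F (H1 Λ)).orthogonal (annW Λ l) = annW Λ l ∧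
      finrank F (annW Λ l) = finrank ℂ U * 2 := by
  obtain ⟨a, ⟨hae, ha0, haW⟩, rfl⟩ := hl
  rw [annW_span]
  exact ⟨a, rfl, hae, ha0, fun v hv => hv, orthogonal_eq_of_maximal (eBasis Λ) haW⟩

lemma baseChange_proj (k : ℕ) :
    (GradedAlgebra.proj (fun j : ℕ => ⋀[ℚ]^j (VQ Λ)) k).baseChange F = projExt F (H1 Λ) k := rfl

lemma baseChange_HatHW (l₁ l₂ : Submodule F (SF Λ F)) :
    (HatHW Λ l₁ l₂).baseChange F =
      (((HW Λ l₁ l₂).baseChange F).map (phiF Λ F)).map (projExt F (H1 Λ) (2 * finrank ℂ U)) := by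
  rw [HatHW, map_baseChange_eq, map_baseChange_eq, baseChange_proj, phiF]

lemma toExt_extProj (k : ℕ) (x : WedgeV Λ) :
    projExt F (H1 Λ) k (toExt F _ x) =
      toExt F _ (GradedAlgebra.proj (fun j : ℕ => ⋀[ℚ]^j (VQ Λ)) k x) :=
  projExt_tmul k 1 x

lemma phiF_one_tmul (a : SQ Λ ⊗[ℚ] SQ Λ) : phiF Λ F (1 ⊗ₜ a) = toExt F _ (phiTau Λ a) :=
  LinearMap.baseChange_tmul _ _ _

/-- Weights of rational spaces of invariants can be computed over an extension field. -/
lemma hasWeight_rat {G : Submonoid (CliffV ℤ (H1Z Λ))} {T : Submodule ℚ (SQ Λ ⊗[ℚ] SQ Λ)} {k : ℕ}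
    (hT : T ≠ ⊥)
    (hfix : ∀ g ∈ G, ∀ x ∈ T.baseChange F,
      (TensorProduct.map (mZ Λ g) (mZ Λ g)).baseChange F x = x)
    (hk : ∀ x ∈ T.baseChange F, phiF Λ F x ∈ filF Λ F k)
    (hk' : ∀ x ∈ T.baseChange F, phiF Λ F x ∈ filF Λ F (k + 1) → phiF Λ F x = 0) :
    HasWeight Λ G ((T.baseChange ℚ).map (phiF Λ ℚ)) k := by
  -- The filtration is cut out by projections defined over `ℚ`, so membership of a rational vector
  -- does not depend on the field.
  have hfil : ∀ (j : ℕ) (a : SQ Λ ⊗[ℚ] SQ Λ),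
      phiF Λ ℚ (1 ⊗ₜ a) ∈ filF Λ ℚ j ↔ phiF Λ F (1 ⊗ₜ a) ∈ filF Λ F j := by
    intro j a
    rw [filF_iff, filF_iff, phiF_one_tmul, phiF_one_tmul]
    refine forall₂_congr fun i _ => ?_
    rw [toExt_extProj, toExt_extProj,
      map_eq_zero_iff _ (toExt_injective _), map_eq_zero_iff _ (toExt_injective _)]
  apply hasWeight_of_invariant
  · intro g hg x hx
    obtain ⟨a, ha, rfl⟩ := exists_of_mem_baseChange_rat hx
    have h := hfix g hg (1 ⊗ₜ a) (Submodule.tmul_mem_baseChange_of_mem _ ha)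
    rw [LinearMap.baseChange_tmul] at h ⊢
    rw [toExt_injective (K := F) _ h]
  · obtain ⟨a, ha, ha0⟩ := Submodule.exists_mem_ne_zero_of_ne_bot hT
    intro h
    have h1 : phiF Λ ℚ (1 ⊗ₜ a) ∈ (⊥ : Submodule ℚ (WedgeF Λ ℚ)) :=
      h ▸ ⟨_, Submodule.tmul_mem_baseChange_of_mem _ ha, rfl⟩
    rw [Submodule.mem_bot, phiF_one_tmul, map_eq_zero_iff _ (toExt_injective _),
      map_eq_zero_iff _ (phiTau_bijective Λ).1] at h1
    exact ha0 h1
  · intro x hx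
    obtain ⟨a, ha, rfl⟩ := exists_of_mem_baseChange_rat hx
    exact (hfil k a).2 (hk _ (Submodule.tmul_mem_baseChange_of_mem _ ha))
  · intro x hx h
    obtain ⟨a, ha, rfl⟩ := exists_of_mem_baseChange_rat hx
    have h1 := hk' _ (Submodule.tmul_mem_baseChange_of_mem _ ha) ((hfil _ a).1 h)
    rw [phiF_one_tmul, map_eq_zero_iff _ (toExt_injective _)] at h1
    rw [phiF_one_tmul, h1, map_zero]

set_option maxHeartbeats 1000000 in
/-- The two pure spinors of a rational secant, and the classes in `H^*(X × X̂)` attached to them. -/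
lemma IsRationalSecant.exists_pureSpinors {σ : F ≃ₐ[ℚ] F} {P : Submodule ℚ (SQ Λ)}
    {l₁ l₂ : Submodule F (SF Λ F)} (hP : IsRationalSecant Λ σ P l₁ l₂) {r : ℕ}
    (hr : r = 2 * finrank ℂ U) {c : F} (hc : c = (-1) ^ finrank ℂ U) :
    ∃ a b : SF Λ F, l₁ = Submodule.span F {a} ∧ l₂ = Submodule.span F {b} ∧ a ≠ 0 ∧
      ((∀ k < r, projExt F (H1 Λ) k (phiF Λ F (tmulF Λ F a a)) = 0) ∧
        projExt F (H1 Λ) r (phiF Λ F (tmulF Λ F a a)) ≠ 0 ∧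
        wedgePow Λ (annW Λ l₁) r =
          Submodule.span F {projExt F (H1 Λ) r (phiF Λ F (tmulF Λ F a a))}) ∧
      ((∀ k < r, projExt F (H1 Λ) k (phiF Λ F (tmulF Λ F b b)) = 0) ∧
        projExt F (H1 Λ) r (phiF Λ F (tmulF Λ F b b)) ≠ 0 ∧
        wedgePow Λ (annW Λ l₂) r =
          Submodule.span F {projExt F (H1 Λ) r (phiF Λ F (tmulF Λ F b b))}) ∧
      Disjoint (Submodule.span F {projExt F (H1 Λ) r (phiF Λ F (tmulF Λ F a a))})
        (Submodule.span F {projExt F (H1 Λ) r (phiF Λ F (tmulF Λ F b b))}) ∧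
      (∀ k < 2, projExt F (H1 Λ) k (phiF Λ F (tmulF Λ F a b + -c • tmulF Λ F b a)) = 0) ∧
      projExt F (H1 Λ) 2 (phiF Λ F (tmulF Λ F a b + -c • tmulF Λ F b a)) ≠ 0 ∧
      projExt F (H1 Λ) 0 (phiF Λ F (tmulF Λ F a b + c • tmulF Λ F b a)) ≠ 0 := by
  obtain ⟨a, hl₁, hae, ha0, haW, hW₁, hr₁⟩ := exists_pureSpinor_of_isPureSpinorLine Λ hP.pure₁
  obtain ⟨b, hl₂, hbe, hb0, hbW, hW₂, hr₂⟩ := exists_pureSpinor_of_isPureSpinorLine Λ hP.pure₂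
  have hPab : P.baseChange F = Submodule.span F {a} ⊔ Submodule.span F {b} := by
    rw [hP.span_eq, hl₁, hl₂]
  have hne : ∃ x ∈ P, ∃ y ∈ P,
      integralBasis (eBasis Λ) (orientationSign Λ) (reverse x * y) ≠ 0 := by
    obtain ⟨x, hx, y, hy, hxy⟩ := hP.nonisotropic
    exact ⟨x, hx, y, hy, by rwa [pairS_eq] at hxy⟩
  have h := pureSpinor_pair (eBasis Λ) (orientationSign_ne_zero Λ) hP.finrank_eq hne hPab
    hae ha0 haW hW₁ hr₁ hbe hb0 hbW hW₂ hr₂ hr hc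
  refine ⟨a, b, hl₁, hl₂, ha0, ?_⟩
  rw [phiF_eq]
  exact h

end

end Torus

end

/-! ### The main theorem -/

set_option maxHeartbeats 4000000 in
theorem mainTheorem9
    {U : Type*} [NormedAddCommGroup U] [NormedSpace ℂ U] [FiniteDimensional ℂ U]
    (Λ : Submodule ℤ U) [DiscreteTopology Λ] [IsZLattice ℝ Λ] (hΛ : IsPolarizable Λ)
    (n : ℕ) (hn : finrank ℂ U = n)
    {K : Type*} [Field K] [NumberField K] (hK : finrank ℚ K = 2)
    (hKim : ∃ d : ℚ, 0 < d ∧ ∃ δ : K, δ ^ 2 = -(d : K))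
    (σ : K ≃ₐ[ℚ] K) (hσ : σ ≠ AlgEquiv.refl)
    (P : Submodule ℚ (SQ Λ)) (l₁ l₂ : Submodule K (SF Λ K))
    (hP : IsRationalSecant Λ σ P l₁ l₂) :
    Function.Bijective (phiTau Λ) ∧
    -- the weight `2n` subrepresentation, over `ℚ` and over `K`
    finrank ℚ (HW Λ l₁ l₂) = 2 ∧
    HasWeight Λ (SpinVP Λ P) (((HW Λ l₁ l₂).baseChange ℚ).map (phiF Λ ℚ)) (2 * n) ∧
    HasWeight Λ (SpinVP Λ P) ((HWF Λ l₁ l₂).map (phiF Λ K)) (2 * n) ∧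
    -- the projection to `H^{2n}`
    Disjoint (wedgePow Λ (annW Λ l₁) (2 * n)) (wedgePow Λ (annW Λ l₂) (2 * n)) ∧
    finrank ℚ (HatHW Λ l₁ l₂) = 2 ∧
    (HatHW Λ l₁ l₂).baseChange K =
      wedgePow Λ (annW Λ l₁) (2 * n) ⊔ wedgePow Λ (annW Λ l₂) (2 * n) ∧
    -- the weights of `l₁ ∧ l₂` and of `l₁ · l₂`
    (Even n →
      HasWeight Λ (SpinVP Λ P) ((wedgeLines Λ l₁ l₂).map (phiF Λ K)) 2 ∧
      HasWeight Λ (SpinVP Λ P) ((symLines Λ l₁ l₂).map (phiF Λ K)) 0) ∧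
    (Odd n →
      HasWeight Λ (SpinVP Λ P) ((symLines Λ l₁ l₂).map (phiF Λ K)) 2 ∧
      HasWeight Λ (SpinVP Λ P) ((wedgeLines Λ l₁ l₂).map (phiF Λ K)) 0) := by
  subst hn
  obtain ⟨r, hr⟩ : ∃ r, r = 2 * finrank ℂ U := ⟨_, rfl⟩
  -- Keeping `c = (-1)^n` abstract treats both parities of `n` at once; it is specialised only in
  -- the last two cases.
  obtain ⟨c, hc⟩ : ∃ c : K, c = (-1) ^ finrank ℂ U := ⟨_, rfl⟩
  rw [← hr]
  obtain ⟨a, b, hl₁, hl₂, ha0, ⟨hya, hya0, hyaS⟩, ⟨hyb, hyb0, hybS⟩, hdisj, hlow, htwo, hzero⟩ :=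
    hP.exists_pureSpinors Λ hr hc
  have haP : a ∈ P.baseChange K := by
    rw [hP.span_eq, hl₁]
    exact Submodule.mem_sup_left (Submodule.mem_span_singleton_self a)
  have hbP : b ∈ P.baseChange K := by
    rw [hP.span_eq, hl₂]
    exact Submodule.mem_sup_right (Submodule.mem_span_singleton_self b)
  have hHWF : HWF Λ l₁ l₂ =
      Submodule.span K {tmulF Λ K a a} ⊔ Submodule.span K {tmulF Λ K b b} := by
    rw [HWF, hl₁, hl₂, tensorLines_span, tensorLines_span]
  have hHW : (HW Λ l₁ l₂).baseChange K = HWF Λ l₁ l₂ :=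
    baseChange_HW Λ hK hKim σ hσ ha0 hl₁ hl₂ hP.conj
  have hHat : (HatHW Λ l₁ l₂).baseChange K =
      wedgePow Λ (annW Λ l₁) r ⊔ wedgePow Λ (annW Λ l₂) r := by
    rw [hyaS, hybS, baseChange_HatHW, hHW, hHWF, ← hr, map_map_span_sup]
  have hfix : ∀ g ∈ SpinVP Λ P, ∀ x ∈ P.baseChange K, ∀ y ∈ P.baseChange K,
      (TensorProduct.map (mZ Λ g) (mZ Λ g)).baseChange K (tmulF Λ K x y) = tmulF Λ K x y :=
    fun g hg x hx y hy => baseChange_map_mZ_tmulF Λ hg hx hy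
  have hfixHW : ∀ g ∈ SpinVP Λ P, ∀ x ∈ HWF Λ l₁ l₂,
      (TensorProduct.map (mZ Λ g) (mZ Λ g)).baseChange K x = x := by
    intro g hg x hx
    rw [hHWF, ← Submodule.span_union, Set.singleton_union, Submodule.mem_span_pair] at hx
    obtain ⟨p, q, rfl⟩ := hx
    rw [map_add, map_smul, map_smul, hfix g hg a haP a haP, hfix g hg b hbP b hbP]
  have hfil : ∀ x ∈ HWF Λ l₁ l₂, phiF Λ K x ∈ filF Λ K r := by
    rw [hHWF]
    change _ ≤ (filF Λ K r).comap (phiF Λ K)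
    rw [sup_le_iff, Submodule.span_singleton_le_iff_mem, Submodule.span_singleton_le_iff_mem]
    exact ⟨(filF_iff Λ r _).2 hya, (filF_iff Λ r _).2 hyb⟩
  have hfil' : ∀ x ∈ HWF Λ l₁ l₂, phiF Λ K x ∈ filF Λ K (r + 1) → phiF Λ K x = 0 := by
    intro x hx h
    rw [hHWF] at hx
    rw [eq_zero_of_map_eq_zero_of_mem_span_sup (projExt K (H1 Λ) r ∘ₗ phiF Λ K) hya0 hyb0 hdisj hx
      ((filF_iff Λ _ _).1 h r r.lt_succ_self), map_zero]
  have hrank : finrank ℚ (HW Λ l₁ l₂) = 2 := by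
    rw [← finrank_submodule_baseChange (K := K), hHW, hHWF]
    refine finrank_sup_span_singleton (fun h => hya0 ?_) (fun h => hyb0 ?_)
      (disjoint_span_of_map (projExt K (H1 Λ) r ∘ₗ phiF Λ K) hya0 hdisj)
    · rw [h, map_zero, map_zero]
    · rw [h, map_zero, map_zero]
  have hfixmix : ∀ p : K, ∀ g ∈ SpinVP Λ P,
      (TensorProduct.map (mZ Λ g) (mZ Λ g)).baseChange K (tmulF Λ K a b + p • tmulF Λ K b a) =
        tmulF Λ K a b + p • tmulF Λ K b a := by
    intro p g hg
    rw [map_add, map_smul, hfix g hg a haP b hbP, hfix g hg b hbP a haP]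
  have hmix : HasWeight Λ (SpinVP Λ P)
        ((Submodule.span K {tmulF Λ K a b + -c • tmulF Λ K b a}).map (phiF Λ K)) 2 ∧
      HasWeight Λ (SpinVP Λ P)
        ((Submodule.span K {tmulF Λ K a b + c • tmulF Λ K b a}).map (phiF Λ K)) 0 :=
    ⟨hasWeight_span Λ (hfixmix _) hlow htwo,
      hasWeight_span Λ (hfixmix _) (fun i hi => absurd hi (Nat.not_lt_zero i)) hzero⟩
  have hwedge : wedgeLines Λ l₁ l₂ =
      Submodule.span K {tmulF Λ K a b + (-1 : K) • tmulF Λ K b a} := by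
    rw [hl₁, hl₂, wedgeLines_span]
  have hsym : symLines Λ l₁ l₂ =
      Submodule.span K {tmulF Λ K a b + (1 : K) • tmulF Λ K b a} := by
    rw [hl₁, hl₂, symLines_span]
  refine ⟨phiTau_bijective Λ, hrank, ?_, ?_, ?_, ?_, hHat, fun hev => ?_, fun hodd => ?_⟩
  · refine hasWeight_rat (F := K) Λ ?_ (hHW ▸ hfixHW) (hHW ▸ hfil) (hHW ▸ hfil')
    intro h
    rw [h, finrank_bot] at hrank
    omega
  · refine hasWeight_of_invariant Λ hfixHW (fun h => hya0 ?_) hfil hfil'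
    have h1 : phiF Λ K (tmulF Λ K a a) ∈ (⊥ : Submodule K (WedgeF Λ K)) := by
      rw [← h, hHWF]
      exact Submodule.mem_map_of_mem
        (Submodule.mem_sup_left (Submodule.mem_span_singleton_self _))
    rw [(Submodule.mem_bot K).1 h1, map_zero]
  · rwa [hyaS, hybS]
  · rw [← finrank_submodule_baseChange (K := K), hHat, hyaS, hybS]
    exact finrank_sup_span_singleton hya0 hyb0 hdisj
  -- For `c = 1` the combination with `-c` is alternating and the one with `c` symmetric; for `c =
  -- -1` the roles are exchanged.
  · rw [hev.neg_one_pow] at hc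
    rwa [hc, ← hwedge, ← hsym] at hmix
  · rw [hodd.neg_one_pow] at hc
    rwa [hc, neg_neg, ← hwedge, ← hsym] at hmix
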